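/- Setting. Let $(\Omega,\mathcal F,\mathbb P)$ be a probability space. For each $N\ge 1$ let $X_1,X_2,\dots$ be random variables, $X_j$ taking values in a measurable space $(\mathcal X_j,\mathcal A_j)$ (the sequence may depend on $N$; no stationarity is assumed), let $g_j:\mathcal X_j\to\mathbb R$ be measurable (possibly depending on $N$) with $\mathbb E[g_j(X_j)]=0$, let $R=R_N$ be a real-valued $\sigma(X_1,\dots,X_N)$-measurable random variable, and put $$S=\sum_{j=1}^N g_j(X_j),\qquad T=S+R,\qquad \sigma_N^2=\operatorname{Var}(S)=\mathbb E[S^2].$$ The $\phi$-mixing coefficients are $$\phi(m)=\sup_{k\ge1}\ \sup_{A\in\sigma(X_1,\dots,X_k),\,\mathbb P(A)>0}\ \sup_{B\in\sigma(X_{k+m},X_{k+m+1},\dots)}|\mathbb P(B\mid A)-\mathbb P(B)|,\qquad m\ge 1.$$ For $1\le j\le N$ and $j-1\le k\le N$ let $R_{j,k}$ be a random variable measurable with respect to $\sigma(X_i: 1\le i\le N,\ i\notin[j,k])$, with $R_{j,j-1}=R$ for $2\le j\le N$ (e.g. also $R_{1,0}=R$), and for $L>0$ let $$\gamma(N;L)=\max\Big\{\big(\mathbb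 E|R_{j,k}-R_{j,k-1}|^{3/2}\big)^{2/3}:\ 1\le j\le k\le N,\ |j-k|\le L\Big\}.$$ Assume that there are constants $\tilde b,b,\rho,\Sigma>0$ and $N_0$ such that (a) $\tilde b N\le \operatorname{Var}(S_N)\le bN$ for all $N\ge N_0$; (b) $\mathbb E|g_j(X_j)|^3\le\rho$ for all $1\le j\le N$ and all $N\geq 1$; (c) $\operatorname{Var}(S_N)\ge\Sigma^2$ for all $N\ge1$. Let $\Phi$ be the standard normal distribution function. 1. (Polynomial mixing.) There are numbers $\varepsilon_p$ with $\varepsilon_p\to0$ as $p\to\infty$ and thresholds $p_0(\varepsilon)$, $\varepsilon>0$, none of which depends on the other data, such that: if $\varepsilon>0$, $p>0$, $p\ge p_0(\varepsilon)$, and $\phi(m)\le Km^{-p}$ for all $m\ge1$ and all $N$, with $K>0$ independent of $N$, then for all $N\ge1$ $$\sup_{x\in\mathbb R}|\mathbb P(T<\sigma_Nx)-\Phi(x)|\le A N^{-1/2+\varepsilon_p}+AN^{-1/2}\,\mathbb E|R|+A\,\gamma(N;N^{\varepsilon})\,N^{\varepsilon_p},$$ where $A>0$ depends only on $p,K,\Sigma,\rho$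 and the constants $\tilde b,N_0$ of (a). 2. (Exponential mixing.) If $\phi(m)\le Ke^{-\lambda m}$ for all $m\ge1$ and all $N$, with $K,\lambda>0$ independent of $N$, then for all $N\ge2$ $$\sup_{x\in\mathbb R}|\mathbb P(T<\sigma_Nx)-\Phi(x)|\le A N^{-1/2}(\log N)^2+AN^{-1/2}\,\mathbb E|R|+A\,\gamma\big(N;(\log N)^3\big)(\log N)^3,$$ where $A>0$ depends only on $\lambda,K,\Sigma,\rho,\tilde b,N_0$. The right-hand sides are understood as $+\infty$ when $\mathbb E|R|$ or $\gamma$ is infinite. -/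

import Mathlib

open MeasureTheory ProbabilityTheory Set Filter Topology
open scoped ENNReal

universe u v

noncomputable section

namespace WeakDependence

/-- The σ-algebra on `Ω` generated by the random variables `X j`, `j ∈ s`. -/
abbrev sigmaGen {Ω : Type u} {𝒳 : ℕ → Type v} [∀ j, MeasurableSpace (𝒳 j)]
    (X : ∀ j, Ω → 𝒳 j) (s : Set ℕ) : MeasurableSpace Ω :=
  ⨆ j ∈ s, MeasurableSpace.comap (X j) inferInstance

/-- The `m`-th φ-mixing coefficient of the sequence `X 1, X 2, …`: the supremum of
`|P(B | A) - P(B)|` over `k ≥ 1`, `A ∈ σ(X 1, …, X k)` with `P(A) > 0`, and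
`B ∈ σ(X (k+m), X (k+m+1), …)`. -/
def phiMixing {Ω : Type u} [MeasurableSpace Ω] (P : Measure Ω) {𝒳 : ℕ → Type v}
    [∀ j, MeasurableSpace (𝒳 j)] (X : ∀ j, Ω → 𝒳 j) (m : ℕ) : ℝ :=
  sSup {x : ℝ | ∃ k : ℕ, 1 ≤ k ∧ ∃ A B : Set Ω,
    MeasurableSet[sigmaGen X (Icc 1 k)] A ∧ P A ≠ 0 ∧
    MeasurableSet[sigmaGen X (Ici (k + m))] B ∧
    x = |(P[|A]).real B - P.real B|}

/-- A statistic `T = S + R` of the sample `X 1, …, X N`, with linear part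
`S = ∑_{j=1}^N g j (X j)` centred termwise, and with leave-block-out remainders
`Rout j k` (for `1 ≤ j ≤ k ≤ N`, and for the empty block `k = j - 1`). The value of `X` at the
index `0` plays no role. -/
structure Statistic {Ω : Type u} [MeasurableSpace Ω] (P : Measure Ω) (𝒳 : ℕ → Type v)
    [∀ j, MeasurableSpace (𝒳 j)] (N : ℕ) where
  X : ∀ j, Ω → 𝒳 j
  g : ∀ j, 𝒳 j → ℝ
  R : Ω → ℝ
  Rout : ℕ → ℕ → Ω → ℝ
  measurable_X : ∀ j, 1 ≤ j → Measurable (X j)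
  measurable_g : ∀ j, 1 ≤ j → j ≤ N → Measurable (g j)
  integrable_g : ∀ j, 1 ≤ j → j ≤ N → Integrable (fun ω => g j (X j ω)) P
  centered_g : ∀ j, 1 ≤ j → j ≤ N → ∫ ω, g j (X j ω) ∂P = 0
  measurable_R : Measurable[sigmaGen X (Icc 1 N)] R
  measurable_Rout : ∀ j k, 1 ≤ j → j ≤ N → j ≤ k + 1 → k ≤ N →
    Measurable[sigmaGen X (Icc 1 N \ Icc j k)] (Rout j k)
  Rout_empty : ∀ j, 2 ≤ j → j ≤ N → Rout j (j - 1) = R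

namespace Statistic

variable {Ω : Type u} [MeasurableSpace Ω] {P : Measure Ω} {𝒳 : ℕ → Type v}
  [∀ j, MeasurableSpace (𝒳 j)] {N : ℕ}

/-- The linear part `S = ∑_{j=1}^N g_j(X_j)`. -/
def S (D : Statistic P 𝒳 N) (ω : Ω) : ℝ := ∑ j ∈ Finset.Icc 1 N, D.g j (D.X j ω)

/-- The statistic `T = S + R`. -/
def T (D : Statistic P 𝒳 N) (ω : Ω) : ℝ := D.S ω + D.R ω

/-- `σ_N`, the standard deviation of `S`. -/
def sd (D : Statistic P 𝒳 N) : ℝ := Real.sqrt (Var[D.S; P])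

/-- `γ`: the largest `L^{3/2}` norm of `R_{j,k} - R_{j,k-1}` over `1 ≤ j ≤ k ≤ N` with
`|j - k| ≤ L`. -/
def gamma (D : Statistic P 𝒳 N) (L : ℝ) : ℝ≥0∞ :=
  ⨆ (j : ℕ) (k : ℕ) (_ : 1 ≤ j ∧ j ≤ k ∧ k ≤ N ∧ |(j : ℝ) - (k : ℝ)| ≤ L),
    eLpNorm (fun ω => D.Rout j k ω - D.Rout j (k - 1) ω) (3 / 2) P

/-- `E|R|`, possibly infinite. -/
def meanAbsR (D : Statistic P 𝒳 N) : ℝ≥0∞ := ∫⁻ ω, ‖D.R ω‖ₑ ∂P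

/-- `sup_x |P(T < σ_N x) - Φ(x)|`. -/
def normalDist (D : Statistic P 𝒳 N) : ℝ≥0∞ :=
  ⨆ x : ℝ, ENNReal.ofReal
    |P.real {ω | D.T ω < D.sd * x} - cdf (gaussianReal 0 1) x|

end Statistic

/-- The assumptions other than the mixing rate, for a statistic `D N` for each sample size `N`:
linear growth of the variance from `N₀` on, uniformly bounded third absolute moments, and
variance bounded below. -/
structure MomentAssumptions {Ω : Type u} [MeasurableSpace Ω] {P : Measure Ω} {𝒳 : ℕ → Type v}
    [∀ j, MeasurableSpace (𝒳 j)] (D : ∀ N, Statistic P 𝒳 N)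
    (b' b : ℝ) (N₀ : ℕ) (ρ Sig : ℝ) : Prop where
  variance_linear : ∀ N, 1 ≤ N → N₀ ≤ N →
    b' * N ≤ Var[(D N).S; P] ∧ Var[(D N).S; P] ≤ b * N
  third_moment : ∀ N j, 1 ≤ j → j ≤ N →
    ∫⁻ ω, ‖(D N).g j ((D N).X j ω)‖ₑ ^ 3 ∂P ≤ ENNReal.ofReal ρ
  variance_lower : ∀ N, 1 ≤ N → Sig ^ 2 ≤ Var[(D N).S; P]

end WeakDependence

end

/-! The method is Tikhomirov's. With W = T/σ_N, the characteristic function f(t) = E exp(itW) nearly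
satisfies f' = -t f, the equation of exp(-t²/2). Comparison of the two functions
(`norm_sub_exp_le_of_deriv`) and Esseen's smoothing inequality (`exists_smoothing_constant`) turn
this into a bound for the distribution functions.

Since f' = i E[W exp(itW)], one needs E[Y_j exp(itW)] for each normalized summand Y_j; the remainder
contributes at most E|R|/σ_N. In exp(itW) the remainder is first replaced by the one which leaves
out a block around j. Telescoping bounds the change by the block length times γ, and Hölder with
exponents 3 and 3/2 pairs it with Y_j. What is left is peeled into rings of width ℓ around j by
iterating exp(itV_k) = exp(itV_{k+1}) + (exp(it y_k) - 1) exp(itV_{k+1}), where V_k omits the rings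
of index below k. Each omitted ring is a gap across which mixing factorizes the expectation. A
product of m factors exp(it y) - 1 has mean of order 16^{-m}, because every second factor is almost
independent of the preceding ones and has small mean. The first-order terms in t form it times the
variance of Y_j plus its covariances with the sites within ℓ; summed over j these give almost 1.

The decisive point is that the second-order error carries a factor |f(t)|. `norm_mean_le` shows that
omitting k rings multiplies the modulus of the characteristic function by at most 2^k, up to a tiny
error, and 16^{-m} beats this growth. An error a t²|f(t)| costs only a in the distance, whereas a t²
alone would cost aT, of order one for the cutoff T ~ √N/ℓ² used with a ~ ℓ²/√N.

Mixing enters through strong mixing between a window and both of its sides, with coefficient 3φ(ℓ)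
(`abs_measure_inter_sub_le_of_sup`), and a covariance inequality for third moments
(`StrongMixing.norm_cov_le`). About log N rings are used, and ℓ is chosen so that 3φ(ℓ) ≤ N^{-27}: ℓ
~ log N for exponential rates, ℓ ~ N^{28/p} for polynomial ones. -/

namespace WeakDependence

/-! ### From one-sided φ-mixing to strong mixing between a window and both of its sides. -/

section Mixing

variable {Ω : Type*}

/-- Sets cut out by finitely many `c`-measurable sets along a finite `a`-measurable partition. -/
def finiteCombinations (a c : MeasurableSpace Ω) : Set (Set Ω) :=
  {D | ∃ (n : ℕ) (h : Ω → Fin n) (F : Fin n → Set Ω), (∀ i, MeasurableSet[a] (h ⁻¹' {i})) ∧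
    (∀ i, MeasurableSet[c] (F i)) ∧ D = {ω | ω ∈ F (h ω)}}

/-- On the common refinement of the two partitions each set is a fixed `c`-measurable set on every
cell, so an operation that is decided point by point (`hp`) acts cell by cell. -/
lemma finiteCombinations_combine {a c : MeasurableSpace Ω} {D E : Set Ω}
    (hD : D ∈ finiteCombinations a c) (hE : E ∈ finiteCombinations a c)
    (op : Set Ω → Set Ω → Set Ω)
    (hop : ∀ s t, MeasurableSet[c] s → MeasurableSet[c] t → MeasurableSet[c] (op s t))
    (hp : ∀ (s t s' t' : Set Ω) (ω : Ω), (ω ∈ s ↔ ω ∈ s') → (ω ∈ t ↔ ω ∈ t') →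
      (ω ∈ op s t ↔ ω ∈ op s' t')) :
    op D E ∈ finiteCombinations a c := by
  obtain ⟨n, h, F, hh, hF, rfl⟩ := hD
  obtain ⟨m, h', F', hh', hF', rfl⟩ := hE
  refine ⟨n * m, fun ω => finProdFinEquiv (h ω, h' ω),
    fun i => op (F (finProdFinEquiv.symm i).1) (F' (finProdFinEquiv.symm i).2), fun i => ?_,
    fun i => hop _ _ (hF _) (hF' _), ?_⟩
  · have : (fun ω => finProdFinEquiv (h ω, h' ω)) ⁻¹' {i}
        = h ⁻¹' {(finProdFinEquiv.symm i).1} ∩ h' ⁻¹' {(finProdFinEquiv.symm i).2} := by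
      ext ω
      simp only [mem_preimage, mem_singleton_iff, mem_inter_iff]
      rw [← Equiv.eq_symm_apply, Prod.ext_iff]
    rw [this]
    exact MeasurableSet.inter (hh _) (hh' _)
  · ext ω
    simp only [mem_ofPred_eq, Equiv.symm_apply_apply]
    exact hp _ _ _ _ _ Iff.rfl Iff.rfl

lemma left_subset_finiteCombinations {a c : MeasurableSpace Ω} {A : Set Ω}
    (hA : MeasurableSet[a] A) : A ∈ finiteCombinations a c := by
  classical
  refine ⟨2, fun ω => if ω ∈ A then 1 else 0, fun i => if i = 1 then univ else ∅, fun i => ?_,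
    fun i => ?_, ?_⟩
  · fin_cases i
    · convert hA.compl using 1
      ext ω
      by_cases h : ω ∈ A <;> simp [h]
    · convert hA using 1
      ext ω
      by_cases h : ω ∈ A <;> simp [h]
  · by_cases hi : i = 1
    · simp only [hi, if_true]; exact MeasurableSet.univ
    · simp only [hi, if_false]; exact MeasurableSet.empty
  · ext ω
    by_cases h : ω ∈ A <;> simp [h]

lemma right_subset_finiteCombinations {a c : MeasurableSpace Ω} {A : Set Ω}
    (hA : MeasurableSet[c] A) : A ∈ finiteCombinations a c := by
  refine ⟨1, fun _ => 0, fun _ => A, fun i => ?_, fun _ => hA, by simp⟩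
  have : (fun _ : Ω => (0 : Fin 1)) ⁻¹' {i} = univ := by
    ext ω; simp [Subsingleton.elim (0 : Fin 1) i]
  rw [this]; exact MeasurableSet.univ

lemma isSetRing_finiteCombinations (a c : MeasurableSpace Ω) :
    IsSetRing (finiteCombinations a c) where
  empty_mem := left_subset_finiteCombinations (a := a) (@MeasurableSet.empty _ a)
  union_mem s t hs ht := finiteCombinations_combine hs ht (· ∪ ·)
    (fun _ _ h h' => MeasurableSet.union h h') (by intros; simp_all)
  sdiff_mem s t hs ht := finiteCombinations_combine hs ht (· \ ·)
    (fun _ _ h h' => MeasurableSet.diff h h') (by intros; simp_all)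

lemma measurableSet_of_mem_finiteCombinations {a c : MeasurableSpace Ω} {D : Set Ω}
    (hD : D ∈ finiteCombinations a c) : MeasurableSet[a ⊔ c] D := by
  obtain ⟨n, h, F, hh, hF, rfl⟩ := hD
  have : {ω | ω ∈ F (h ω)} = ⋃ i, (h ⁻¹' {i} ∩ F i) := by
    ext ω; simp
  rw [this]
  have h1 : a ≤ a ⊔ c := le_sup_left
  have h2 : c ≤ a ⊔ c := le_sup_right
  exact MeasurableSet.iUnion fun i => MeasurableSet.inter (h1 _ (hh i)) (h2 _ (hF i))

lemma generateFrom_finiteCombinations (a c : MeasurableSpace Ω) :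
    a ⊔ c = MeasurableSpace.generateFrom (finiteCombinations a c) := by
  apply le_antisymm
  · refine sup_le ?_ ?_
    · intro s hs
      exact MeasurableSpace.measurableSet_generateFrom (left_subset_finiteCombinations hs)
    · intro s hs
      exact MeasurableSpace.measurableSet_generateFrom (right_subset_finiteCombinations hs)
  · exact MeasurableSpace.generateFrom_le fun t ht => measurableSet_of_mem_finiteCombinations ht

/-- A ring is dense, in measure, in the σ-algebra it generates. The measure is trimmed to `a ⊔ c`
because that is the σ-algebra generated by the ring. -/
lemma exists_finiteCombination_near {a c : MeasurableSpace Ω} [mΩ : MeasurableSpace Ω]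
    {P : Measure Ω} [IsProbabilityMeasure P]
    (ha : a ≤ mΩ) (hc : c ≤ mΩ) {D : Set Ω} (hD : MeasurableSet[a ⊔ c] D) {ε : ℝ} (hε : 0 < ε) :
    ∃ E ∈ finiteCombinations a c, P.real (symmDiff E D) < ε := by
  have hac : a ⊔ c ≤ mΩ := sup_le ha hc
  obtain ⟨t, ht, hlt⟩ := @exists_measure_symmDiff_lt_of_generateFrom_isSetRing Ω (a ⊔ c)
    (P.trim hac) _ _ (isSetRing_finiteCombinations a c)
    ⟨{univ}, countable_singleton _, by
      simpa using left_subset_finiteCombinations (c := c) (@MeasurableSet.univ _ a), by simp⟩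
    (generateFrom_finiteCombinations a c) D hD (ENNReal.ofReal ε) (by simpa using hε)
  refine ⟨t, ht, ?_⟩
  have h1 : MeasurableSet[a ⊔ c] (symmDiff t D) :=
    MeasurableSet.symmDiff (measurableSet_of_mem_finiteCombinations ht) hD
  rw [trim_measurableSet_eq hac h1] at hlt
  rw [Measure.real]
  exact (ENNReal.lt_ofReal_iff_toReal_lt (measure_ne_top _ _)).1 hlt

/-- Two-sided decoupling: if the past `a` is `q`-mixing with respect to `b ⊔ c`, and `b` with
respect to the future `c`, then `b` is `3 q`-strongly mixing with respect to `a ⊔ c`. -/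
lemma abs_measure_inter_sub_le_of_sup {a b c : MeasurableSpace Ω} [mΩ : MeasurableSpace Ω]
    {P : Measure Ω} [IsProbabilityMeasure P]
    (ha : a ≤ mΩ) (hb : b ≤ mΩ) (hc : c ≤ mΩ) {q : ℝ}
    (h1 : ∀ A B, MeasurableSet[a] A → MeasurableSet[b ⊔ c] B →
      |P.real (A ∩ B) - P.real A * P.real B| ≤ q * P.real A)
    (h2 : ∀ A B, MeasurableSet[b] A → MeasurableSet[c] B →
      |P.real (A ∩ B) - P.real A * P.real B| ≤ q * P.real A)
    {D M : Set Ω} (hD : MeasurableSet[a ⊔ c] D) (hM : MeasurableSet[b] M) :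
    |P.real (D ∩ M) - P.real D * P.real M| ≤ 3 * q := by
  have hq : 0 ≤ q := by
    have := h1 univ univ (@MeasurableSet.univ _ a) (@MeasurableSet.univ _ (b ⊔ c))
    simpa using (abs_nonneg _).trans this
  have hM1 : P.real M ≤ 1 := measureReal_le_one
  have hM0 : 0 ≤ P.real M := measureReal_nonneg
  have key : ∀ E ∈ finiteCombinations a c,
      |P.real (E ∩ M) - P.real E * P.real M| ≤ 3 * q := by
    rintro E ⟨n, h, F, hh, hF, rfl⟩
    have hsum : ∀ B : Set Ω, MeasurableSet B → P.real B = ∑ i, P.real (h ⁻¹' {i} ∩ B) := by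
      intro B hB
      rw [← measureReal_biUnion_finset]
      · congr 1
        ext ω; simp
      · intro i _ j _ hij
        exact (Disjoint.preimage h (by simpa using hij)).mono inter_subset_left inter_subset_left
      · intro i _
        exact (ha _ (hh i)).inter hB
    have hE : MeasurableSet {ω | ω ∈ F (h ω)} :=
      sup_le ha hc _ (measurableSet_of_mem_finiteCombinations ⟨n, h, F, hh, hF, rfl⟩)
    have e1 : ∀ i, h ⁻¹' {i} ∩ {ω | ω ∈ F (h ω)} = h ⁻¹' {i} ∩ F i := by
      intro i; ext ω
      simp only [mem_inter_iff, mem_preimage, mem_singleton_iff, mem_ofPred_eq]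
      constructor
      · rintro ⟨rfl, h⟩; exact ⟨rfl, h⟩
      · rintro ⟨rfl, h⟩; exact ⟨rfl, h⟩
    rw [hsum _ (hE.inter (hb _ hM)), hsum _ hE, Finset.sum_mul, ← Finset.sum_sub_distrib]
    have hone : ∑ i, P.real (h ⁻¹' {i}) = 1 := by
      have := hsum univ MeasurableSet.univ
      simpa using this.symm
    calc _ ≤ ∑ i, |P.real (h ⁻¹' {i} ∩ ({ω | ω ∈ F (h ω)} ∩ M))
          - P.real (h ⁻¹' {i} ∩ {ω | ω ∈ F (h ω)}) * P.real M| := Finset.abs_sum_le_sum_abs _ _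
      _ ≤ ∑ i, 3 * q * P.real (h ⁻¹' {i}) := by
        refine Finset.sum_le_sum fun i _ => ?_
        rw [← inter_assoc, e1, inter_assoc]
        have hb' : b ≤ b ⊔ c := le_sup_left
        have hc' : c ≤ b ⊔ c := le_sup_right
        have t1 := h1 _ _ (hh i) (MeasurableSet.inter (hc' _ (hF i)) (hb' _ hM))
        have t2 := h2 _ _ hM (hF i)
        have t3 := h1 _ _ (hh i) (hc' _ (hF i))
        rw [inter_comm M] at t2
        have hA0 : 0 ≤ P.real (h ⁻¹' {i}) := measureReal_nonneg
        set A := P.real (h ⁻¹' {i})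
        set x := P.real (h ⁻¹' {i} ∩ (F i ∩ M))
        set y := P.real (F i ∩ M)
        set z := P.real (h ⁻¹' {i} ∩ F i)
        set f := P.real (F i)
        set m := P.real M
        -- Three decouplings: the cell from `F i ∩ M`, then `M` from `F i`, then the cell from `F
        -- i`. Each costs at most `q` times the probability of the cell, so the costs sum to `3 * q`
        -- whatever the number of cells. This is where the factor `P(A)` in the φ-mixing bound is
        -- indispensable.
        have : x - z * m = (x - A * y) + A * (y - m * f) - m * (z - A * f) := by ring
        rw [this]
        have s2 : |A * (y - m * f)| ≤ A * q := by
          rw [abs_mul, abs_of_nonneg hA0]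
          exact mul_le_mul_of_nonneg_left (t2.trans (by nlinarith)) hA0
        have s3 : |m * (z - A * f)| ≤ q * A := by
          rw [abs_mul, abs_of_nonneg hM0]
          nlinarith [abs_nonneg (z - A * f)]
        calc _ ≤ |x - A * y| + |A * (y - m * f)| + |m * (z - A * f)| :=
              (abs_sub _ _).trans (by gcongr; exact abs_add_le _ _)
          _ ≤ _ := by linarith
      _ = 3 * q := by rw [← Finset.mul_sum, hone, mul_one]
  -- A general `D` is approximated by a finite combination; the bound in `key` does not depend on
  -- the number of cells and survives the limit.
  refine le_of_forall_pos_le_add fun ε hε => ?_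
  obtain ⟨E, hE, hlt⟩ := exists_finiteCombination_near (P := P) ha hc hD (half_pos hε)
  have hEm := sup_le ha hc _ (measurableSet_of_mem_finiteCombinations hE)
  have hDm := sup_le ha hc _ hD
  have d1 : |P.real (E ∩ M) - P.real (D ∩ M)| ≤ ε / 2 := by
    refine (abs_measureReal_sub_le_measureReal_symmDiff (hEm.inter (hb _ hM)).nullMeasurableSet
      (hDm.inter (hb _ hM)).nullMeasurableSet).trans ((measureReal_mono ?_).trans hlt.le)
    intro ω; simp only [mem_symmDiff, mem_inter_iff]; tauto
  have d2 : |P.real E - P.real D| ≤ ε / 2 :=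
    (abs_measureReal_sub_le_measureReal_symmDiff hEm.nullMeasurableSet
      hDm.nullMeasurableSet).trans hlt.le
  have d3 := key E hE
  have d4 : |(P.real E - P.real D) * P.real M| ≤ ε / 2 := by
    rw [abs_mul, abs_of_nonneg hM0]; nlinarith [abs_nonneg (P.real E - P.real D)]
  rw [abs_le] at *
  constructor <;> nlinarith

variable {𝒳 : ℕ → Type*} [∀ j, MeasurableSpace (𝒳 j)]

lemma sigmaGen_mono (X : ∀ j, Ω → 𝒳 j) {s t : Set ℕ} (h : s ⊆ t) :
    sigmaGen X s ≤ sigmaGen X t := biSup_mono h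

lemma sigmaGen_le [mΩ : MeasurableSpace Ω] (X : ∀ j, Ω → 𝒳 j) {s : Set ℕ} (h : ∀ j ∈ s, Measurable (X j)) :
    sigmaGen X s ≤ mΩ := iSup₂_le fun j hj => (h j hj).comap_le

lemma sigmaGen_union_le (X : ∀ j, Ω → 𝒳 j) {s t r : Set ℕ} (h : r ⊆ s ∪ t) :
    sigmaGen X r ≤ sigmaGen X s ⊔ sigmaGen X t := by
  refine iSup₂_le fun j hj => ?_
  rcases h hj with h | h
  · exact (le_iSup₂_of_le (f := fun j (_ : j ∈ s) => MeasurableSpace.comap (X j) inferInstance)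
      j h le_rfl).trans le_sup_left
  · exact (le_iSup₂_of_le (f := fun j (_ : j ∈ t) => MeasurableSpace.comap (X j) inferInstance)
      j h le_rfl).trans le_sup_right

lemma measurable_sigmaGen (X : ∀ j, Ω → 𝒳 j) {s : Set ℕ} {j : ℕ} (hj : j ∈ s) :
    Measurable[sigmaGen X s] (X j) := by
  rw [measurable_iff_comap_le]
  exact le_iSup₂_of_le (f := fun j (_ : j ∈ s) => MeasurableSpace.comap (X j) inferInstance)
    j hj le_rfl

variable [mΩ : MeasurableSpace Ω] {P : Measure Ω}

lemma phiMixing_nonneg [IsProbabilityMeasure P] (X : ∀ j, Ω → 𝒳 j) (m : ℕ) :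
    0 ≤ phiMixing P X m := by
  refine Real.sSup_nonneg ?_
  rintro x ⟨k, _, A, B, _, _, _, rfl⟩
  exact abs_nonneg _

lemma abs_measure_inter_sub_le_phiMixing [IsProbabilityMeasure P] {X : ∀ j, Ω → 𝒳 j}
    (hX : ∀ j, 1 ≤ j → Measurable (X j)) {m k : ℕ} (hk : 1 ≤ k) {A B : Set Ω}
    (hA : MeasurableSet[sigmaGen X (Icc 1 k)] A) (hB : MeasurableSet[sigmaGen X (Ici (k + m))] B) :
    |P.real (A ∩ B) - P.real A * P.real B| ≤ phiMixing P X m * P.real A := by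
  have hAm : MeasurableSet A := sigmaGen_le X (fun j hj => hX j hj.1) _ hA
  by_cases h0 : P A = 0
  · have h1 : P.real A = 0 := by simp [Measure.real, h0]
    have h2 : P.real (A ∩ B) = 0 := by
      simp [Measure.real, measure_mono_null inter_subset_left h0]
    simp [h1, h2]
  · have hle : |(P[|A]).real B - P.real B| ≤ phiMixing P X m := by
      -- The bound by 1 matters: the real `sSup` of an unbounded set would be 0.
      refine le_csSup ⟨1, ?_⟩ ⟨k, hk, A, B, hA, h0, hB, rfl⟩
      rintro x ⟨k, _, A, B, _, h, _, rfl⟩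
      have : IsProbabilityMeasure (P[|A]) := cond_isProbabilityMeasure h
      exact abs_sub_le_of_nonneg_of_le measureReal_nonneg measureReal_le_one measureReal_nonneg
        measureReal_le_one
    have hpos : 0 < P.real A := ENNReal.toReal_pos h0 (measure_ne_top _ _)
    have hc : (P[|A]).real B = (P.real A)⁻¹ * P.real (A ∩ B) := by
      simp [Measure.real, cond_apply hAm, ENNReal.toReal_mul, ENNReal.toReal_inv]
    rw [hc] at hle
    have : P.real (A ∩ B) - P.real A * P.real B
        = ((P.real A)⁻¹ * P.real (A ∩ B) - P.real B) * P.real A := by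
      field_simp
    rw [this, abs_mul, abs_of_pos hpos]
    gcongr

/-- The `σ`-algebras of a window and of the complement of its `m`-neighbourhood are strongly
mixing, with coefficient at most `3 φ(m)`. -/
lemma abs_measure_inter_sub_le_of_window [IsProbabilityMeasure P] {X : ∀ j, Ω → 𝒳 j}
    (hX : ∀ j, 1 ≤ j → Measurable (X j)) {m p q : ℕ} (hp : 1 ≤ p) (hpq : p ≤ q)
    {s t : Set ℕ} (hs : s ⊆ Icc p q) (ht : ∀ i ∈ t, 1 ≤ i ∧ (i + m ≤ p ∨ q + m ≤ i))
    {D M : Set Ω} (hD : MeasurableSet[sigmaGen X t] D) (hM : MeasurableSet[sigmaGen X s] M) :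
    |P.real (D ∩ M) - P.real D * P.real M| ≤ 3 * phiMixing P X m := by
  have hle : ∀ s : Set ℕ, s ⊆ Ici 1 → sigmaGen X s ≤ mΩ :=
    fun s hs => sigmaGen_le X fun j hj => hX j (hs hj)
  refine abs_measure_inter_sub_le_of_sup (a := sigmaGen X (Icc 1 (p - m)))
    (b := sigmaGen X (Icc p q)) (c := sigmaGen X (Ici (q + m))) (hle _ fun i hi => hi.1)
    (hle _ fun i hi => hp.trans hi.1)
    (hle _ fun i hi => (hp.trans hpq).trans ((Nat.le_add_right _ _).trans hi)) ?_ ?_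
    (D := D) (M := M) (sigmaGen_union_le X ?_ _ hD) (sigmaGen_mono X hs _ hM)
  · intro A B hA hB
    -- If `p ≤ m`, there is no index at distance `m` to the left of the window. The truncated
    -- difference makes the past an empty index set, whose σ-algebra is trivial.
    by_cases hpm : m < p
    · refine abs_measure_inter_sub_le_phiMixing hX (k := p - m) (by omega) hA
        ((sup_le (sigmaGen_mono X ?_) (sigmaGen_mono X ?_)) _ hB)
      · intro i hi; simp only [mem_Icc, mem_Ici] at *; omega
      · intro i hi; simp only [mem_Ici] at *; omega
    · have he : Icc 1 (p - m) = ∅ := Icc_eq_empty (by omega)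
      rw [he] at hA
      have : sigmaGen X (∅ : Set ℕ) = ⊥ := by simp [sigmaGen]
      rw [this, MeasurableSpace.measurableSet_bot_iff] at hA
      have := phiMixing_nonneg (P := P) X m
      rcases hA with rfl | rfl <;> simp [this]
  · intro A B hA hB
    refine abs_measure_inter_sub_le_phiMixing hX (k := q) (by omega) (sigmaGen_mono X ?_ _ hA) hB
    intro i hi; simp only [mem_Icc] at *; omega
  · intro i hi
    obtain ⟨h1, h2 | h2⟩ := ht i hi
    · left; simp only [mem_Icc]; omega
    · right; exact h2

end Mixing

end WeakDependence

namespace WeakDependence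

/-! ### Covariance inequalities under strong mixing. -/

section Covariance

variable {Ω : Type*}

/-- The strong mixing coefficient of the `σ`-algebras `a` and `c` is at most `ψ`. -/
def StrongMixing [MeasurableSpace Ω] (P : Measure Ω) (a c : MeasurableSpace Ω) (ψ : ℝ) : Prop :=
  ∀ M D : Set Ω, MeasurableSet[a] M → MeasurableSet[c] D →
    |P.real (M ∩ D) - P.real M * P.real D| ≤ ψ

/-- Layer cake: the integral of `Y` is the integral over `t ∈ (0, 1]` of the measure of `{Y > t}`,
and the bound holds for each `t`. -/
lemma abs_integral_sub_le_of_forall_measurableSet {m : MeasurableSpace Ω}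
    [mΩ : MeasurableSpace Ω] (hm : m ≤ mΩ) {μ ν : Measure Ω} [IsFiniteMeasure μ]
    [IsFiniteMeasure ν] {ψ : ℝ}
    (h : ∀ B, MeasurableSet[m] B → |μ.real B - ν.real B| ≤ ψ) {Y : Ω → ℝ}
    (hY : Measurable[m] Y) (h0 : ∀ ω, 0 ≤ Y ω) (h1 : ∀ ω, Y ω ≤ 1) :
    |∫ ω, Y ω ∂μ - ∫ ω, Y ω ∂ν| ≤ ψ := by
  have hYm : Measurable Y := hY.mono hm le_rfl
  have hi : ∀ κ : Measure Ω, IsFiniteMeasure κ → Integrable Y κ := fun κ _ =>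
    Integrable.of_bound hYm.aestronglyMeasurable 1
      (Eventually.of_forall fun ω => by rw [Real.norm_eq_abs, abs_of_nonneg (h0 ω)]; exact h1 ω)
  have hlc : ∀ κ : Measure Ω, IsFiniteMeasure κ →
      ∫ ω, Y ω ∂κ = ∫ t in Ioc (0 : ℝ) 1, κ.real {ω | t < Y ω} := by
    intro κ hκ
    rw [(hi κ hκ).integral_eq_integral_meas_lt (Eventually.of_forall h0)]
    refine (setIntegral_eq_of_subset_of_forall_sdiff_eq_zero measurableSet_Ioi
      Ioc_subset_Ioi_self fun t ht => ?_)
    have : {ω | t < Y ω} = ∅ := by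
      ext ω
      simp only [Set.mem_sdiff, mem_Ioi, mem_Ioc, not_and, not_le] at ht
      have := ht.2 ht.1
      simp only [mem_ofPred_eq, mem_empty_iff_false, iff_false, not_lt]
      linarith [h1 ω]
    simp [this]
  have hint : ∀ κ : Measure Ω, IsFiniteMeasure κ →
      IntegrableOn (fun t => κ.real {ω | t < Y ω}) (Ioc (0 : ℝ) 1) := by
    intro κ hκ
    refine Measure.integrableOn_of_bounded (M := κ.real univ) (by simp) ?_ ?_
    · refine (Antitone.measurable fun s t hst => ?_).aestronglyMeasurable
      exact measureReal_mono fun ω (hω : t < Y ω) => hst.trans_lt hω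
    · refine Eventually.of_forall fun t => ?_
      rw [Real.norm_eq_abs, abs_of_nonneg measureReal_nonneg]
      exact measureReal_mono (subset_univ _)
  rw [hlc μ inferInstance, hlc ν inferInstance,
    ← integral_sub (hint μ inferInstance) (hint ν inferInstance)]
  have := norm_setIntegral_le_of_norm_le_const (μ := volume) (s := Ioc (0 : ℝ) 1) (C := ψ)
    (f := fun t => μ.real {ω | t < Y ω} - ν.real {ω | t < Y ω}) (by simp)
    fun t _ => h _ (measurableSet_lt measurable_const hY)
  simpa using this

/-- The layer-cake comparison is used twice: for `Y`, between `P` restricted to `D` and `P(D) • P`;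
then for `F`, between the measure with density `Y` and `E[Y] • P`. -/
lemma StrongMixing.abs_cov_le_of_mem_unit {a c : MeasurableSpace Ω} [mΩ : MeasurableSpace Ω]
    {P : Measure Ω} [IsProbabilityMeasure P] {ψ : ℝ} (h : StrongMixing P a c ψ) (ha : a ≤ mΩ)
    (hc : c ≤ mΩ) {Y F : Ω → ℝ} (hY : Measurable[a] Y) (hF : Measurable[c] F)
    (hY0 : ∀ ω, 0 ≤ Y ω) (hY1 : ∀ ω, Y ω ≤ 1) (hF0 : ∀ ω, 0 ≤ F ω) (hF1 : ∀ ω, F ω ≤ 1) :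
    |∫ ω, Y ω * F ω ∂P - (∫ ω, Y ω ∂P) * ∫ ω, F ω ∂P| ≤ ψ := by
  have hYm : Measurable Y := hY.mono ha le_rfl
  have hFm : Measurable F := hF.mono hc le_rfl
  have hYi : Integrable Y P := Integrable.of_bound hYm.aestronglyMeasurable 1
      (Eventually.of_forall fun ω => by rw [Real.norm_eq_abs, abs_of_nonneg (hY0 ω)]; exact hY1 ω)
  have hYint0 : 0 ≤ ∫ ω, Y ω ∂P := integral_nonneg hY0
  have step : ∀ D, MeasurableSet[c] D →
      |∫ ω in D, Y ω ∂P - (∫ ω, Y ω ∂P) * P.real D| ≤ ψ := by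
    intro D hD
    have := abs_integral_sub_le_of_forall_measurableSet ha (μ := P.restrict D)
      (ν := (P D).toNNReal • P) (ψ := ψ) (fun B hB => ?_) hY hY0 hY1
    · rw [integral_smul_nnreal_measure, NNReal.smul_def, smul_eq_mul, mul_comm] at this
      exact this
    · have := h B D hB hD
      rw [measureReal_restrict_apply (ha _ hB), measureReal_nnreal_smul_apply]
      rw [mul_comm] at this
      exact this
  let w : Ω → NNReal := fun ω => (Y ω).toNNReal
  have hw : Measurable w := hYm.real_toNNReal
  have hwi : ∀ D, ∫⁻ ω in D, (w ω : ℝ≥0∞) ∂P = ENNReal.ofReal (∫ ω in D, Y ω ∂P) := fun D =>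
    (ofReal_integral_eq_lintegral_ofReal hYi.integrableOn (Eventually.of_forall hY0)).symm
  have hfin : IsFiniteMeasure (P.withDensity fun ω => (w ω : ℝ≥0∞)) := by
    refine ⟨?_⟩
    rw [withDensity_apply _ MeasurableSet.univ, hwi]
    exact ENNReal.ofReal_lt_top
  have := abs_integral_sub_le_of_forall_measurableSet hc
    (μ := P.withDensity fun ω => (w ω : ℝ≥0∞)) (ν := (∫ ω, Y ω ∂P).toNNReal • P) (ψ := ψ)
    (fun D hD => ?_) hF hF0 hF1
  · rw [integral_withDensity_eq_integral_smul hw, integral_smul_nnreal_measure,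
      NNReal.smul_def, Real.coe_toNNReal _ hYint0, smul_eq_mul] at this
    convert this using 5 with ω
    simp [w, NNReal.smul_def, Real.coe_toNNReal _ (hY0 _)]
  · rw [measureReal_nnreal_smul_apply, Real.coe_toNNReal _ hYint0, Measure.real,
      withDensity_apply _ (hc _ hD), hwi, ENNReal.toReal_ofReal (integral_nonneg hY0)]
    exact step D hD

lemma StrongMixing.abs_cov_le {a c : MeasurableSpace Ω} [mΩ : MeasurableSpace Ω]
    {P : Measure Ω} [IsProbabilityMeasure P] {ψ : ℝ} (h : StrongMixing P a c ψ) (ha : a ≤ mΩ)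
    (hc : c ≤ mΩ) {Y F : Ω → ℝ} (hY : Measurable[a] Y) (hF : Measurable[c] F) {B : ℝ} (hB : 0 < B)
    (hYB : ∀ ω, |Y ω| ≤ B) (hFB : ∀ ω, |F ω| ≤ B) :
    |∫ ω, Y ω * F ω ∂P - (∫ ω, Y ω ∂P) * ∫ ω, F ω ∂P| ≤ 4 * B ^ 2 * ψ := by
  have hYm : Measurable Y := hY.mono ha le_rfl
  have hFm : Measurable F := hF.mono hc le_rfl
  have hYi : Integrable Y P := Integrable.of_bound hYm.aestronglyMeasurable B
    (Eventually.of_forall hYB)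
  have hFi : Integrable F P := Integrable.of_bound hFm.aestronglyMeasurable B
    (Eventually.of_forall hFB)
  have hYF : Integrable (fun ω => Y ω * F ω) P := hYi.mul_bdd hFm.aestronglyMeasurable
    (Eventually.of_forall hFB)
  have hu : ∀ {G : Ω → ℝ}, (∀ ω, |G ω| ≤ B) → ∀ ω, 0 ≤ (G ω + B) / (2 * B) := fun hG ω =>
    div_nonneg (by linarith [(abs_le.1 (hG ω)).1]) (by positivity)
  have hu' : ∀ {G : Ω → ℝ}, (∀ ω, |G ω| ≤ B) → ∀ ω, (G ω + B) / (2 * B) ≤ 1 := fun hG ω => by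
    rw [div_le_one (by positivity)]; linarith [(abs_le.1 (hG ω)).2]
  have key := h.abs_cov_le_of_mem_unit ha hc ((hY.add_const B).div_const (2 * B))
    ((hF.add_const B).div_const (2 * B)) (hu hYB) (hu' hYB) (hu hFB) (hu' hFB)
  have e1 : ∫ ω, (Y ω + B) / (2 * B) ∂P = (∫ ω, Y ω ∂P + B) / (2 * B) := by
    rw [integral_div, integral_add hYi (integrable_const _)]; simp
  have e2 : ∫ ω, (F ω + B) / (2 * B) ∂P = (∫ ω, F ω ∂P + B) / (2 * B) := by
    rw [integral_div, integral_add hFi (integrable_const _)]; simp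
  have e3 : ∫ ω, (Y ω + B) / (2 * B) * ((F ω + B) / (2 * B)) ∂P
      = (∫ ω, Y ω * F ω ∂P + B * ∫ ω, Y ω ∂P + B * ∫ ω, F ω ∂P + B ^ 2) / (4 * B ^ 2) := by
    have : ∀ ω, (Y ω + B) / (2 * B) * ((F ω + B) / (2 * B))
        = (Y ω * F ω + B * Y ω + B * F ω + B ^ 2) / (4 * B ^ 2) := fun ω => by
      field_simp; ring
    simp_rw [this]
    rw [integral_div, integral_add, integral_add, integral_add, integral_const_mul,
      integral_const_mul]
    · simp
    · exact hYF
    · exact hYi.const_mul B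
    · exact hYF.add (hYi.const_mul B)
    · exact hFi.const_mul B
    · exact (hYF.add (hYi.const_mul B)).add (hFi.const_mul B)
    · exact integrable_const _
  rw [e1, e2, e3] at key
  set x := ∫ ω, Y ω * F ω ∂P
  set y := ∫ ω, Y ω ∂P
  set z := ∫ ω, F ω ∂P
  have : (x + B * y + B * z + B ^ 2) / (4 * B ^ 2) - (y + B) / (2 * B) * ((z + B) / (2 * B))
      = (x - y * z) / (4 * B ^ 2) := by
    field_simp; ring
  rw [this, abs_div, abs_of_pos (by positivity : 0 < 4 * B ^ 2), div_le_iff₀ (by positivity)] at key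
  linarith

lemma StrongMixing.norm_cov_le_of_bounded {a c : MeasurableSpace Ω} [mΩ : MeasurableSpace Ω]
    {P : Measure Ω} [IsProbabilityMeasure P] {ψ : ℝ} (h : StrongMixing P a c ψ) (ha : a ≤ mΩ)
    (hc : c ≤ mΩ) {Y F : Ω → ℂ} (hY : Measurable[a] Y) (hF : Measurable[c] F) {B : ℝ} (hB : 0 < B)
    (hYB : ∀ ω, ‖Y ω‖ ≤ B) (hFB : ∀ ω, ‖F ω‖ ≤ B) :
    ‖∫ ω, Y ω * F ω ∂P - (∫ ω, Y ω ∂P) * ∫ ω, F ω ∂P‖ ≤ 16 * B ^ 2 * ψ := by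
  have hYm : Measurable Y := hY.mono ha le_rfl
  have hFm : Measurable F := hF.mono hc le_rfl
  have hYi : Integrable Y P := Integrable.of_bound hYm.aestronglyMeasurable B
    (Eventually.of_forall hYB)
  have hFi : Integrable F P := Integrable.of_bound hFm.aestronglyMeasurable B
    (Eventually.of_forall hFB)
  have hYF : Integrable (fun ω => Y ω * F ω) P := hYi.mul_bdd hFm.aestronglyMeasurable
    (Eventually.of_forall hFB)
  have hr : ∀ {G : Ω → ℂ}, (∀ ω, ‖G ω‖ ≤ B) → ∀ ω, |(G ω).re| ≤ B := fun hG ω =>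
    (Complex.abs_re_le_norm _).trans (hG ω)
  have hi : ∀ {G : Ω → ℂ}, (∀ ω, ‖G ω‖ ≤ B) → ∀ ω, |(G ω).im| ≤ B := fun hG ω =>
    (Complex.abs_im_le_norm _).trans (hG ω)
  have hYr := Complex.measurable_re.comp hY
  have hYj := Complex.measurable_im.comp hY
  have hFr := Complex.measurable_re.comp hF
  have hFj := Complex.measurable_im.comp hF
  have k1 := h.abs_cov_le ha hc hYr hFr hB (hr hYB) (hr hFB)
  have k2 := h.abs_cov_le ha hc hYj hFj hB (hi hYB) (hi hFB)
  have k3 := h.abs_cov_le ha hc hYr hFj hB (hr hYB) (hi hFB)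
  have k4 := h.abs_cov_le ha hc hYj hFr hB (hi hYB) (hr hFB)
  have ip : ∀ {G H : Ω → ℝ}, Measurable[a] G → Measurable[c] H → (∀ ω, |G ω| ≤ B) →
      (∀ ω, |H ω| ≤ B) → Integrable (fun ω => G ω * H ω) P := fun hG hH hGB hHB =>
    (Integrable.of_bound (hG.mono ha le_rfl).aestronglyMeasurable B
      (Eventually.of_forall hGB)).mul_bdd (hH.mono hc le_rfl).aestronglyMeasurable
      (Eventually.of_forall hHB)
  have re_int : ∀ {G : Ω → ℂ}, Integrable G P → (∫ ω, G ω ∂P).re = ∫ ω, (G ω).re ∂P :=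
    fun hG => (integral_re hG).symm
  have im_int : ∀ {G : Ω → ℂ}, Integrable G P → (∫ ω, G ω ∂P).im = ∫ ω, (G ω).im ∂P :=
    fun hG => (integral_im hG).symm
  have er : (∫ ω, Y ω * F ω ∂P - (∫ ω, Y ω ∂P) * ∫ ω, F ω ∂P).re
      = (∫ ω, (Y ω).re * (F ω).re ∂P - (∫ ω, (Y ω).re ∂P) * ∫ ω, (F ω).re ∂P)
        - (∫ ω, (Y ω).im * (F ω).im ∂P - (∫ ω, (Y ω).im ∂P) * ∫ ω, (F ω).im ∂P) := by
    rw [Complex.sub_re, Complex.mul_re, re_int hYF, re_int hYi, re_int hFi, im_int hYi, im_int hFi]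
    simp_rw [Complex.mul_re]
    have := integral_sub (ip hYr hFr (hr hYB) (hr hFB)) (ip hYj hFj (hi hYB) (hi hFB))
    simp only [Function.comp] at this
    rw [this]
    ring
  have ei : (∫ ω, Y ω * F ω ∂P - (∫ ω, Y ω ∂P) * ∫ ω, F ω ∂P).im
      = (∫ ω, (Y ω).re * (F ω).im ∂P - (∫ ω, (Y ω).re ∂P) * ∫ ω, (F ω).im ∂P)
        + (∫ ω, (Y ω).im * (F ω).re ∂P - (∫ ω, (Y ω).im ∂P) * ∫ ω, (F ω).re ∂P) := by
    rw [Complex.sub_im, Complex.mul_im, im_int hYF, re_int hYi, re_int hFi, im_int hYi, im_int hFi]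
    simp_rw [Complex.mul_im]
    have := integral_add (ip hYr hFj (hr hYB) (hi hFB)) (ip hYj hFr (hi hYB) (hr hFB))
    simp only [Function.comp] at this
    rw [this]
    ring
  refine (Complex.norm_le_abs_re_add_abs_im _).trans ?_
  rw [er, ei]
  refine (add_le_add (abs_sub _ _) (abs_add_le _ _)).trans ?_
  simp only [Function.comp] at k1 k2 k3 k4
  linarith

lemma integrable_of_integrable_norm_cube [MeasurableSpace Ω] {P : Measure Ω}
    [IsProbabilityMeasure P] {Y : Ω → ℂ} (hY : AEStronglyMeasurable Y P)
    (h : Integrable (fun ω => ‖Y ω‖ ^ 3) P) : Integrable Y P := by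
  refine ((integrable_const (1 : ℝ)).add h).mono' hY (Eventually.of_forall fun ω => ?_)
  simp only [Pi.add_apply]
  nlinarith [norm_nonneg (Y ω), sq_nonneg (‖Y ω‖ - 1), sq_nonneg (‖Y ω‖),
    mul_nonneg (norm_nonneg (Y ω)) (sq_nonneg (‖Y ω‖ - 1))]

/-- Davydov-type covariance inequality, for variables with third moments. -/
lemma StrongMixing.norm_cov_le {a c : MeasurableSpace Ω} [mΩ : MeasurableSpace Ω]
    {P : Measure Ω} [IsProbabilityMeasure P] {η : ℝ} (h : StrongMixing P a c (η ^ 3))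
    (hη0 : 0 < η) (hη1 : η ≤ 1) (ha : a ≤ mΩ) (hc : c ≤ mΩ) {Y F : Ω → ℂ} (hY : Measurable[a] Y)
    (hF : Measurable[c] F) {A : ℝ} (hA : 1 ≤ A) (hY3 : Integrable (fun ω => ‖Y ω‖ ^ 3) P)
    (hF3 : Integrable (fun ω => ‖F ω‖ ^ 3) P) (hYA : ∫ ω, ‖Y ω‖ ^ 3 ∂P ≤ A)
    (hFA : ∫ ω, ‖F ω‖ ^ 3 ∂P ≤ A) :
    ‖∫ ω, Y ω * F ω ∂P - (∫ ω, Y ω ∂P) * ∫ ω, F ω ∂P‖ ≤ 22 * A ^ 2 * η := by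
  have hYm : Measurable Y := hY.mono ha le_rfl
  have hFm : Measurable F := hF.mono hc le_rfl
  have hYi := integrable_of_integrable_norm_cube hYm.aestronglyMeasurable hY3
  have hFi := integrable_of_integrable_norm_cube hFm.aestronglyMeasurable hF3
  set M : ℝ := η⁻¹ with hM
  have hM1 : 1 ≤ M := (one_le_inv₀ hη0).2 hη1
  have hM0 : 0 < M := by linarith
  let tr : (Ω → ℂ) → Ω → ℂ := fun G ω => if ‖G ω‖ ≤ M then G ω else 0
  have trB : ∀ G ω, ‖tr G ω‖ ≤ M := fun G ω => by
    by_cases hG : ‖G ω‖ ≤ M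
    · simp [tr, hG]
    · simp [tr, hG, hM0.le]
  have tr_le : ∀ G ω, ‖tr G ω‖ ≤ ‖G ω‖ := fun G ω => by
    by_cases hG : ‖G ω‖ ≤ M <;> simp [tr, hG]
  have trm : ∀ {m : MeasurableSpace Ω} {G : Ω → ℂ}, Measurable[m] G → Measurable[m] (tr G) :=
    fun {m G} hG => Measurable.ite (measurableSet_le hG.norm measurable_const) hG measurable_const
  have tri : ∀ {G : Ω → ℂ}, Measurable G → Integrable (tr G) P := fun {G} hG =>
    Integrable.of_bound (trm hG).aestronglyMeasurable M (Eventually.of_forall (trB G))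
  have tail : ∀ G ω, ‖G ω - tr G ω‖ ≤ ‖G ω‖ ^ 3 / M := fun G ω => by
    by_cases hG : ‖G ω‖ ≤ M
    · simp only [tr, hG, if_true, sub_self, norm_zero]; positivity
    · simp only [tr, hG, if_false, sub_zero]
      rw [le_div_iff₀ hM0]
      push Not at hG
      have : 0 ≤ ‖G ω‖ := norm_nonneg _
      nlinarith [mul_le_mul hG.le hG.le hM0.le this, mul_nonneg this (sub_nonneg.2 hM1)]
  have tailint : ∀ {G : Ω → ℂ}, Measurable G → Integrable G P →
      Integrable (fun ω => ‖G ω‖ ^ 3) P → ∫ ω, ‖G ω‖ ^ 3 ∂P ≤ A →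
      ‖∫ ω, G ω ∂P - ∫ ω, tr G ω ∂P‖ ≤ A / M := fun {G} hG hGi hG3 hGA => by
    rw [← integral_sub hGi (tri hG)]
    refine (norm_integral_le_of_norm_le (hG3.div_const M) (Eventually.of_forall (tail G))).trans ?_
    rw [integral_div]
    gcongr
  have first : ∀ {G : Ω → ℂ}, Integrable (fun ω => ‖G ω‖ ^ 3) P → ∫ ω, ‖G ω‖ ^ 3 ∂P ≤ A →
      ∀ {H : Ω → ℂ}, (∀ ω, ‖H ω‖ ≤ ‖G ω‖) → ‖∫ ω, H ω ∂P‖ ≤ 2 * A := fun {G} hG3 hGA {H} hHG => by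
    refine (norm_integral_le_of_norm_le ((integrable_const (1 : ℝ)).add hG3)
      (Eventually.of_forall fun ω => (hHG ω).trans ?_)).trans ?_
    · simp only [Pi.add_apply]
      nlinarith [norm_nonneg (G ω), sq_nonneg (‖G ω‖ - 1), sq_nonneg (‖G ω‖),
        mul_nonneg (norm_nonneg (G ω)) (sq_nonneg (‖G ω‖ - 1))]
    · simp only [Pi.add_apply]
      rw [integral_add (integrable_const _) hG3]
      simp; linarith
  have k1 := h.norm_cov_le_of_bounded ha hc (trm hY) (trm hF) hM0 (trB Y) (trB F)
  -- Where the products differ, one of the two factors exceeds `M`. Multiplying by that factor and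
  -- using `y² f ≤ y³ + f³` gives the bound.
  have pw : ∀ ω, ‖Y ω * F ω - tr Y ω * tr F ω‖ ≤ (‖Y ω‖ ^ 3 + ‖F ω‖ ^ 3) / M := fun ω => by
    have hy := norm_nonneg (Y ω)
    have hf := norm_nonneg (F ω)
    have cub : ∀ y f : ℝ, 0 ≤ y → 0 ≤ f → y ^ 2 * f ≤ y ^ 3 + f ^ 3 := fun y f hy hf => by
      nlinarith [mul_nonneg (add_nonneg hy hf) (sq_nonneg (y - f)), pow_nonneg hy 3,
        pow_nonneg hf 3, mul_nonneg hy (mul_nonneg hf hf), mul_nonneg hy (sq_nonneg (y - f)),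
        mul_nonneg hf (sq_nonneg (y - f))]
    by_cases h1 : ‖Y ω‖ ≤ M
    · by_cases h2 : ‖F ω‖ ≤ M
      · simp only [tr, h1, h2, if_true, sub_self, norm_zero]; positivity
      · simp only [tr, h2, if_false, mul_zero, sub_zero, norm_mul]
        rw [le_div_iff₀ hM0]
        push Not at h2
        nlinarith [cub _ _ hf hy, mul_le_mul_of_nonneg_left h2.le (mul_nonneg hy hf)]
    · simp only [tr, h1, if_false, zero_mul, sub_zero, norm_mul]
      rw [le_div_iff₀ hM0]
      push Not at h1
      nlinarith [cub _ _ hy hf, mul_le_mul_of_nonneg_left h1.le (mul_nonneg hy hf)]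
  have hd : Integrable (fun ω => Y ω * F ω - tr Y ω * tr F ω) P := by
    refine ((hY3.add hF3).div_const M).mono' ?_ (Eventually.of_forall pw)
    exact ((hYm.mul hFm).sub ((trm hYm).mul (trm hFm))).aestronglyMeasurable
  have hti : Integrable (fun ω => tr Y ω * tr F ω) P :=
    (tri hYm).mul_bdd (trm hFm).aestronglyMeasurable (Eventually.of_forall (trB F))
  have k2 : ‖∫ ω, (Y ω * F ω - tr Y ω * tr F ω) ∂P‖ ≤ 2 * A / M := by
    refine (norm_integral_le_of_norm_le ((hY3.add hF3).div_const M)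
      (Eventually.of_forall pw)).trans ?_
    simp only [Pi.add_apply]
    rw [integral_div, integral_add hY3 hF3]
    gcongr; linarith
  have e1 : ∫ ω, Y ω * F ω ∂P = ∫ ω, (Y ω * F ω - tr Y ω * tr F ω) ∂P
      + ∫ ω, tr Y ω * tr F ω ∂P := by
    rw [← integral_add hd hti]; simp
  have k3 := tailint hYm hYi hY3 hYA
  have k4 := tailint hFm hFi hF3 hFA
  have k5 := first hF3 hFA (H := F) (fun ω => le_rfl)
  have k6 := first hY3 hYA (H := tr Y) (tr_le Y)
  rw [e1]
  set x := ∫ ω, (Y ω * F ω - tr Y ω * tr F ω) ∂P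
  set x' := ∫ ω, tr Y ω * tr F ω ∂P
  set y := ∫ ω, Y ω ∂P
  set y' := ∫ ω, tr Y ω ∂P
  set z := ∫ ω, F ω ∂P
  set z' := ∫ ω, tr F ω ∂P
  have : x + x' - y * z = x + (x' - y' * z') - (y - y') * z - y' * (z - z') := by ring
  rw [this]
  have b3 : ‖(y - y') * z‖ ≤ A / M * (2 * A) := by
    rw [norm_mul]; gcongr
  have b4 : ‖y' * (z - z')‖ ≤ 2 * A * (A / M) := by
    rw [norm_mul]; gcongr
  have hMM : 16 * M ^ 2 * η ^ 3 = 16 * η := by rw [hM]; field_simp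
  have hAM : A / M = A * η := by rw [hM]; field_simp
  rw [hMM] at k1
  rw [hAM] at b3 b4
  rw [mul_div_assoc, hAM] at k2
  calc _ ≤ ‖x‖ + ‖x' - y' * z'‖ + ‖(y - y') * z‖
          + ‖y' * (z - z')‖ :=
        (norm_sub_le _ _).trans (add_le_add ((norm_sub_le _ _).trans
          (add_le_add (norm_add_le _ _) le_rfl)) le_rfl)
    _ ≤ 2 * (A * η) + 16 * η + A * η * (2 * A) + 2 * A * (A * η) := by gcongr
    _ ≤ 22 * A ^ 2 * η := by
      nlinarith [mul_nonneg hη0.le (sub_nonneg.2 hA), mul_pos hη0 hη0,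
        mul_nonneg (mul_nonneg hη0.le (sub_nonneg.2 hA)) (sub_nonneg.2 hA)]

end Covariance

end WeakDependence

/-! ### Oscillations, chains of rings and the expansion over rings. -/

namespace WeakDependence

/-- The oscillation `exp(i t x)`. -/
noncomputable def osc (t x : ℝ) : ℂ := Complex.exp ((t * x : ℝ) * Complex.I)

lemma norm_osc (t x : ℝ) : ‖osc t x‖ = 1 := Complex.norm_exp_ofReal_mul_I _

lemma osc_add (t x y : ℝ) : osc t (x + y) = osc t x * osc t y := by
  simp only [osc, ← Complex.exp_add]; congr 1; push_cast; ring

lemma norm_osc_sub_one_le_two (t x : ℝ) : ‖osc t x - 1‖ ≤ 2 := by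
  refine (norm_sub_le _ _).trans ?_
  rw [norm_osc]; norm_num

lemma norm_osc_sub_one_le (t x : ℝ) : ‖osc t x - 1‖ ≤ |t| * |x| := by
  have := Real.norm_exp_I_mul_ofReal_sub_one_le (x := t * x)
  rw [Real.norm_eq_abs, abs_mul] at this
  simpa [osc, mul_comm] using this

lemma norm_osc_sub_one_sub_le (t x : ℝ) :
    ‖osc t x - 1 - (t * x : ℝ) * Complex.I‖ ≤ 3 * (t ^ 2 * x ^ 2) := by
  have h0 : ‖((t * x : ℝ) : ℂ) * Complex.I‖ = |t * x| := by simp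
  by_cases h : |t * x| ≤ 1
  · have := Complex.norm_exp_sub_one_sub_id_le (x := ((t * x : ℝ) : ℂ) * Complex.I) (by rw [h0]; exact h)
    rw [h0, sq_abs] at this
    refine this.trans ?_
    nlinarith [sq_nonneg (t * x)]
  · push Not at h
    refine (norm_sub_le _ _).trans ?_
    rw [h0]
    have h2 := norm_osc_sub_one_le_two t x
    have h3 : (t * x) ^ 2 = |t * x| ^ 2 := (sq_abs _).symm
    nlinarith

lemma measurable_osc (t : ℝ) : Measurable (osc t) := by
  unfold osc; fun_prop

/-- A chain of rings `y 0, …, y r` around a site, with `V k` the statistic from which the rings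
of index less than `k` are left out; the ring algebras `I k` and `O (k + 2)` are strongly mixing
with coefficient `η³`. -/
structure RingChain {Ω : Type*} [mΩ : MeasurableSpace Ω] (P : Measure Ω) (r : ℕ) (η : ℝ)
    (I O : ℕ → MeasurableSpace Ω) (y V : ℕ → Ω → ℝ) : Prop where
  I_le : ∀ k, k ≤ r → I k ≤ mΩ
  O_le : ∀ k, k ≤ r + 1 → O k ≤ mΩ
  I_mono : ∀ i k, i ≤ k → k ≤ r → I i ≤ I k
  measurable_I : ∀ k, k ≤ r → Measurable[I k] (y k)
  measurable_O : ∀ k, k ≤ r → Measurable[O k] (y k)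
  measurable_V : ∀ k, k ≤ r + 1 → Measurable[O k] (V k)
  step : ∀ k, k ≤ r → ∀ ω, V k ω = y k ω + V (k + 1) ω
  -- Ring `k + 1` belongs to neither side and is the gap that separates them.
  mixing : ∀ k, k < r → StrongMixing P (I k) (O (k + 2)) (η ^ 3)

/-- The product `∏_{i = k+1}^{k+m} (exp(i t y_i) - 1)`. -/
noncomputable def ringProd {Ω : Type*} (t : ℝ) (y : ℕ → Ω → ℝ) (k m : ℕ) (ω : Ω) : ℂ :=
  ∏ i ∈ Finset.range m, (osc t (y (k + 1 + i) ω) - 1)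

lemma norm_ringProd_le {Ω : Type*} (t : ℝ) (y : ℕ → Ω → ℝ) (k m : ℕ) (ω : Ω) :
    ‖ringProd t y k m ω‖ ≤ 2 ^ m := by
  unfold ringProd
  rw [norm_prod]
  refine (Finset.prod_le_prod (fun _ _ => norm_nonneg _)
    fun _ _ => norm_osc_sub_one_le_two _ _).trans ?_
  simp

lemma ringProd_succ {Ω : Type*} (t : ℝ) (y : ℕ → Ω → ℝ) (k m : ℕ) (ω : Ω) :
    ringProd t y k (m + 1) ω = ringProd t y k m ω * (osc t (y (k + m + 1) ω) - 1) := by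
  unfold ringProd
  rw [Finset.prod_range_succ]; congr 4; ring

/-- A two-step contraction decays geometrically. -/
lemma le_of_two_step_contraction {q : ℕ → ℝ} {C e : ℝ} (he : 0 ≤ e) {M : ℕ}
    (h0 : q 0 ≤ C) (h1 : 1 ≤ M → q 1 ≤ C / 16)
    (h : ∀ m, m + 2 ≤ M → q (m + 2) ≤ 1 / 256 * q m + 2 * e) :
    ∀ m, m ≤ M → q m ≤ C * (1 / 16) ^ m + 4 * e := by
  intro m
  induction m using Nat.strong_induction_on with
  | _ m ih =>
    intro hm
    match m with
    | 0 => simp; linarith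
    | 1 => have := h1 hm; simp; linarith
    | m + 2 =>
      have := h m hm
      have h2 := ih m (by omega) (by omega)
      have h3 : C * (1 / 16 : ℝ) ^ (m + 2) = 1 / 256 * (C * (1 / 16) ^ m) := by ring
      rw [h3]; linarith

namespace RingChain

variable {Ω : Type*} [mΩ : MeasurableSpace Ω] {P : Measure Ω} {r : ℕ} {η : ℝ} {I O : ℕ → MeasurableSpace Ω} {y V : ℕ → Ω → ℝ}

lemma measurable_ringProd (h : RingChain P r η I O y V) (t : ℝ) {k m : ℕ} (hkm : k + m ≤ r) :
    Measurable[I (k + m)] (ringProd t y k m) := by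
  unfold ringProd
  refine Finset.measurable_fun_prod _ fun i hi => ?_
  have hi' := Finset.mem_range.1 hi
  exact ((measurable_osc t).comp ((h.measurable_I _ (by omega)).mono
    (h.I_mono _ _ (by omega) hkm) le_rfl)).sub_const 1

lemma measurable_ring (h : RingChain P r η I O y V) {k : ℕ} (hk : k ≤ r) : Measurable (y k) :=
  (h.measurable_I k hk).mono (h.I_le k hk) le_rfl

/-- The expectations `E exp(i t V_k)`. -/
noncomputable def mean (P : Measure Ω) (V : ℕ → Ω → ℝ) (t : ℝ) (k : ℕ) : ℂ :=
  ∫ ω, osc t (V k ω) ∂P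

lemma norm_integral_osc_le_one [IsProbabilityMeasure P] (Z : Ω → ℝ) (t : ℝ) : ‖∫ ω, osc t (Z ω) ∂P‖ ≤ 1 := by
  refine (norm_integral_le_of_norm_le_const (C := 1)
    (Eventually.of_forall fun ω => (norm_osc _ _).le)).trans ?_
  simp

/-- Each ring factor has modulus at most 2, hence cube at most 8. This is the source of `8 ^ r` in
the decoupling error `e` throughout. -/
lemma integrable_cube_ringProd {t : ℝ} {k m : ℕ} {G : Ω → ℂ}
    (hG : AEStronglyMeasurable G P) (hR : AEStronglyMeasurable (ringProd t y k m) P)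
    (hG3 : Integrable (fun ω => ‖G ω‖ ^ 3) P) :
    Integrable (fun ω => ‖G ω * ringProd t y k m ω‖ ^ 3) P ∧
      ∫ ω, ‖G ω * ringProd t y k m ω‖ ^ 3 ∂P ≤ 8 ^ m * ∫ ω, ‖G ω‖ ^ 3 ∂P := by
  have pw : ∀ ω, ‖G ω * ringProd t y k m ω‖ ^ 3 ≤ 8 ^ m * ‖G ω‖ ^ 3 := fun ω => by
    rw [norm_mul, mul_pow, mul_comm]
    have h2 := norm_ringProd_le t y k m ω
    have : ‖ringProd t y k m ω‖ ^ 3 ≤ (2 ^ m) ^ 3 := by gcongr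
    rw [← pow_mul, mul_comm m 3, pow_mul] at this
    norm_num at this ⊢
    gcongr
  have hi : Integrable (fun ω => ‖G ω * ringProd t y k m ω‖ ^ 3) P :=
    (hG3.const_mul (8 ^ m)).mono' ((hG.mul hR).norm.pow 3)
      (Eventually.of_forall fun ω => by rw [Real.norm_eq_abs, abs_of_nonneg (by positivity)]; exact pw ω)
  refine ⟨hi, ?_⟩
  rw [← integral_const_mul]
  exact integral_mono hi (hG3.const_mul _) pw

section Expansion

variable [IsProbabilityMeasure P] {t A e : ℝ}

/-- Replacing the rings one after the other. -/
lemma norm_integral_mul_osc_sub_le (h : RingChain P r η I O y V) (hη0 : 0 < η) (hη1 : η ≤ 1)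
    (hA : 1 ≤ A) (he : 22 * (8 ^ r * A) ^ 2 * η ≤ e) {k : ℕ} {G : Ω → ℂ} (hkr : k ≤ r)
    (hG : Measurable[I k] G) (hG3 : Integrable (fun ω => ‖G ω‖ ^ 3) P)
    (hGA : ∫ ω, ‖G ω‖ ^ 3 ∂P ≤ A) {M : ℕ} (hM : k + M ≤ r) :
    ‖∫ ω, G ω * osc t (V (k + 1) ω) ∂P
        - ∑ m ∈ Finset.range M, (∫ ω, G ω * ringProd t y k m ω ∂P) * mean P V t (k + m + 2)‖
      ≤ ∫ ω, ‖G ω * ringProd t y k M ω‖ ∂P + M * e := by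
  have hGm : Measurable G := hG.mono (h.I_le k hkr) le_rfl
  have hOs : ∀ j, j ≤ r + 1 → Measurable[O j] (fun ω => osc t (V j ω)) := fun j hj =>
    (measurable_osc t).comp (h.measurable_V j hj)
  have hOsm : ∀ j, j ≤ r + 1 → Measurable (fun ω => osc t (V j ω)) := fun j hj =>
    (hOs j hj).mono (h.O_le j hj) le_rfl
  have hRm : ∀ m, k + m ≤ r → Measurable (ringProd t y k m) := fun m hm =>
    (h.measurable_ringProd t hm).mono (h.I_le _ hm) le_rfl
  have hGI : ∀ m, k + m ≤ r → Measurable[I (k + m)] G := fun m hm =>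
    hG.mono (h.I_mono _ _ (by omega) hm) le_rfl
  have hGi : ∀ m, k + m ≤ r → Integrable (fun ω => G ω * ringProd t y k m ω) P := fun m hm =>
    integrable_of_integrable_norm_cube (hGm.mul (hRm m hm)).aestronglyMeasurable
      (integrable_cube_ringProd hGm.aestronglyMeasurable (hRm m hm).aestronglyMeasurable hG3).1
  have key : ∀ M, k + M ≤ r →
      ‖∫ ω, G ω * osc t (V (k + 1) ω) ∂P
        - ∑ m ∈ Finset.range M, (∫ ω, G ω * ringProd t y k m ω ∂P) * mean P V t (k + m + 2)
        - ∫ ω, G ω * ringProd t y k M ω * osc t (V (k + M + 1) ω) ∂P‖ ≤ M * e := by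
    intro M
    induction M with
    | zero => intro _; simp [ringProd]
    | succ M ih =>
      intro hM
      have ih' := ih (by omega)
      have hbd : ∀ j, j ≤ r + 1 → ∀ {H : Ω → ℂ}, Integrable H P →
          Integrable (fun ω => H ω * osc t (V j ω)) P := fun j hj {H} hH =>
        hH.mul_bdd (c := 1) (hOsm j hj).aestronglyMeasurable
          (Eventually.of_forall fun ω => (norm_osc _ _).le)
      -- Ring `k + M + 1` is split off the exponential. The first term no longer contains this ring
      -- and factorizes by mixing; the second has one more factor in its product and is treated in
      -- the next step.
      have e1 : ∫ ω, G ω * ringProd t y k M ω * osc t (V (k + M + 1) ω) ∂P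
          = ∫ ω, G ω * ringProd t y k M ω * osc t (V (k + M + 2) ω) ∂P
            + ∫ ω, G ω * ringProd t y k (M + 1) ω * osc t (V (k + M + 2) ω) ∂P := by
        rw [← integral_add (hbd _ (by omega) (hGi M (by omega)))
          (hbd _ (by omega) (hGi (M + 1) (by omega)))]
        refine integral_congr_ae (Eventually.of_forall fun ω => ?_)
        simp only
        rw [h.step (k + M + 1) (by omega), osc_add]
        rw [ringProd_succ]; ring
      have hc := integrable_cube_ringProd (t := t) (y := y) (k := k) (m := M)
        hGm.aestronglyMeasurable (hRm M (by omega)).aestronglyMeasurable hG3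
      have hMr : (8 : ℝ) ^ M ≤ 8 ^ r := pow_le_pow_right₀ (by norm_num) (by omega)
      have h8 : (1 : ℝ) ≤ 8 ^ r := one_le_pow₀ (by norm_num)
      have cov := (h.mixing (k + M) (by omega)).norm_cov_le hη0 hη1 (h.I_le _ (by omega))
        (h.O_le _ (by omega)) (Y := fun ω => G ω * ringProd t y k M ω)
        (F := fun ω => osc t (V (k + M + 2) ω))
        ((hGI M (by omega)).mul (h.measurable_ringProd t (by omega))) (hOs _ (by omega))
        (A := 8 ^ r * A) (by nlinarith) hc.1 (by simp [norm_osc])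
        (hc.2.trans (by gcongr)) (by simp [norm_osc]; nlinarith)
      rw [Finset.sum_range_succ]
      have : ∀ a b c d g : ℂ, a - (b + c) - g = (a - b - (d + g)) + (d - c) := by
        intros; ring
      rw [this _ _ _ (∫ ω, G ω * ringProd t y k M ω * osc t (V (k + M + 2) ω) ∂P)]
      have e3 : (k + (M + 1) + 1) = k + M + 2 := by ring
      rw [e3, ← e1]
      refine (norm_add_le _ _).trans ?_
      push_cast
      rw [add_mul, one_mul]
      exact add_le_add ih' (cov.trans he)
  have h1 := key M hM
  have h2 : ‖∫ ω, G ω * ringProd t y k M ω * osc t (V (k + M + 1) ω) ∂P‖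
      ≤ ∫ ω, ‖G ω * ringProd t y k M ω‖ ∂P := by
    refine (norm_integral_le_integral_norm _).trans_eq ?_
    simp_rw [norm_mul, norm_osc, mul_one]
  calc _ ≤ _ := norm_le_insert' _ _
    _ ≤ _ := add_le_add h2 h1

end Expansion

end RingChain

end WeakDependence

/-! ### Geometric decay of ring products, and the effect of leaving out rings. -/

namespace WeakDependence

namespace RingChain

variable {Ω : Type*} [mΩ : MeasurableSpace Ω] {P : Measure Ω} [IsProbabilityMeasure P]
  {r : ℕ} {η : ℝ} {I O : ℕ → MeasurableSpace Ω} {y V : ℕ → Ω → ℝ} {t A e θ : ℝ}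

lemma integrable_mul_ringProd (h : RingChain P r η I O y V) {k m : ℕ} {G : Ω → ℂ}
    (hkm : k + m ≤ r) (hG : Measurable G) (hG3 : Integrable (fun ω => ‖G ω‖ ^ 3) P) :
    Integrable (fun ω => G ω * ringProd t y k m ω) P := by
  have hR : Measurable (ringProd t y k m) :=
    (h.measurable_ringProd t hkm).mono (h.I_le _ hkm) le_rfl
  exact integrable_of_integrable_norm_cube (hG.mul hR).aestronglyMeasurable
      (integrable_cube_ringProd hG.aestronglyMeasurable hR.aestronglyMeasurable hG3).1

/-- Of the two new factors, the inner one is bounded by 2 and serves as a gap; the outer one then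
decouples from the product before it and contributes its mean, at most `θ`. -/
lemma integral_norm_mul_ringProd_le (h : RingChain P r η I O y V) (hη0 : 0 < η) (hη1 : η ≤ 1)
    (hA : 1 ≤ A) (he : 22 * (8 ^ r * A) ^ 2 * η ≤ e)
    (hθ : ∀ k, k ≤ r → ∫ ω, ‖osc t (y k ω) - 1‖ ∂P ≤ θ) {k m : ℕ} {G : Ω → ℂ}
    (hkm : k + m + 2 ≤ r) (hG : Measurable[I k] G) (hG3 : Integrable (fun ω => ‖G ω‖ ^ 3) P)
    (hGA : ∫ ω, ‖G ω‖ ^ 3 ∂P ≤ A) :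
    ∫ ω, ‖G ω * ringProd t y k (m + 2) ω‖ ∂P
      ≤ 2 * θ * ∫ ω, ‖G ω * ringProd t y k m ω‖ ∂P + 2 * e := by
  have hGm : Measurable G := hG.mono (h.I_le k (by omega)) le_rfl
  have hGI : Measurable[I (k + m)] G := hG.mono (h.I_mono _ _ (by omega) (by omega)) le_rfl
  have hRm : Measurable (ringProd t y k m) :=
    (h.measurable_ringProd t (k := k) (m := m) (by omega)).mono (h.I_le (k + m) (by omega)) le_rfl
  have hc := integrable_cube_ringProd (t := t) (y := y) (k := k) (m := m)
    hGm.aestronglyMeasurable hRm.aestronglyMeasurable hG3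
  have hi := h.integrable_mul_ringProd (t := t) (k := k) (m := m) (by omega) hGm hG3
  have hi2 := h.integrable_mul_ringProd (t := t) (k := k) (m := m + 2) (by omega) hGm hG3
  have hMr : (8 : ℝ) ^ m ≤ 8 ^ r := pow_le_pow_right₀ (by norm_num) (by omega)
  have h8 : (8 : ℝ) ≤ 8 ^ r := by
    calc (8 : ℝ) = 8 ^ 1 := by norm_num
      _ ≤ 8 ^ r := pow_le_pow_right₀ (by norm_num) (by omega)
  have hz : Measurable[O (k + m + 2)] (fun ω => osc t (y (k + m + 2) ω) - 1) :=
    ((measurable_osc t).comp (h.measurable_O _ (by omega))).sub_const 1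
  have hzm : Measurable (fun ω => osc t (y (k + m + 2) ω) - 1) :=
    hz.mono (h.O_le _ (by omega)) le_rfl
  have hz8 : ∀ ω, ‖osc t (y (k + m + 2) ω) - 1‖ ^ 3 ≤ 8 := fun ω => by
    have := norm_osc_sub_one_le_two t (y (k + m + 2) ω)
    calc _ ≤ (2 : ℝ) ^ 3 := by gcongr
      _ = 8 := by norm_num
  have hz3 : Integrable (fun ω => ‖osc t (y (k + m + 2) ω) - 1‖ ^ 3) P :=
    Integrable.of_bound (hzm.norm.pow_const 3).aestronglyMeasurable 8
      (Eventually.of_forall fun ω => by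
        rw [Real.norm_eq_abs, abs_of_nonneg (by positivity)]; exact hz8 ω)
  have cov := (h.mixing (k + m) (by omega)).norm_cov_le hη0 hη1 (h.I_le _ (by omega))
    (h.O_le _ (by omega)) (Y := fun ω => ((‖G ω * ringProd t y k m ω‖ : ℝ) : ℂ))
    (F := fun ω => ((‖osc t (y (k + m + 2) ω) - 1‖ : ℝ) : ℂ))
    (Complex.measurable_ofReal.comp
      (measurable_norm.comp (hGI.mul (h.measurable_ringProd t (by omega)))))
    (Complex.measurable_ofReal.comp (measurable_norm.comp hz))
    (A := 8 ^ r * A) (by nlinarith) (by simpa using hc.1) (by simpa using hz3)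
    (by simpa using hc.2.trans (by gcongr)) (by
      simp only [Complex.norm_real, norm_norm]
      refine (integral_mono hz3 (integrable_const (8 : ℝ)) hz8).trans ?_
      simp; nlinarith)
  have cov' : |∫ ω, ‖G ω * ringProd t y k m ω‖ * ‖osc t (y (k + m + 2) ω) - 1‖ ∂P
      - (∫ ω, ‖G ω * ringProd t y k m ω‖ ∂P) * ∫ ω, ‖osc t (y (k + m + 2) ω) - 1‖ ∂P| ≤ e := by
    rw [← Real.norm_eq_abs, ← Complex.norm_real]
    push_cast
    rw [← integral_complex_ofReal, ← integral_complex_ofReal, ← integral_complex_ofReal]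
    push_cast
    exact cov.trans he
  have hprod : Integrable
      (fun ω => ‖G ω * ringProd t y k m ω‖ * ‖osc t (y (k + m + 2) ω) - 1‖) P :=
    hi.norm.mul_bdd (c := 2) hzm.norm.aestronglyMeasurable (Eventually.of_forall fun ω => by
      rw [norm_norm]; exact norm_osc_sub_one_le_two _ _)
  have pw : ∀ ω, ‖G ω * ringProd t y k (m + 2) ω‖
      ≤ 2 * (‖G ω * ringProd t y k m ω‖ * ‖osc t (y (k + m + 2) ω) - 1‖) := fun ω => by
    rw [ringProd_succ, ringProd_succ, norm_mul, norm_mul, norm_mul, norm_mul]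
    have h1 := norm_osc_sub_one_le_two t (y (k + m + 1) ω)
    have h2 : k + (m + 1) + 1 = k + m + 2 := by ring
    rw [h2]
    calc _ = (‖G ω‖ * ‖ringProd t y k m ω‖ * ‖osc t (y (k + m + 2) ω) - 1‖)
          * ‖osc t (y (k + m + 1) ω) - 1‖ := by ring
      _ ≤ (‖G ω‖ * ‖ringProd t y k m ω‖ * ‖osc t (y (k + m + 2) ω) - 1‖) * 2 := by gcongr
      _ = _ := by ring
  have h1 := integral_mono hi2.norm (hprod.const_mul 2) pw
  rw [integral_const_mul] at h1
  have h2 := (abs_le.1 cov').2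
  have h3 := hθ (k + m + 2) (by omega)
  have h4 : 0 ≤ ∫ ω, ‖G ω * ringProd t y k m ω‖ ∂P := integral_nonneg fun _ => norm_nonneg _
  nlinarith

/-- Since `512 * θ ≤ 1`, two rings contract by `2 * θ ≤ 1 / 256 = (1 / 16) ^ 2`. The offset `n`
allows the recursion to start from a product that is already known to be of second order in `t`. -/
lemma integral_norm_mul_ringProd_le_geometric (h : RingChain P r η I O y V) (hη0 : 0 < η)
    (hη1 : η ≤ 1) (hA : 1 ≤ A) (he : 22 * (8 ^ r * A) ^ 2 * η ≤ e) (hθ0 : 512 * θ ≤ 1)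
    (hθ : ∀ k, k ≤ r → ∫ ω, ‖osc t (y k ω) - 1‖ ∂P ≤ θ) {k n : ℕ} {G : Ω → ℂ}
    (hG : Measurable[I k] G) (hG3 : Integrable (fun ω => ‖G ω‖ ^ 3) P)
    (hGA : ∫ ω, ‖G ω‖ ^ 3 ∂P ≤ A) {C : ℝ} (h0 : ∫ ω, ‖G ω * ringProd t y k n ω‖ ∂P ≤ C)
    (h1 : k + n + 1 ≤ r → ∫ ω, ‖G ω * ringProd t y k (n + 1) ω‖ ∂P ≤ C / 16) {m : ℕ}
    (hm : k + n + m ≤ r) :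
    ∫ ω, ‖G ω * ringProd t y k (n + m) ω‖ ∂P ≤ C * (1 / 16) ^ m + 4 * e := by
  have he0 : 0 ≤ e := le_trans (by positivity) he
  refine le_of_two_step_contraction (q := fun m => ∫ ω, ‖G ω * ringProd t y k (n + m) ω‖ ∂P)
    (M := r - k - n) he0 h0 (fun h => h1 (by omega)) (fun m hm => ?_) m (by omega)
  have := h.integral_norm_mul_ringProd_le hη0 hη1 hA he hθ (m := n + m) (by omega) hG hG3 hGA
  have h4 : 0 ≤ ∫ ω, ‖G ω * ringProd t y k (n + m) ω‖ ∂P := integral_nonneg fun _ => norm_nonneg _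
  have e1 : n + (m + 2) = n + m + 2 := by ring
  simp only [e1]
  nlinarith

lemma sum_range_geometric_le {x : ℝ} (h0 : 0 ≤ x) (h1 : x ≤ 1 / 8) (M : ℕ) :
    ∑ m ∈ Finset.range M, x ^ m ≤ 8 / 7 := by
  calc ∑ m ∈ Finset.range M, x ^ m ≤ ∑' m, x ^ m :=
        Summable.sum_le_tsum _ (fun _ _ => by positivity)
          (summable_geometric_of_lt_one h0 (by linarith))
    _ = (1 - x)⁻¹ := tsum_geometric_of_lt_one h0 (by linarith)
    _ ≤ 8 / 7 := by rw [inv_le_comm₀ (by linarith) (by norm_num)]; linarith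

/-- The expansion over rings is applied to `G = osc t (y k) - 1`. The starting values `θ` and `2 * θ
= 32 * θ / 16` explain the constant 32. The means are kept in the bound, instead of being estimated
by 1, so that it can be closed up in `norm_mean_le`. -/
lemma norm_mean_sub_succ_le (h : RingChain P r η I O y V) (hη0 : 0 < η)
    (hη1 : η ≤ 1) (hA : 8 ≤ A) (he : 22 * (8 ^ r * A) ^ 2 * η ≤ e) (hθ0 : 512 * θ ≤ 1)
    (hθ : ∀ k, k ≤ r → ∫ ω, ‖osc t (y k ω) - 1‖ ∂P ≤ θ) {k : ℕ} (hk : k ≤ r) :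
    ‖mean P V t k - mean P V t (k + 1)‖
      ≤ 32 * θ * ∑ m ∈ Finset.range (r - k), (1 / 16) ^ m * ‖mean P V t (k + m + 2)‖
        + 32 * θ * (1 / 16) ^ (r - k) + 9 * (r + 1) * e := by
  have he0 : 0 ≤ e := le_trans (by positivity) he
  have hv1 : ∀ j, ‖mean P V t j‖ ≤ 1 := fun j => norm_integral_osc_le_one _ _
  set G : Ω → ℂ := fun ω => osc t (y k ω) - 1 with hGdef
  have hG : Measurable[I k] G := ((measurable_osc t).comp (h.measurable_I k hk)).sub_const 1
  have hGm : Measurable G := hG.mono (h.I_le k hk) le_rfl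
  have hz8 : ∀ ω, ‖G ω‖ ^ 3 ≤ 8 := fun ω => by
    have := norm_osc_sub_one_le_two t (y k ω)
    calc _ ≤ (2 : ℝ) ^ 3 := by gcongr
      _ = 8 := by norm_num
  have hG3 : Integrable (fun ω => ‖G ω‖ ^ 3) P :=
    Integrable.of_bound (hGm.norm.pow_const 3).aestronglyMeasurable 8
      (Eventually.of_forall fun ω => by
        rw [Real.norm_eq_abs, abs_of_nonneg (by positivity)]; exact hz8 ω)
  have hGA : ∫ ω, ‖G ω‖ ^ 3 ∂P ≤ A := by
    refine (integral_mono hG3 (integrable_const (8 : ℝ)) hz8).trans ?_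
    simpa using hA
  have hθn : 0 ≤ θ := le_trans (integral_nonneg fun _ => norm_nonneg _) (hθ k hk)
  have q0 : ∫ ω, ‖G ω * ringProd t y k 0 ω‖ ∂P ≤ θ := by simpa [ringProd] using hθ k hk
  have q1 : k + 0 + 1 ≤ r → ∫ ω, ‖G ω * ringProd t y k 1 ω‖ ∂P ≤ 2 * θ := fun hk1 => by
    have hi := (h.integrable_mul_ringProd (t := t) (k := k) (m := 1) (by omega) hGm hG3).norm
    have hi0 := (h.integrable_mul_ringProd (t := t) (k := k) (m := 0) (by omega) hGm hG3).norm
    have := integral_mono hi (hi0.const_mul 2) fun ω => by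
      simp only [ringProd_succ _ _ _ 0, norm_mul]
      have := norm_osc_sub_one_le_two t (y (k + 0 + 1) ω)
      calc ‖G ω‖ * (‖ringProd t y k 0 ω‖ * ‖osc t (y (k + 0 + 1) ω) - 1‖)
          ≤ ‖G ω‖ * (‖ringProd t y k 0 ω‖ * 2) := by gcongr
        _ = _ := by ring
    rw [integral_const_mul] at this
    linarith
  have q : ∀ m, k + m ≤ r →
      ∫ ω, ‖G ω * ringProd t y k m ω‖ ∂P ≤ 32 * θ * (1 / 16) ^ m + 4 * e := fun m hm => by
    have := h.integral_norm_mul_ringProd_le_geometric hη0 hη1 (by linarith) he hθ0 hθ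
      (n := 0) hG hG3 hGA (C := 32 * θ) (by linarith) (fun h => by linarith [q1 h]) (m := m)
      (by omega)
    simpa using this
  have main := h.norm_integral_mul_osc_sub_le (t := t) hη0 hη1 (by linarith) he hk hG hG3 hGA
    (M := r - k) (by omega)
  have hV : Measurable (V (k + 1)) := (h.measurable_V _ (by omega)).mono (h.O_le _ (by omega)) le_rfl
  have ho : ∀ j, j ≤ r + 1 → Integrable (fun ω => osc t (V j ω)) P := fun j hj =>
    Integrable.of_bound ((measurable_osc t).comp ((h.measurable_V _ hj).mono
      (h.O_le _ hj) le_rfl)).aestronglyMeasurable 1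
      (Eventually.of_forall fun ω => (norm_osc _ _).le)
  have e1 : mean P V t k - mean P V t (k + 1) = ∫ ω, G ω * osc t (V (k + 1) ω) ∂P := by
    unfold mean
    rw [← integral_sub (ho k (by omega)) (ho (k + 1) (by omega))]
    refine integral_congr_ae (Eventually.of_forall fun ω => ?_)
    simp only [hGdef, h.step k hk, osc_add]; ring
  rw [e1]
  have hM : ((r - k : ℕ) : ℝ) ≤ r := by exact_mod_cast Nat.sub_le r k
  have hs : ‖∑ m ∈ Finset.range (r - k), (∫ ω, G ω * ringProd t y k m ω ∂P)
      * mean P V t (k + m + 2)‖ ≤ 32 * θ * ∑ m ∈ Finset.range (r - k),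
        (1 / 16) ^ m * ‖mean P V t (k + m + 2)‖ + r * (4 * e) := by
    calc _ ≤ ∑ m ∈ Finset.range (r - k), (32 * θ * ((1 / 16) ^ m * ‖mean P V t (k + m + 2)‖)
          + 4 * e) := by
          refine (norm_sum_le _ _).trans (Finset.sum_le_sum fun m hm => ?_)
          have hm' := Finset.mem_range.1 hm
          rw [norm_mul]
          have a1 := (norm_integral_le_integral_norm _).trans (q m (by omega))
          have a2 := hv1 (k + m + 2)
          calc _ ≤ (32 * θ * (1 / 16) ^ m + 4 * e) * ‖mean P V t (k + m + 2)‖ := by gcongr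
            _ ≤ _ := by nlinarith [norm_nonneg (mean P V t (k + m + 2))]
      _ ≤ _ := by
        rw [Finset.sum_add_distrib, ← Finset.mul_sum, Finset.sum_const, Finset.card_range,
          nsmul_eq_mul]
        gcongr
  have := q (r - k) (by omega)
  have h3 : ((r - k : ℕ) : ℝ) * e ≤ r * e := by gcongr
  have tri := norm_le_insert' (∫ ω, G ω * osc t (V (k + 1) ω) ∂P)
    (∑ m ∈ Finset.range (r - k), (∫ ω, G ω * ringProd t y k m ω ∂P) * mean P V t (k + m + 2))
  have hr0 : (0 : ℝ) ≤ r := Nat.cast_nonneg r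
  nlinarith

/-- Leaving out `k` rings changes the modulus of the characteristic function by a factor at most
`2 ^ k`, up to a small error. -/
lemma norm_mean_le (h : RingChain P r η I O y V) (hη0 : 0 < η)
    (hη1 : η ≤ 1) (hA : 8 ≤ A) (he : 22 * (8 ^ r * A) ^ 2 * η ≤ e) (hθ0 : 512 * θ ≤ 1)
    (hθ : ∀ k, k ≤ r → ∫ ω, ‖osc t (y k ω) - 1‖ ∂P ≤ θ) {k : ℕ} (hk : k ≤ r + 1) :
    ‖mean P V t k‖ ≤ 2 ^ k * (‖mean P V t 0‖ + (3 * (1 / 2) ^ r + 27 * (r + 1) * e)) := by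
  have he0 : 0 ≤ e := le_trans (by positivity) he
  have hθn : 0 ≤ θ := le_trans (integral_nonneg fun _ => norm_nonneg _) (hθ 0 (by omega))
  -- Take the index where `2 ^ (-k) * ‖mean k‖` is largest. Up to the error terms, one step
  -- increases the modulus from at most `2 ^ i * M` to at most `(1 + 2 / 7) * 2 ^ i * M`, as `(1 /
  -- 16) ^ m * 2 ^ m = (1 / 8) ^ m` is summable. A maximum at `i + 1` requires a doubling, so it is
  -- possible only if `M` is of the size of the errors.
  obtain ⟨j, hj, hmax⟩ := Finset.exists_max_image (Finset.range (r + 2))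
    (fun k => (1 / 2 : ℝ) ^ k * ‖mean P V t k‖) ⟨0, by simp⟩
  simp only [Finset.mem_range] at hj hmax
  set M := (1 / 2 : ℝ) ^ j * ‖mean P V t j‖ with hM
  have hM0 : 0 ≤ M := by positivity
  have hle : ∀ i, i ≤ r + 1 → ‖mean P V t i‖ ≤ 2 ^ i * M := fun i hi => by
    have := hmax i (by omega)
    have h2 : (2 : ℝ) ^ i * ((1 / 2) ^ i * ‖mean P V t i‖) = ‖mean P V t i‖ := by
      rw [← mul_assoc, ← mul_pow]; norm_num
    rw [← h2]; gcongr
  suffices hMb : M ≤ ‖mean P V t 0‖ + (3 * (1 / 2) ^ r + 27 * (r + 1) * e) by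
    refine (hle k hk).trans ?_
    gcongr
  rcases Nat.eq_zero_or_pos j with rfl | hjp
  · simp only [hM, pow_zero, one_mul, le_add_iff_nonneg_right]; positivity
  obtain ⟨i, rfl⟩ : ∃ i, j = i + 1 := ⟨j - 1, by omega⟩
  have hi : i ≤ r := by omega
  have d := h.norm_mean_sub_succ_le hη0 hη1 hA he hθ0 hθ hi
  have hMj : ‖mean P V t (i + 1)‖ = 2 ^ (i + 1) * M := by
    rw [hM, ← mul_assoc, ← mul_pow]; norm_num
  have hs : ∑ m ∈ Finset.range (r - i), (1 / 16 : ℝ) ^ m * ‖mean P V t (i + m + 2)‖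
      ≤ 2 ^ (i + 2) * M * (8 / 7) := by
    calc _ ≤ ∑ m ∈ Finset.range (r - i), 2 ^ (i + 2) * M * (1 / 8) ^ m := by
          refine Finset.sum_le_sum fun m hm => ?_
          have hm' := Finset.mem_range.1 hm
          have := hle (i + m + 2) (by omega)
          have e8 : (1 / 8 : ℝ) ^ m = (1 / 16) ^ m * 2 ^ m := by rw [← mul_pow]; norm_num
          calc _ ≤ (1 / 16 : ℝ) ^ m * (2 ^ (i + m + 2) * M) := by gcongr
            _ = _ := by rw [e8]; ring
      _ ≤ _ := by
        rw [← Finset.mul_sum]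
        gcongr
        exact sum_range_geometric_le (by norm_num) le_rfl _
  have h0 := hle i (by omega)
  have tri : ‖mean P V t (i + 1)‖ ≤ ‖mean P V t i‖ + ‖mean P V t i - mean P V t (i + 1)‖ := by
    rw [norm_sub_rev]; exact norm_le_insert' _ _
  have hp : (0 : ℝ) < 2 ^ i := by positivity
  have hθs : 32 * θ * ∑ m ∈ Finset.range (r - i), (1 / 16 : ℝ) ^ m * ‖mean P V t (i + m + 2)‖
      ≤ 1 / 16 * (2 ^ (i + 2) * M * (8 / 7)) := by
    gcongr
    linarith
  have hq : 32 * θ * (1 / 16 : ℝ) ^ (r - i) ≤ (1 / 16) * (1 / 2) ^ (r - i) := by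
    gcongr
    · linarith
    · norm_num
  have hr : (1 / 2 : ℝ) ^ (r - i) = 2 ^ i * (1 / 2) ^ r := by
    obtain ⟨s, rfl⟩ := Nat.exists_eq_add_of_le hi
    rw [Nat.add_sub_cancel_left, pow_add, ← mul_assoc, ← mul_pow]; norm_num
  rw [hr] at hq
  rw [hMj] at tri
  have h9 : 9 * ((r : ℝ) + 1) * e ≤ 2 ^ i * (9 * (r + 1) * e) :=
    le_mul_of_one_le_left (by positivity) (one_le_pow₀ (by norm_num))
  have fin : 2 ^ i * M * (1 - 2 / 7) ≤ 2 ^ i * (1 / 16 * (1 / 2) ^ r + 9 * (r + 1) * e) := by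
    have e1 : (2 : ℝ) ^ (i + 1) = 2 * 2 ^ i := by ring
    have e2 : (2 : ℝ) ^ (i + 2) = 4 * 2 ^ i := by ring
    rw [e1] at tri
    rw [e2] at hθs
    linarith
  rw [mul_assoc] at fin
  have fin' := le_of_mul_le_mul_left fin hp
  have : 0 ≤ (1 / 2 : ℝ) ^ r := by positivity
  have h9' : 0 ≤ ((r : ℝ) + 1) * e := by positivity
  have := norm_nonneg (mean P V t 0)
  linarith

end RingChain

end WeakDependence

/-! ### First-order expansion at one site. -/

namespace WeakDependence

/-- A three-fold Hölder inequality. -/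
lemma integral_mul_mul_le_of_cube {Ω : Type*} [MeasurableSpace Ω] {P : Measure Ω}
    {f g h : Ω → ℝ} (hf : Measurable f) (hg : Measurable g) (hh : Measurable h)
    (hf3 : Integrable (fun ω => |f ω| ^ 3) P) (hg3 : Integrable (fun ω => |g ω| ^ 3) P)
    (hh3 : Integrable (fun ω => |h ω| ^ 3) P) {a b c : ℝ} (ha : 0 < a) (hb : 0 < b) (hc : 0 < c)
    (hfa : ∫ ω, |f ω| ^ 3 ∂P ≤ a ^ 3) (hgb : ∫ ω, |g ω| ^ 3 ∂P ≤ b ^ 3)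
    (hhc : ∫ ω, |h ω| ^ 3 ∂P ≤ c ^ 3) :
    Integrable (fun ω => |f ω| * |g ω| * |h ω|) P ∧
      ∫ ω, |f ω| * |g ω| * |h ω| ∂P ≤ a * b * c := by
  have amgm : ∀ x y z : ℝ, 0 ≤ x → 0 ≤ y → 0 ≤ z → x * y * z ≤ (x ^ 3 + y ^ 3 + z ^ 3) / 3 := by
    intro x y z hx hy hz
    nlinarith [mul_nonneg (add_nonneg (add_nonneg hx hy) hz)
      (add_nonneg (add_nonneg (sq_nonneg (x - y)) (sq_nonneg (y - z))) (sq_nonneg (z - x)))]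
  have pw : ∀ ω, |f ω| * |g ω| * |h ω|
      ≤ a * b * c / 3 * (|f ω| ^ 3 / a ^ 3 + |g ω| ^ 3 / b ^ 3 + |h ω| ^ 3 / c ^ 3) := fun ω => by
    have := amgm (|f ω| / a) (|g ω| / b) (|h ω| / c) (by positivity) (by positivity) (by positivity)
    have e : |f ω| * |g ω| * |h ω| = a * b * c * (|f ω| / a * (|g ω| / b) * (|h ω| / c)) := by
      field_simp
    rw [e]
    calc _ ≤ a * b * c * (((|f ω| / a) ^ 3 + (|g ω| / b) ^ 3 + (|h ω| / c) ^ 3) / 3) := by gcongr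
      _ = _ := by simp only [div_pow]; ring
  have hd : Integrable (fun ω => a * b * c / 3 *
      (|f ω| ^ 3 / a ^ 3 + |g ω| ^ 3 / b ^ 3 + |h ω| ^ 3 / c ^ 3)) P :=
    (((hf3.div_const _).add (hg3.div_const _)).add (hh3.div_const _)).const_mul _
  have hi : Integrable (fun ω => |f ω| * |g ω| * |h ω|) P := by
    refine hd.mono' ((hf.abs.mul hg.abs).mul hh.abs).aestronglyMeasurable
      (Eventually.of_forall fun ω => ?_)
    rw [Real.norm_eq_abs, abs_of_nonneg (by positivity)]; exact pw ω
  refine ⟨hi, (integral_mono hi hd pw).trans ?_⟩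
  rw [integral_const_mul, integral_add ((hf3.div_const _).fun_add (hg3.div_const _)) (hh3.div_const _),
    integral_add (hf3.div_const _) (hg3.div_const _), integral_div, integral_div, integral_div]
  have h1 : (∫ ω, |f ω| ^ 3 ∂P) / a ^ 3 ≤ 1 := (div_le_one (by positivity)).2 hfa
  have h2 : (∫ ω, |g ω| ^ 3 ∂P) / b ^ 3 ≤ 1 := (div_le_one (by positivity)).2 hgb
  have h3 : (∫ ω, |h ω| ^ 3 ∂P) / c ^ 3 ≤ 1 := (div_le_one (by positivity)).2 hhc
  calc _ ≤ a * b * c / 3 * (1 + 1 + 1) := by gcongr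
    _ = _ := by ring

/-- Collecting the terms of the first-order expansion. -/
lemma norm_expansion_le {X x0 x1 tl v0 v1 v2 v3 : ℂ} {b0 b1 t κ θ c D E B F R : ℝ}
    (hκ : 0 ≤ κ) (hθ : 0 ≤ θ) (hθ1 : 512 * θ ≤ 1) (hD : 0 ≤ D) (hE : 0 ≤ E) (hB : 0 ≤ B)
    (hθθ : κ * θ * θ = B) (hc : |t| * c ≤ κ * θ) (hb0 : |b0| ≤ c) (hb1 : |b1| ≤ c)
    (m01 : ‖v0 - v1‖ ≤ 600 * θ * D + E) (m12 : ‖v1 - v2‖ ≤ 600 * θ * D + E)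
    (m23 : ‖v2 - v3‖ ≤ 600 * θ * D + E) (n2 : ‖v2‖ ≤ 2 ^ 2 * D) (n3 : ‖v3‖ ≤ 2 ^ 3 * D)
    (g0 : ‖x0 - Complex.I * (t * b0 : ℝ)‖ ≤ 3 * B) (g1 : ‖x1 - Complex.I * (t * b1 : ℝ)‖ ≤ 4 * B)
    (main : ‖X - (tl + x1 * v3 + x0 * v2)‖ ≤ 11 * B * D + R)
    (tail : ‖tl‖ ≤ 600 * B * D + F) (hF : F + R ≤ E) :
    ‖X - Complex.I * (t * (b0 + b1) : ℝ) * v0‖ ≤ 4000 * B * D + (1 + κ) * E := by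
  -- `x0` and `x1` are replaced by their first-order parts `I * t * b0` and `I * t * b1`. Then `v2`
  -- and `v3` are replaced by `v0`, which costs a further factor `θ` and so is again of second order
  -- in `t`.
  have split : X - Complex.I * (t * (b0 + b1) : ℝ) * v0
      = (X - (tl + x1 * v3 + x0 * v2)) + tl + (x0 - Complex.I * (t * b0 : ℝ)) * v2
        + (x1 - Complex.I * (t * b1 : ℝ)) * v3 + Complex.I * (t * b0 : ℝ) * (v2 - v0)
        + Complex.I * (t * b1 : ℝ) * (v3 - v0) := by
    push_cast; ring
  rw [split]
  have w2 : ‖v2 - v0‖ ≤ 1200 * θ * D + 2 * E := by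
    have : v2 - v0 = -((v0 - v1) + (v1 - v2)) := by ring
    rw [this, norm_neg]
    refine (norm_add_le _ _).trans ?_
    linarith
  have w3 : ‖v3 - v0‖ ≤ 1800 * θ * D + 3 * E := by
    have : v3 - v0 = (v2 - v0) - (v2 - v3) := by ring
    rw [this]
    refine (norm_sub_le _ _).trans ?_
    linarith
  have hn : ∀ b : ℝ, |b| ≤ c → ‖Complex.I * (t * b : ℝ)‖ ≤ κ * θ := fun b hb => by
    rw [norm_mul, Complex.norm_I, one_mul, Complex.norm_real, Real.norm_eq_abs, abs_mul]
    exact (mul_le_mul_of_nonneg_left hb (abs_nonneg t)).trans hc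
  have z0 : ‖(x0 - Complex.I * (t * b0 : ℝ)) * v2‖ ≤ 3 * B * (2 ^ 2 * D) := by
    rw [norm_mul]; gcongr
  have z1 : ‖(x1 - Complex.I * (t * b1 : ℝ)) * v3‖ ≤ 4 * B * (2 ^ 3 * D) := by
    rw [norm_mul]; gcongr
  have z2 : ‖Complex.I * (t * b0 : ℝ) * (v2 - v0)‖ ≤ κ * θ * (1200 * θ * D + 2 * E) := by
    rw [norm_mul]; exact mul_le_mul (hn b0 hb0) w2 (norm_nonneg _) (by positivity)
  have z3 : ‖Complex.I * (t * b1 : ℝ) * (v3 - v0)‖ ≤ κ * θ * (1800 * θ * D + 3 * E) := by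
    rw [norm_mul]; exact mul_le_mul (hn b1 hb1) w3 (norm_nonneg _) (by positivity)
  have tri : ∀ a b c d f g : ℂ, ‖a + b + c + d + f + g‖ ≤ ‖a‖ + ‖b‖ + ‖c‖ + ‖d‖ + ‖f‖ + ‖g‖ := by
    intro a b c d f g
    refine (norm_add_le _ _).trans (add_le_add_left ?_ _)
    refine (norm_add_le _ _).trans (add_le_add_left ?_ _)
    refine (norm_add_le _ _).trans (add_le_add_left ?_ _)
    exact norm_add₃_le
  refine (tri _ _ _ _ _ _).trans ?_
  have k1 : κ * θ * (1200 * θ * D + 2 * E) = 1200 * B * D + 2 * (κ * E) * θ := by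
    rw [← hθθ]; ring
  have k2 : κ * θ * (1800 * θ * D + 3 * E) = 1800 * B * D + 3 * (κ * E) * θ := by
    rw [← hθθ]; ring
  rw [k1] at z2
  rw [k2] at z3
  have hκE : 0 ≤ κ * E := mul_nonneg hκ hE
  have k3 : κ * E * θ ≤ κ * E / 512 := by
    rw [le_div_iff₀ (by norm_num)]; nlinarith
  have htBD := mul_nonneg hB hD
  linarith

namespace RingChain

variable {Ω : Type*} [mΩ : MeasurableSpace Ω] {P : Measure Ω} [IsProbabilityMeasure P]
  {r : ℕ} {η : ℝ} {I O : ℕ → MeasurableSpace Ω} {y V : ℕ → Ω → ℝ} {t A e β κ : ℝ}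

lemma integral_norm_osc_sub_one_le {Z : Ω → ℝ} (hZ : Measurable Z)
    (hZ3 : Integrable (fun ω => |Z ω| ^ 3) P) (hβ : 0 < β) (hZβ : ∫ ω, |Z ω| ^ 3 ∂P ≤ β ^ 3) :
    Integrable Z P ∧ ∫ ω, |Z ω| ∂P ≤ β ∧ ∫ ω, ‖osc t (Z ω) - 1‖ ∂P ≤ |t| * β := by
  have h1 := integral_mul_mul_le_of_cube hZ (measurable_const (a := (1 : ℝ)))
    (measurable_const (a := (1 : ℝ))) hZ3 (by simp) (by simp) hβ one_pos one_pos hZβ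
    (by simp) (by simp)
  simp only [abs_one, mul_one] at h1
  have hi : Integrable Z P := (integrable_norm_iff hZ.aestronglyMeasurable).1 h1.1
  refine ⟨hi, h1.2, ?_⟩
  calc _ ≤ ∫ ω, |t| * |Z ω| ∂P := by
        refine integral_mono ?_ (h1.1.const_mul _) fun ω => norm_osc_sub_one_le _ _
        exact (Integrable.of_bound (((measurable_osc t).comp hZ).sub_const 1).aestronglyMeasurable 2
          (Eventually.of_forall fun ω => norm_osc_sub_one_le_two _ _)).norm
    _ ≤ _ := by rw [integral_const_mul]; gcongr; exact h1.2

/-- `norm_mean_le` is fed back into `norm_mean_sub_succ_le`, so that the first increments are of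
order `θ` times the modulus of the full characteristic function; `32 * 16 * 8 / 7 + 32 / 3 < 600`.
-/
lemma norm_mean_sub_succ_le_of_le_two (h : RingChain P r η I O y V) (hη0 : 0 < η)
    (hη1 : η ≤ 1) (hA : 8 ≤ A) (he : 22 * (8 ^ r * A) ^ 2 * η ≤ e) {θ : ℝ} (hθ0 : 512 * θ ≤ 1)
    (hθ : ∀ k, k ≤ r → ∫ ω, ‖osc t (y k ω) - 1‖ ∂P ≤ θ) (hr : 3 ≤ r) {k : ℕ} (hk : k ≤ 2) :
    ‖mean P V t k - mean P V t (k + 1)‖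
      ≤ 600 * θ * (‖mean P V t 0‖ + (3 * (1 / 2) ^ r + 27 * (r + 1) * e)) + 9 * (r + 1) * e := by
  have he0 : 0 ≤ e := le_trans (by positivity) he
  have hθn : 0 ≤ θ := le_trans (integral_nonneg fun _ => norm_nonneg _) (hθ 0 (by omega))
  have d := h.norm_mean_sub_succ_le hη0 hη1 hA he hθ0 hθ (k := k) (by omega)
  have hv := fun j hj => h.norm_mean_le (k := j) hη0 hη1 hA he hθ0 hθ hj
  set D := ‖mean P V t 0‖ + (3 * (1 / 2) ^ r + 27 * (r + 1) * e) with hD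
  have hD2 : (1 / 2 : ℝ) ^ r ≤ D / 3 := by
    have : 0 ≤ 27 * ((r : ℝ) + 1) * e := by positivity
    have := norm_nonneg (mean P V t 0)
    rw [hD]; linarith
  have hD0 : 0 ≤ D := by positivity
  have hs : ∑ m ∈ Finset.range (r - k), (1 / 16 : ℝ) ^ m * ‖mean P V t (k + m + 2)‖
      ≤ 16 * D * (8 / 7) := by
    calc _ ≤ ∑ m ∈ Finset.range (r - k), 16 * D * (1 / 8) ^ m := by
          refine Finset.sum_le_sum fun m hm => ?_
          have hm' := Finset.mem_range.1 hm
          have := hv (k + m + 2) (by omega)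
          have e8 : (1 / 8 : ℝ) ^ m = (1 / 16) ^ m * 2 ^ m := by rw [← mul_pow]; norm_num
          have e2 : (2 : ℝ) ^ (k + m + 2) ≤ 16 * 2 ^ m := by
            calc (2 : ℝ) ^ (k + m + 2) ≤ 2 ^ (m + 4) :=
                  pow_le_pow_right₀ (by norm_num) (by omega)
              _ = _ := by ring
          calc _ ≤ (1 / 16 : ℝ) ^ m * ((16 * 2 ^ m) * D) := by
                gcongr; exact this.trans (by gcongr)
            _ = _ := by rw [e8]; ring
      _ ≤ _ := by
        rw [← Finset.mul_sum]
        gcongr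
        exact sum_range_geometric_le (by norm_num) le_rfl _
  have hp : (1 / 16 : ℝ) ^ (r - k) ≤ (1 / 2) ^ r := by
    have : (1 / 16 : ℝ) = (1 / 2) ^ 4 := by norm_num
    rw [this, ← pow_mul]
    exact pow_le_pow_of_le_one (by norm_num) (by norm_num) (by omega)
  have hp' : 32 * θ * (1 / 16 : ℝ) ^ (r - k) ≤ 32 * θ * (D / 3) := by
    gcongr; exact hp.trans hD2
  have hs' := mul_le_mul_of_nonneg_left hs (by positivity : 0 ≤ 32 * θ)
  nlinarith [mul_nonneg hθn hD0]

set_option maxHeartbeats 1000000 in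
/-- First-order expansion of `E[y₀ exp(i t V₀)]` with a remainder proportional to the modulus of
the characteristic function. -/
lemma norm_integral_mul_osc_sub_variance_le (h : RingChain P r η I O y V) (hη0 : 0 < η)
    (hη1 : η ≤ 1) (hA : 8 ≤ A) (he : 22 * (8 ^ r * A) ^ 2 * η ≤ e) (hr : 3 ≤ r) (hκ : 0 < κ)
    (hκβ : κ ≤ β) (hκA : κ ^ 3 ≤ A) (htβ : 512 * (|t| * β) ≤ 1)
    (hy3 : ∀ k, k ≤ r → Integrable (fun ω => |y k ω| ^ 3) P)
    (hyβ : ∀ k, k ≤ r → ∫ ω, |y k ω| ^ 3 ∂P ≤ β ^ 3) (hyκ : ∫ ω, |y 0 ω| ^ 3 ∂P ≤ κ ^ 3)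
    (hy0 : ∫ ω, y 0 ω ∂P = 0) :
    ‖∫ ω, (y 0 ω : ℂ) * osc t (V 0 ω) ∂P
        - Complex.I * (t * (∫ ω, y 0 ω * y 0 ω ∂P + ∫ ω, y 0 ω * y 1 ω ∂P) : ℝ) * mean P V t 0‖
      ≤ 4000 * (t ^ 2 * (κ * β ^ 2))
          * (‖mean P V t 0‖ + (3 * (1 / 2) ^ r + 27 * (r + 1) * e)) + 9 * (1 + κ) * (r + 1) * e := by
  have he0 : 0 ≤ e := le_trans (by positivity) he
  have hβ : 0 < β := hκ.trans_le hκβ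
  have hym : ∀ k, k ≤ r → Measurable (y k) := fun k hk => h.measurable_ring hk
  have hv1 : ∀ j, ‖mean P V t j‖ ≤ 1 := fun j => norm_integral_osc_le_one _ _
  set θ := |t| * β with hθd
  have hθ0 : 0 ≤ θ := by positivity
  have hθ : ∀ k, k ≤ r → ∫ ω, ‖osc t (y k ω) - 1‖ ∂P ≤ θ := fun k hk =>
    (integral_norm_osc_sub_one_le (hym k hk) (hy3 k hk) hβ (hyβ k hk)).2.2
  have hv := fun j hj => h.norm_mean_le (k := j) hη0 hη1 hA he htβ hθ hj
  have dv := fun k hk => h.norm_mean_sub_succ_le_of_le_two (k := k) hη0 hη1 hA he htβ hθ hr hk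
  set D := ‖mean P V t 0‖ + (3 * (1 / 2) ^ r + 27 * (r + 1) * e) with hD
  have hD2 : (1 / 2 : ℝ) ^ r ≤ D / 3 := by
    have : 0 ≤ 27 * ((r : ℝ) + 1) * e := by positivity
    have := norm_nonneg (mean P V t 0)
    rw [hD]; linarith
  have hD0 : 0 ≤ D := by positivity
  set B := κ * β ^ 2 with hB
  have hB0 : 0 < B := by positivity
  -- Ring 0 is merged into the prefactor, and the expansion starts with ring 1.
  set G : Ω → ℂ := fun ω => (y 0 ω : ℂ) * osc t (y 0 ω) with hGd
  have hG : Measurable[I 0] G := (Complex.measurable_ofReal.comp (h.measurable_I 0 (by omega))).mul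
    ((measurable_osc t).comp (h.measurable_I 0 (by omega)))
  have hGm : Measurable G := hG.mono (h.I_le 0 (by omega)) le_rfl
  have hGn : ∀ ω, ‖G ω‖ = |y 0 ω| := fun ω => by
    simp [hGd, norm_osc]
  have hG3 : Integrable (fun ω => ‖G ω‖ ^ 3) P := by simpa only [hGn] using hy3 0 (by omega)
  have hGA : ∫ ω, ‖G ω‖ ^ 3 ∂P ≤ A := by simpa only [hGn] using hyκ.trans hκA
  have hGi : ∀ m, m ≤ r → Integrable (fun ω => G ω * ringProd t y 0 m ω) P := fun m hm =>
    h.integrable_mul_ringProd (by omega) hGm hG3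
  have main := h.norm_integral_mul_osc_sub_le (t := t) (k := 0) hη0 hη1 (by linarith) he
    (by omega) hG hG3 hGA (M := r) (by omega)
  have one3 : Integrable (fun _ : Ω => |(1 : ℝ)| ^ 3) P := by simp
  have t00 := integral_mul_mul_le_of_cube (hym 0 (by omega)) (hym 0 (by omega)) (hym 0 (by omega))
    (hy3 0 (by omega)) (hy3 0 (by omega)) (hy3 0 (by omega)) hκ hβ hβ hyκ (hyβ 0 (by omega))
    (hyβ 0 (by omega))
  have t001 := integral_mul_mul_le_of_cube (hym 0 (by omega)) (hym 0 (by omega)) (hym 1 (by omega))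
    (hy3 0 (by omega)) (hy3 0 (by omega)) (hy3 1 (by omega)) hκ hβ hβ hyκ (hyβ 0 (by omega))
    (hyβ 1 (by omega))
  have t011 := integral_mul_mul_le_of_cube (hym 0 (by omega)) (hym 1 (by omega)) (hym 1 (by omega))
    (hy3 0 (by omega)) (hy3 1 (by omega)) (hy3 1 (by omega)) hκ hβ hβ hyκ (hyβ 1 (by omega))
    (hyβ 1 (by omega))
  have t012 := integral_mul_mul_le_of_cube (hym 0 (by omega)) (hym 1 (by omega)) (hym 2 (by omega))
    (hy3 0 (by omega)) (hy3 1 (by omega)) (hy3 2 (by omega)) hκ hβ hβ hyκ (hyβ 1 (by omega))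
    (hyβ 2 (by omega))
  have d00 := integral_mul_mul_le_of_cube (hym 0 (by omega)) (hym 0 (by omega))
    (measurable_const (a := (1 : ℝ))) (hy3 0 (by omega)) (hy3 0 (by omega)) one3 hκ hβ one_pos
    hyκ (hyβ 0 (by omega)) (by simp)
  have d01 := integral_mul_mul_le_of_cube (hym 0 (by omega)) (hym 1 (by omega))
    (measurable_const (a := (1 : ℝ))) (hy3 0 (by omega)) (hy3 1 (by omega)) one3 hκ hβ one_pos
    hyκ (hyβ 1 (by omega)) (by simp)
  have hBB : κ * β * β = B := by rw [hB]; ring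
  rw [hBB] at t00 t001 t011 t012
  simp only [abs_one, mul_one] at d00 d01
  have int00 : Integrable (fun ω => y 0 ω * y 0 ω) P := by
    refine d00.1.mono' ((hym 0 (by omega)).mul (hym 0 (by omega))).aestronglyMeasurable
      (Eventually.of_forall fun ω => (abs_mul _ _).le)
  have int01 : Integrable (fun ω => y 0 ω * y 1 ω) P := by
    refine d01.1.mono' ((hym 0 (by omega)).mul (hym 1 (by omega))).aestronglyMeasurable
      (Eventually.of_forall fun ω => (abs_mul _ _).le)
  set b0 := ∫ ω, y 0 ω * y 0 ω ∂P with hb0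
  set b1 := ∫ ω, y 0 ω * y 1 ω ∂P with hb1
  have hb0' : |b0| ≤ κ * β := (abs_integral_le_integral_abs).trans (by
    simpa only [abs_mul] using d00.2)
  have hb1' : |b1| ≤ κ * β := (abs_integral_le_integral_abs).trans (by
    simpa only [abs_mul] using d01.2)
  have yi : Integrable (y 0) P :=
    (integral_norm_osc_sub_one_le (t := t) (hym 0 (by omega)) (hy3 0 (by omega)) hβ
      (hyβ 0 (by omega))).1
  have cint00 : Integrable (fun ω => ((t * (y 0 ω * y 0 ω) : ℝ) : ℂ) * Complex.I) P :=
    (int00.const_mul t).ofReal.mul_const _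
  have cint01 : Integrable (fun ω => ((t * (y 0 ω * y 1 ω) : ℝ) : ℂ) * Complex.I) P :=
    (int01.const_mul t).ofReal.mul_const _
  have cyi : Integrable (fun ω => (y 0 ω : ℂ)) P := yi.ofReal
  -- Taylor expansion of `exp(i t y₀)`: the zeroth-order term disappears because `y 0` is centred,
  -- and the first-order term is the variance.
  have g0 : ‖∫ ω, G ω * ringProd t y 0 0 ω ∂P - Complex.I * (t * b0 : ℝ)‖ ≤ 3 * (t ^ 2 * B) := by
    have e1 : Complex.I * (t * b0 : ℝ) = ∫ ω, ((y 0 ω : ℂ) + (t * (y 0 ω * y 0 ω) : ℝ) * Complex.I) ∂P := by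
      rw [integral_add cyi cint00, integral_mul_const,
        integral_complex_ofReal, integral_complex_ofReal, hy0, integral_const_mul, ← hb0]
      simp [mul_comm]
    rw [e1, ← integral_sub (hGi 0 (by omega)) (cyi.fun_add cint00)]
    refine (norm_integral_le_of_norm_le (t00.1.const_mul (3 * t ^ 2))
      (Eventually.of_forall fun ω => ?_)).trans ?_
    · have : G ω * ringProd t y 0 0 ω - ((y 0 ω : ℂ) + (t * (y 0 ω * y 0 ω) : ℝ) * Complex.I)
          = y 0 ω * (osc t (y 0 ω) - 1 - (t * y 0 ω : ℝ) * Complex.I) := by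
        simp only [hGd, ringProd, Finset.range_zero, Finset.prod_empty]; push_cast; ring
      rw [this, norm_mul, Complex.norm_real, Real.norm_eq_abs]
      calc _ ≤ |y 0 ω| * (3 * (t ^ 2 * y 0 ω ^ 2)) := by
            gcongr; exact norm_osc_sub_one_sub_le _ _
        _ = _ := by rw [← sq_abs (y 0 ω)]; ring
    · rw [integral_const_mul]
      nlinarith [t00.2, sq_nonneg t]
  have g1 : ‖∫ ω, G ω * ringProd t y 0 1 ω ∂P - Complex.I * (t * b1 : ℝ)‖ ≤ 4 * (t ^ 2 * B) := by
    have e1 : Complex.I * (t * b1 : ℝ) = ∫ ω, ((t * (y 0 ω * y 1 ω) : ℝ) * Complex.I) ∂P := by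
      rw [integral_mul_const, integral_complex_ofReal, integral_const_mul, mul_comm]
    rw [e1, ← integral_sub (hGi 1 (by omega)) cint01]
    refine (norm_integral_le_of_norm_le
      ((t001.1.const_mul (t ^ 2)).add (t011.1.const_mul (3 * t ^ 2)))
      (Eventually.of_forall fun ω => ?_)).trans ?_
    · have : G ω * ringProd t y 0 1 ω - (t * (y 0 ω * y 1 ω) : ℝ) * Complex.I
          = y 0 ω * ((osc t (y 0 ω) - 1) * (osc t (y 1 ω) - 1))
            + y 0 ω * (osc t (y 1 ω) - 1 - (t * y 1 ω : ℝ) * Complex.I) := by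
        simp only [hGd, ringProd, Finset.range_one, Finset.prod_singleton, add_zero, zero_add]
        push_cast; ring
      rw [this]
      refine (norm_add_le _ _).trans ?_
      simp only [norm_mul, Complex.norm_real, Real.norm_eq_abs, Pi.add_apply]
      refine add_le_add ?_ ?_
      · calc _ ≤ |y 0 ω| * ((|t| * |y 0 ω|) * (|t| * |y 1 ω|)) := by
              gcongr <;> exact norm_osc_sub_one_le _ _
          _ = _ := by rw [← sq_abs t]; ring
      · calc _ ≤ |y 0 ω| * (3 * (t ^ 2 * y 1 ω ^ 2)) := by
              gcongr; exact norm_osc_sub_one_sub_le _ _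
          _ = _ := by rw [← sq_abs (y 1 ω)]; ring
    · simp only [Pi.add_apply]
      rw [integral_add (t001.1.const_mul _) (t011.1.const_mul _), integral_const_mul,
        integral_const_mul]
      nlinarith [t001.2, t011.2, sq_nonneg t]
  -- From two ring factors on, the product is of second order in `t`. Only the products with no
  -- factor and with one factor have a first-order part.
  have q2 : ∫ ω, ‖G ω * ringProd t y 0 2 ω‖ ∂P ≤ t ^ 2 * B := by
    refine (integral_mono (hGi 2 (by omega)).norm (t012.1.const_mul (t ^ 2)) fun ω => ?_).trans ?_
    · simp only [ringProd, Finset.prod_range_succ, Finset.range_zero, Finset.prod_empty, one_mul,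
        norm_mul, hGn]
      calc _ ≤ |y 0 ω| * ((|t| * |y 1 ω|) * (|t| * |y 2 ω|)) := by
            gcongr <;> exact norm_osc_sub_one_le _ _
        _ = _ := by rw [← sq_abs t]; ring
    · rw [integral_const_mul]
      gcongr; exact t012.2
  have q3 : ∫ ω, ‖G ω * ringProd t y 0 3 ω‖ ∂P ≤ 2 * (t ^ 2 * B) := by
    have := integral_mono (hGi 3 (by omega)).norm ((hGi 2 (by omega)).norm.const_mul 2) fun ω => by
      simp only [ringProd_succ _ _ _ 2, norm_mul]
      have := norm_osc_sub_one_le_two t (y (0 + 2 + 1) ω)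
      calc ‖G ω‖ * (‖ringProd t y 0 2 ω‖ * ‖osc t (y (0 + 2 + 1) ω) - 1‖)
          ≤ ‖G ω‖ * (‖ringProd t y 0 2 ω‖ * 2) := by gcongr
        _ = _ := by ring
    rw [integral_const_mul] at this
    linarith
  have htB : 0 ≤ t ^ 2 * B := by positivity
  -- Geometric decay starts at `n = 2`, with `C = 32 * (t ^ 2 * B)` chosen so that `q3` is exactly
  -- the bound `C / 16`.
  have q : ∀ m, m + 2 ≤ r →
      ∫ ω, ‖G ω * ringProd t y 0 (2 + m) ω‖ ∂P ≤ 32 * (t ^ 2 * B) * (1 / 16) ^ m + 4 * e :=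
    fun m hm => h.integral_norm_mul_ringProd_le_geometric hη0 hη1 (by linarith) he htβ hθ
      (n := 2) hG hG3 hGA (C := 32 * (t ^ 2 * B)) (by linarith) (fun h => by linarith [q3])
      (m := m) (by omega)
  obtain ⟨s, rfl⟩ : ∃ s, r = s + 2 := ⟨r - 2, by omega⟩
  have tailsum : ‖∑ m ∈ Finset.range s, (∫ ω, G ω * ringProd t y 0 (m + 1 + 1) ω ∂P)
      * mean P V t (0 + (m + 1 + 1) + 2)‖ ≤ 600 * (t ^ 2 * B) * D + s * (4 * e) := by
    calc _ ≤ ∑ m ∈ Finset.range s, (512 * (t ^ 2 * B) * D * (1 / 8) ^ m + 4 * e) := by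
          refine (norm_sum_le _ _).trans (Finset.sum_le_sum fun m hm => ?_)
          have hm' := Finset.mem_range.1 hm
          rw [norm_mul]
          have a1 := (norm_integral_le_integral_norm _).trans (q m (by omega))
          have e3 : 2 + m = m + 1 + 1 := by ring
          rw [e3] at a1
          have a2 := hv1 (0 + (m + 1 + 1) + 2)
          have a3 := hv (0 + (m + 1 + 1) + 2) (by omega)
          have e8 : (1 / 8 : ℝ) ^ m = (1 / 16) ^ m * 2 ^ m := by rw [← mul_pow]; norm_num
          have e4 : (2 : ℝ) ^ (0 + (m + 1 + 1) + 2) = 16 * 2 ^ m := by ring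
          rw [e4] at a3
          calc _ ≤ (32 * (t ^ 2 * B) * (1 / 16) ^ m + 4 * e)
                * ‖mean P V t (0 + (m + 1 + 1) + 2)‖ := by gcongr
            _ = 32 * (t ^ 2 * B) * (1 / 16) ^ m * ‖mean P V t (0 + (m + 1 + 1) + 2)‖
                + 4 * e * ‖mean P V t (0 + (m + 1 + 1) + 2)‖ := by ring
            _ ≤ 32 * (t ^ 2 * B) * (1 / 16) ^ m * (16 * 2 ^ m * D) + 4 * e * 1 := by gcongr
            _ = _ := by rw [e8]; ring
      _ ≤ 512 * (t ^ 2 * B) * D * (8 / 7) + s * (4 * e) := by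
        rw [Finset.sum_add_distrib, ← Finset.mul_sum, Finset.sum_const, Finset.card_range,
          nsmul_eq_mul]
        gcongr
        exact sum_range_geometric_le (by norm_num) le_rfl _
      _ ≤ _ := by nlinarith [mul_nonneg htB hD0]
  have rem : ∫ ω, ‖G ω * ringProd t y 0 (s + 2) ω‖ ∂P ≤ 11 * (t ^ 2 * B) * D + 4 * e := by
    have := q s (by omega)
    rw [add_comm 2 s] at this
    have hp : (1 / 16 : ℝ) ^ s ≤ (1 / 2) ^ (s + 2) := by
      have : (1 / 16 : ℝ) = (1 / 2) ^ 4 := by norm_num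
      rw [this, ← pow_mul]
      exact pow_le_pow_of_le_one (by norm_num) (by norm_num) (by omega)
    have : 32 * (t ^ 2 * B) * (1 / 16 : ℝ) ^ s ≤ 32 * (t ^ 2 * B) * (D / 3) := by
      gcongr; exact hp.trans hD2
    nlinarith [mul_nonneg htB hD0]
  have e0 : ∫ ω, (y 0 ω : ℂ) * osc t (V 0 ω) ∂P = ∫ ω, G ω * osc t (V (0 + 1) ω) ∂P := by
    refine integral_congr_ae (Eventually.of_forall fun ω => ?_)
    simp only [hGd, h.step 0 (by omega), osc_add]; ring
  rw [e0]
  -- The terms `m = 0` and `m = 1`, which carry the first order in `t`, are taken out of the sum.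
  rw [Finset.sum_range_succ', Finset.sum_range_succ'] at main
  simp only [zero_add] at main g1 tailsum ⊢
  have m02 := dv 0 (by omega)
  have m12 := dv 1 (by omega)
  have m23 := dv 2 (by omega)
  simp only [zero_add, Nat.reduceAdd] at m02 m12 m23 main
  have n2 := hv 2 (by omega)
  have n3 := hv 3 (by omega)
  set v0 := mean P V t 0
  set v1 := mean P V t 1
  set v2 := mean P V t 2
  set v3 := mean P V t 3
  set X := ∫ ω, G ω * osc t (V 1 ω) ∂P
  set x0 := ∫ ω, G ω * ringProd t y 0 0 ω ∂P
  set x1 := ∫ ω, G ω * ringProd t y 0 1 ω ∂P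
  set tl := ∑ m ∈ Finset.range s, (∫ ω, G ω * ringProd t y 0 (m + 1 + 1) ω ∂P)
      * mean P V t (m + 1 + 1 + 2)
  have k4 : (s : ℝ) * (4 * e) + (((s + 2 : ℕ) : ℝ) * e + 4 * e)
      ≤ 9 * (((s + 2 : ℕ) : ℝ) + 1) * e := by
    push_cast; nlinarith [mul_nonneg (Nat.cast_nonneg s : (0 : ℝ) ≤ s) he0]
  have hc : |t| * (κ * β) ≤ κ * θ := le_of_eq (by rw [hθd]; ring)
  have hθθ : κ * θ * θ = t ^ 2 * B := by rw [hθd, hB, ← sq_abs t]; ring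
  have k5 : 9 * (1 + κ) * (((s + 2 : ℕ) : ℝ) + 1) * e
      = (1 + κ) * (9 * (((s + 2 : ℕ) : ℝ) + 1) * e) := by ring
  rw [k5]
  exact norm_expansion_le hκ.le hθ0 htβ hD0 (by positivity) htB hθθ hc hb0' hb1' m02 m12 m23 n2 n3
    g0 g1 (main.trans (by linarith only [rem])) tailsum k4

end RingChain

end WeakDependence

namespace WeakDependence

/-! ### Esseen's smoothing inequality by means of the Fejér kernel. -/

section Smoothing

/-- The (unnormalised) Fejér kernel, as the cosine transform of a triangle. -/
noncomputable def fejer (u : ℝ) : ℝ := ∫ s in (0 : ℝ)..1, (1 - s) * Real.cos (s * u)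

lemma continuous_fejer : Continuous fejer :=
  intervalIntegral.continuous_parametric_intervalIntegral_of_continuous'
    (f := fun u s : ℝ => (1 - s) * Real.cos (s * u)) (by fun_prop) 0 1

/-- The integrand times `u ^ 2` has an elementary primitive. The identity yields both the positivity
of the kernel and its decay like `u ^ (-2)`. -/
lemma fejer_mul_sq (u : ℝ) : fejer u * u ^ 2 = 1 - Real.cos u := by
  have hd : ∀ s ∈ uIcc (0 : ℝ) 1, HasDerivAt
      (fun s => (1 - s) * Real.sin (s * u) * u - Real.cos (s * u))
      ((1 - s) * Real.cos (s * u) * u ^ 2) s := by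
    intro s _
    have h1 : HasDerivAt (fun s : ℝ => s * u) u s := by simpa using (hasDerivAt_id s).mul_const u
    have h2 : HasDerivAt (fun s : ℝ => 1 - s) (-1) s := by
      simpa using (hasDerivAt_id s).const_sub 1
    refine (((h2.mul h1.sin).mul_const u).sub h1.cos).congr_deriv ?_
    ring
  have := intervalIntegral.integral_eq_sub_of_hasDerivAt hd
    (Continuous.intervalIntegrable (by fun_prop) _ _)
  rw [intervalIntegral.integral_mul_const] at this
  rw [fejer, this]; simp; ring

lemma fejer_zero : fejer 0 = 1 / 2 := by
  simp only [fejer, mul_zero, Real.cos_zero, mul_one]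
  rw [intervalIntegral.integral_sub (by simp) (by simp)]
  simp; norm_num

lemma fejer_nonneg (u : ℝ) : 0 ≤ fejer u := by
  by_cases hu : u = 0
  · rw [hu, fejer_zero]; norm_num
  · have h := fejer_mul_sq u
    have h1 := Real.cos_le_one u
    have : 0 < u ^ 2 := by positivity
    by_contra hneg
    push Not at hneg
    nlinarith

lemma fejer_le (u : ℝ) : fejer u ≤ 3 * (1 + u ^ 2)⁻¹ := by
  have h1 : fejer u ≤ 1 := by
    refine (le_abs_self _).trans ?_
    have := intervalIntegral.norm_integral_le_of_norm_le_const (a := (0 : ℝ)) (b := 1) (C := 1)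
      (f := fun s => (1 - s) * Real.cos (s * u)) (fun s hs => by
        rw [uIoc_of_le zero_le_one] at hs
        rw [Real.norm_eq_abs, abs_mul, abs_of_nonneg (by linarith [hs.2])]
        have := Real.abs_cos_le_one (s * u)
        nlinarith [hs.1, abs_nonneg (Real.cos (s * u))])
    simpa [fejer] using this
  have h2 := fejer_mul_sq u
  have h3 := Real.neg_one_le_cos u
  rw [← div_eq_mul_inv, le_div_iff₀ (by positivity)]
  nlinarith

lemma integrable_fejer : Integrable fejer :=
  (integrable_inv_one_add_sq.const_mul 3).mono' continuous_fejer.aestronglyMeasurable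
    (Eventually.of_forall fun u => by
      rw [Real.norm_eq_abs, abs_of_nonneg (fejer_nonneg u)]; exact fejer_le u)

lemma integral_fejer_pos : 0 < ∫ u, fejer u := by
  rw [integral_pos_iff_support_of_nonneg fejer_nonneg integrable_fejer]
  exact continuous_fejer.isOpen_support.measure_pos _ ⟨0, by simp [fejer_zero]⟩

/-- Any proportion above one half would do for the smoothing inequality: the window must outweigh
the rest of the kernel. -/
lemma exists_fejer_tail : ∃ a : ℝ, 0 < a ∧
    3 / 4 * ∫ u, fejer u ≤ ∫ u in Ioc (-a) a, fejer u := by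
  have h := intervalIntegral_tendsto_integral integrable_fejer tendsto_neg_atTop_atBot tendsto_id
  have hc := integral_fejer_pos
  have := (h.eventually (lt_mem_nhds (show 3 / 4 * ∫ u, fejer u < ∫ u, fejer u by linarith))).and
    (eventually_gt_atTop (0 : ℝ))
  obtain ⟨a, h1, h2⟩ := this.exists
  refine ⟨a, h2, ?_⟩
  rw [intervalIntegral.integral_of_le (by simp; linarith)] at h1
  exact h1.le

lemma integral_fejer_eq (u : ℝ) :
    ∫ x in (0 : ℝ)..u, fejer x = ∫ s in (0 : ℝ)..1, (1 - s) * ∫ x in (0 : ℝ)..u, Real.cos (s * x) := by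
  simp only [fejer]
  rw [intervalIntegral_intervalIntegral_swap]
  · simp_rw [intervalIntegral.integral_const_mul]
  · have hc : Continuous (Function.uncurry fun x s : ℝ => (1 - s) * Real.cos (s * x)) := by
      unfold Function.uncurry; fun_prop
    exact (hc.continuousOn.integrableOn_compact (isCompact_uIcc.prod isCompact_uIcc)).mono_set
      (prod_mono uIoc_subset_uIcc uIoc_subset_uIcc)

/-- The Fourier representation of the primitive of the Fejér kernel. -/
noncomputable def fejerSine (s w : ℝ) : ℝ := (1 - s) * (Real.sin (s * w) / s)

lemma abs_fejerSine_le {s : ℝ} (hs : s ∈ Ioc (0 : ℝ) 1) (w : ℝ) : |fejerSine s w| ≤ |w| := by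
  unfold fejerSine
  rw [abs_mul, abs_div, abs_of_nonneg (by linarith [hs.2] : 0 ≤ 1 - s), abs_of_pos hs.1]
  have h1 : |Real.sin (s * w)| ≤ s * |w| := by
    have := Real.abs_sin_le_abs (x := s * w)
    rwa [abs_mul, abs_of_pos hs.1] at this
  have h2 : |Real.sin (s * w)| / s ≤ |w| := by
    rw [div_le_iff₀ hs.1]; linarith
  have h3 : 0 ≤ |Real.sin (s * w)| / s := div_nonneg (abs_nonneg _) hs.1.le
  nlinarith [hs.1, abs_nonneg w]

lemma integral_fejer_eq_fejerSine (u : ℝ) :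
    ∫ x in (0 : ℝ)..u, fejer x = ∫ s in (0 : ℝ)..1, fejerSine s u := by
  rw [integral_fejer_eq]
  refine intervalIntegral.integral_congr_ae (Eventually.of_forall fun s hs => ?_)
  rw [uIoc_of_le zero_le_one] at hs
  have hs0 : s ≠ 0 := hs.1.ne'
  rw [fejerSine, intervalIntegral.integral_comp_mul_left (fun x => Real.cos x) hs0]
  simp [div_eq_inv_mul]

variable {μ ν : Measure ℝ} [IsProbabilityMeasure μ] [IsProbabilityMeasure ν]

lemma integrable_fejerSine_prod (hμ : Integrable id μ) (T z : ℝ) :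
    Integrable (Function.uncurry fun s x : ℝ => fejerSine s (T * (z - x)))
      ((volume.restrict (uIoc (0 : ℝ) 1)).prod μ) := by
  rw [uIoc_of_le zero_le_one]
  have hd : Integrable (fun p : ℝ × ℝ => |T| * (|z| + |p.2|))
      ((volume.restrict (Ioc (0 : ℝ) 1)).prod μ) :=
    (((integrable_const |z|).add hμ.abs).const_mul |T|).comp_snd _
  refine hd.mono' ?_ ?_
  · refine Measurable.aestronglyMeasurable ?_
    unfold Function.uncurry fejerSine
    fun_prop
  · have : ∀ᵐ p ∂((volume.restrict (Ioc (0 : ℝ) 1)).prod μ), p.1 ∈ Ioc (0 : ℝ) 1 :=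
      Measure.quasiMeasurePreserving_fst.ae (ae_restrict_mem measurableSet_Ioc)
    filter_upwards [this] with p hp
    refine (abs_fejerSine_le hp _).trans ?_
    rw [abs_mul]
    gcongr
    exact abs_sub _ _

lemma integral_fejerSine_eq (μ : Measure ℝ) [IsProbabilityMeasure μ] (s T z : ℝ) :
    ∫ x, fejerSine s (T * (z - x)) ∂μ
      = (1 - s) * ((Complex.exp ((s * T * z : ℝ) * Complex.I) * charFun μ (-(s * T))).im / s) := by
  simp only [fejerSine]
  rw [integral_const_mul, integral_div, charFun_apply_real, ← integral_const_mul]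
  have hi : Integrable (fun x : ℝ => Complex.exp ((s * T * z : ℝ) * Complex.I)
      * Complex.exp (((-(s * T) : ℝ) : ℂ) * x * Complex.I)) μ := by
    refine Integrable.of_bound (by fun_prop) 1 (Eventually.of_forall fun x => ?_)
    rw [norm_mul, Complex.norm_exp_ofReal_mul_I, ← Complex.ofReal_mul,
      Complex.norm_exp_ofReal_mul_I, one_mul]
  have him : ∀ {f : ℝ → ℂ}, Integrable f μ → (∫ x, f x ∂μ).im = ∫ x, (f x).im ∂μ :=
    fun hf => (integral_im hf).symm
  rw [him hi]
  have pw : ∀ x : ℝ, Real.sin (s * (T * (z - x))) = (Complex.exp ((s * T * z : ℝ) * Complex.I)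
      * Complex.exp (((-(s * T) : ℝ) : ℂ) * x * Complex.I)).im := fun x => ?_
  · simp_rw [pw]
  rw [← Complex.exp_add]
  have : ((s * T * z : ℝ) : ℂ) * Complex.I + ((-(s * T) : ℝ) : ℂ) * x * Complex.I
      = ((s * (T * (z - x)) : ℝ) : ℂ) * Complex.I := by push_cast; ring
  rw [this, Complex.exp_ofReal_mul_I_im]

/-- After an exchange of integrals, the smoothed difference involves the characteristic functions at
the frequencies `s * T` with `0 < s ≤ 1` alone. The factor `t` in the hypothesis cancels the `1 / s`
of the sine kernel. -/
lemma abs_integral_fejer_sub_le (hμ : Integrable id μ) (hν : Integrable id ν) {T : ℝ} (hT : 0 < T)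
    {B : ℝ → ℝ} (hB : IntervalIntegrable B volume 0 T)
    (hμν : ∀ t ∈ Ioc 0 T, ‖charFun μ t - charFun ν t‖ ≤ t * B t) (z : ℝ) :
    |∫ x, (∫ u in (0 : ℝ)..(T * (z - x)), fejer u) ∂μ
      - ∫ x, (∫ u in (0 : ℝ)..(T * (z - x)), fejer u) ∂ν| ≤ ∫ t in (0 : ℝ)..T, B t := by
  simp_rw [integral_fejer_eq_fejerSine]
  rw [← intervalIntegral_integral_swap (integrable_fejerSine_prod hμ T z),
    ← intervalIntegral_integral_swap (integrable_fejerSine_prod hν T z)]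
  have hii : ∀ κ : Measure ℝ, IsProbabilityMeasure κ → Integrable id κ →
      IntervalIntegrable (fun s => ∫ x, fejerSine s (T * (z - x)) ∂κ) volume 0 1 := by
    intro κ _ hκ
    rw [intervalIntegrable_iff]
    exact (integrable_fejerSine_prod hκ T z).integral_prod_left
  rw [← intervalIntegral.integral_sub (hii μ inferInstance hμ) (hii ν inferInstance hν)]
  have hBT : IntervalIntegrable (fun s => T * B (T * s)) volume 0 1 := by
    have := (hB.comp_mul_left (c := T)).const_mul T
    simpa [hT.ne'] using this
  have e : ∫ t in (0 : ℝ)..T, B t = ∫ s in (0 : ℝ)..1, T * B (T * s) := by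
    rw [intervalIntegral.integral_const_mul, intervalIntegral.mul_integral_comp_mul_left]
    simp
  rw [e, ← Real.norm_eq_abs]
  refine intervalIntegral.norm_integral_le_of_norm_le zero_le_one
    (Eventually.of_forall fun s hs => ?_) hBT
  rw [integral_fejerSine_eq, integral_fejerSine_eq]
  set ex := Complex.exp ((s * T * z : ℝ) * Complex.I)
  have hex : ‖ex‖ = 1 := Complex.norm_exp_ofReal_mul_I _
  have e2 : (1 - s) * ((ex * charFun μ (-(s * T))).im / s) - (1 - s) * ((ex * charFun ν (-(s * T))).im / s)
      = (1 - s) * ((ex * (charFun μ (-(s * T)) - charFun ν (-(s * T)))).im / s) := by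
    rw [mul_sub, Complex.sub_im]; ring
  have hsT : s * T ∈ Ioc 0 T := ⟨mul_pos hs.1 hT, by nlinarith [hs.2]⟩
  have h1 : |(ex * (charFun μ (-(s * T)) - charFun ν (-(s * T)))).im| ≤ s * T * B (s * T) := by
    refine (Complex.abs_im_le_norm _).trans ?_
    rw [norm_mul, hex, one_mul, charFun_neg, charFun_neg, ← map_sub, RCLike.norm_conj]
    exact hμν _ hsT
  rw [e2, Real.norm_eq_abs, abs_mul, abs_div, abs_of_nonneg (by linarith [hs.2] : 0 ≤ 1 - s),
    abs_of_pos hs.1]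
  have h2 : |(ex * (charFun μ (-(s * T)) - charFun ν (-(s * T)))).im| / s ≤ T * B (T * s) := by
    rw [div_le_iff₀ hs.1, mul_comm T s]; linarith
  have h3 := div_nonneg (abs_nonneg (ex * (charFun μ (-(s * T)) - charFun ν (-(s * T)))).im) hs.1.le
  nlinarith [hs.1]

/-- Convolution of a distribution function with the rescaled kernel. -/
lemma integral_measure_Iio_mul_fejer (μ : Measure ℝ) [IsProbabilityMeasure μ] {T : ℝ} (hT : 0 < T)
    (z : ℝ) :
    Integrable (fun u => μ.real (Iio (z - u / T)) * fejer u) ∧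
    ∫ u, μ.real (Iio (z - u / T)) * fejer u
      = (∫ u in Iic (0 : ℝ), fejer u) + ∫ x, (∫ u in (0 : ℝ)..(T * (z - x)), fejer u) ∂μ := by
  have hset : MeasurableSet {p : ℝ × ℝ | p.2 < z - p.1 / T} :=
    measurableSet_lt measurable_snd (by fun_prop)
  have hprod : Integrable (Function.uncurry fun u x : ℝ => (Iio (z - u / T)).indicator
      (fun _ => fejer u) x) (volume.prod μ) := by
    have h1 : Integrable (fun p : ℝ × ℝ => fejer p.1) (volume.prod μ) := integrable_fejer.comp_fst _
    refine (h1.indicator hset).congr (Eventually.of_forall fun p => ?_)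
    simp only [Function.uncurry, indicator, mem_ofPred_eq, mem_Iio]
  have e1 : ∀ u, ∫ x, (Iio (z - u / T)).indicator (fun _ => fejer u) x ∂μ
      = μ.real (Iio (z - u / T)) * fejer u := fun u => by
    rw [integral_indicator measurableSet_Iio, setIntegral_const, smul_eq_mul]
  have e2 : ∀ x, ∫ u, (Iio (z - u / T)).indicator (fun _ => fejer u) x
      = (∫ u in Iic (0 : ℝ), fejer u) + ∫ u in (0 : ℝ)..(T * (z - x)), fejer u := fun x => by
    rw [← intervalIntegral.integral_Iic_sub_Iic integrable_fejer.integrableOn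
      integrable_fejer.integrableOn, add_sub_cancel, integral_Iic_eq_integral_Iio,
      ← integral_indicator measurableSet_Iio]
    congr 1
    ext u
    have : x < z - u / T ↔ u < T * (z - x) := by
      rw [lt_sub_iff_add_lt, add_comm, ← lt_sub_iff_add_lt, div_lt_iff₀ hT, mul_comm]
    simp only [indicator, mem_Iio, this]
  have hL : Integrable (fun x => (∫ u in Iic (0 : ℝ), fejer u)
      + ∫ u in (0 : ℝ)..(T * (z - x)), fejer u) μ := by
    have := hprod.integral_prod_right
    simpa only [Function.uncurry, e2] using this
  have hL' : Integrable (fun x => ∫ u in (0 : ℝ)..(T * (z - x)), fejer u) μ := by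
    refine (hL.sub (integrable_const (∫ u in Iic (0 : ℝ), fejer u))).congr
      (Eventually.of_forall fun x => ?_)
    simp
  constructor
  · have := hprod.integral_prod_left
    simpa only [Function.uncurry, e1] using this
  · simp_rw [← e1]
    rw [integral_integral_swap hprod]
    simp_rw [e2]
    rw [integral_add (integrable_const _) hL']
    simp

/-- Esseen's smoothing inequality. -/
theorem exists_smoothing_constant : ∃ C : ℝ, 0 < C ∧ ∀ (μ ν : Measure ℝ) [IsProbabilityMeasure μ]
    [IsProbabilityMeasure ν], Integrable id μ → Integrable id ν →
    (∀ x y, x ≤ y → ν.real (Iio y) ≤ ν.real (Iio x) + (y - x)) → ∀ T : ℝ, 0 < T →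
    ∀ B : ℝ → ℝ, IntervalIntegrable B volume 0 T →
    (∀ t ∈ Ioc 0 T, ‖charFun μ t - charFun ν t‖ ≤ t * B t) →
    ∀ x, |μ.real (Iio x) - ν.real (Iio x)| ≤ C * ((∫ t in (0 : ℝ)..T, B t) + 1 / T) := by
  obtain ⟨a, ha, hca⟩ := exists_fejer_tail
  have hc := integral_fejer_pos
  set c := ∫ u, fejer u with hcdef
  refine ⟨2 / c + 4 * a, by positivity, ?_⟩
  intro μ ν _ _ hμ hν hlip T hT B hB hμν
  set J := ∫ t in (0 : ℝ)..T, B t with hJ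
  set Δ : ℝ → ℝ := fun x => μ.real (Iio x) - ν.real (Iio x) with hΔ
  have hconv : ∀ z, |∫ u, Δ (z - u / T) * fejer u| ≤ J := fun z => by
    have h1 := integral_measure_Iio_mul_fejer μ hT z
    have h2 := integral_measure_Iio_mul_fejer ν hT z
    have e : ∫ u, Δ (z - u / T) * fejer u
        = ∫ x, (∫ u in (0 : ℝ)..(T * (z - x)), fejer u) ∂μ
          - ∫ x, (∫ u in (0 : ℝ)..(T * (z - x)), fejer u) ∂ν := by
      simp only [hΔ, sub_mul]
      rw [integral_sub h1.1 h2.1, h1.2, h2.2]; ring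
    rw [e]
    exact abs_integral_fejer_sub_le hμ hν hT hB hμν z
  have hint : ∀ z, Integrable (fun u => Δ (z - u / T) * fejer u) := fun z => by
    simp only [hΔ, sub_mul]
    exact (integral_measure_Iio_mul_fejer μ hT z).1.sub (integral_measure_Iio_mul_fejer ν hT z).1
  have hJ0 : 0 ≤ J := (abs_nonneg _).trans (hconv 0)
  have hΔ1 : ∀ x, |Δ x| ≤ 1 := fun x => abs_sub_le_of_nonneg_of_le measureReal_nonneg
    measureReal_le_one measureReal_nonneg measureReal_le_one
  set η := sSup (range fun x => |Δ x|) with hη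
  have hbdd : BddAbove (range fun x => |Δ x|) := ⟨1, by rintro _ ⟨x, rfl⟩; exact hΔ1 x⟩
  have hle : ∀ x, |Δ x| ≤ η := fun x => le_csSup hbdd ⟨x, rfl⟩
  have hη0 : 0 ≤ η := (abs_nonneg _).trans (hle 0)
  set p := ∫ u in Ioc (-a) a, fejer u with hp
  have hpc : p ≤ c := setIntegral_le_integral integrable_fejer (Eventually.of_forall fejer_nonneg)
  have htail : ∫ u in (Ioc (-a) a)ᶜ, fejer u = c - p := by
    rw [← integral_add_compl measurableSet_Ioc integrable_fejer (s := Ioc (-a) a)] at hcdef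
    linarith
  -- a lower bound on the window propagates to the convolution
  have core : ∀ (σ d z : ℝ), |σ| = 1 → (∀ u ∈ Ioc (-a) a, d ≤ σ * Δ (z - u / T)) →
      d * p ≤ J + η * (c - p) := by
    intro σ d z hσ hd
    have h1 : ∫ u, σ * (Δ (z - u / T) * fejer u) ≤ J := by
      rw [integral_const_mul]
      refine (le_abs_self _).trans ?_
      rw [abs_mul, hσ, one_mul]; exact hconv z
    rw [← integral_add_compl (measurableSet_Ioc (a := -a) (b := a)) ((hint z).const_mul σ)] at h1
    have h2 : d * p ≤ ∫ u in Ioc (-a) a, σ * (Δ (z - u / T) * fejer u) := by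
      rw [hp, ← integral_const_mul]
      refine setIntegral_mono_on (integrable_fejer.integrableOn.const_mul d)
        ((hint z).const_mul σ).integrableOn measurableSet_Ioc fun u hu => ?_
      rw [← mul_assoc]
      exact mul_le_mul_of_nonneg_right (hd u hu) (fejer_nonneg u)
    have h3 : -(η * (c - p)) ≤ ∫ u in (Ioc (-a) a)ᶜ, σ * (Δ (z - u / T) * fejer u) := by
      rw [← htail, ← neg_mul, ← integral_const_mul]
      refine setIntegral_mono_on (integrable_fejer.integrableOn.const_mul _)
        ((hint z).const_mul σ).integrableOn measurableSet_Ioc.compl fun u _ => ?_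
      rw [← mul_assoc]
      refine mul_le_mul_of_nonneg_right ?_ (fejer_nonneg u)
      have : |σ * Δ (z - u / T)| ≤ η := by rw [abs_mul, hσ, one_mul]; exact hle _
      exact (abs_le.1 this).1
    linarith
  have haT : 0 < a / T := by positivity
  have hwin : ∀ u ∈ Ioc (-a) a, -(a / T) ≤ u / T ∧ u / T ≤ a / T := fun u hu =>
    ⟨by rw [← neg_div]; exact div_le_div_of_nonneg_right hu.1.le hT.le,
      div_le_div_of_nonneg_right hu.2 hT.le⟩
  have hmono : ∀ x y, x ≤ y → μ.real (Iio x) ≤ μ.real (Iio y) := fun x y h =>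
    measureReal_mono (Iio_subset_Iio h)
  -- The point of evaluation is shifted by `a / T`, so that the window lies to the right of `x` when
  -- `Δ x ≥ 0` and to the left otherwise. There monotonicity of `μ` and the Lipschitz bound for `ν`
  -- preserve the size of `Δ` up to `2 * a / T`.
  have both : ∀ x, |Δ x| * p ≤ J + 2 * (a / T) * p + η * (c - p) := fun x => by
    rcases le_total 0 (Δ x) with h0 | h0
    · have := core 1 (Δ x - 2 * (a / T)) (x + a / T) (by simp) fun u hu => by
        have hw := hwin u hu
        have m1 := hmono x (x + a / T - u / T) (by linarith)
        have m2 := hlip x (x + a / T - u / T) (by linarith)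
        simp only [hΔ, one_mul]; linarith
      rw [abs_of_nonneg h0]; linarith
    · have := core (-1) (-Δ x - 2 * (a / T)) (x - a / T) (by simp) fun u hu => by
        have hw := hwin u hu
        have m1 := hmono (x - a / T - u / T) x (by linarith)
        have m2 := hlip (x - a / T - u / T) x (by linarith)
        simp only [hΔ]; linarith
      rw [abs_of_nonpos h0]; linarith
  have hηp : η * p ≤ J + 2 * (a / T) * p + η * (c - p) := by
    have hp0 : 0 < p := by linarith
    rw [← le_div_iff₀ hp0]
    refine csSup_le (range_nonempty _) ?_
    rintro _ ⟨x, rfl⟩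
    rw [le_div_iff₀ hp0]; exact both x
  -- As `p ≥ 3 * c / 4`, the coefficient `2 * p - c` of `η` is at least `c / 2`.
  have hfin : η * c ≤ 2 * J + 4 * (a / T) * c := by nlinarith
  intro x
  refine (hle x).trans ?_
  have : η ≤ (2 * J + 4 * (a / T) * c) / c := by rwa [le_div_iff₀ hc]
  refine this.trans ?_
  have e : (2 * J + 4 * (a / T) * c) / c = 2 / c * J + 4 * a * (1 / T) := by field_simp
  rw [e]
  have q1 : 0 ≤ 2 / c * (1 / T) := by positivity
  have q2 : 0 ≤ 4 * a * J := by positivity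
  nlinarith

lemma gaussianReal_Iio_le (x y : ℝ) (h : x ≤ y) :
    (gaussianReal 0 1).real (Iio y) ≤ (gaussianReal 0 1).real (Iio x) + (y - x) := by
  have : Iio y ⊆ Iio x ∪ Ico x y := fun u hu => by
    rcases lt_or_ge u x with h | h
    · exact Or.inl h
    · exact Or.inr ⟨h, hu⟩
  refine (measureReal_mono this).trans ((measureReal_union_le _ _).trans ?_)
  gcongr
  rw [Measure.real, gaussianReal_apply_eq_integral 0 one_ne_zero,
    ENNReal.toReal_ofReal (integral_nonneg fun _ => gaussianPDFReal_nonneg _ _ _)]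
  have hb : ∀ u, gaussianPDFReal 0 1 u ≤ 1 := fun u => by
    rw [gaussianPDFReal_def]
    have h1 : (1 : ℝ) ≤ Real.sqrt (2 * Real.pi * ((1 : NNReal) : ℝ)) := by
      rw [Real.one_le_sqrt]; simp; linarith [Real.pi_gt_three]
    have h2 : Real.exp (-(u - 0) ^ 2 / (2 * ((1 : NNReal) : ℝ))) ≤ 1 := by
      rw [Real.exp_le_one_iff]
      simp only [NNReal.coe_one]; nlinarith [sq_nonneg (u - 0)]
    exact mul_le_one₀ (inv_le_one_of_one_le₀ h1) (Real.exp_pos _).le h2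
  have := setIntegral_mono (s := Ico x y) (μ := volume)
    (integrable_gaussianPDFReal 0 1).integrableOn (integrableOn_const (by simp)) hb
  refine this.trans ?_
  simp [h]

end Smoothing
end WeakDependence

namespace WeakDependence

/-! ### From an approximate differential equation to normal approximation. -/

section CharacteristicFunction

/-- A characteristic function that almost solves `f' = -t f` is close to `exp(-t²/2)`. -/
lemma norm_sub_exp_le_of_deriv {f f' : ℝ → ℂ} {a e0 e1 e2 T : ℝ} (ha : 0 < a) (he0 : 0 ≤ e0)
    (he1 : 0 ≤ e1) (he2 : 0 ≤ e2) (haT : 4 * a * T ≤ 1) (hf : ∀ t, HasDerivAt f (f' t) t)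
    (hf0 : f 0 = 1) (hode : ∀ t ∈ Icc 0 T,
      ‖f' t + t * f t‖ ≤ a * t ^ 2 * ‖f t‖ + e0 + e1 * t + e2 * t ^ 2) :
    ∀ t ∈ Icc 0 T, ‖f t - (Real.exp (-(t ^ 2 / 2)) : ℝ)‖
      ≤ t * (4 * ((e0 + a) / (1 + t ^ 2) + e1 * (t / (1 + t ^ 2)) + e2)) := by
  -- The barrier vanishes linearly at 0, so that `b t / t` stays bounded there. Its part with `e0 +
  -- a` decays like `1 / t`, which makes `b t / t` integrable at infinity and keeps `a` free of any
  -- factor growing with `T`.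
  set b : ℝ → ℝ := fun t => 4 * ((e0 + a) * (t / (1 + t ^ 2)) + e1 * (t ^ 2 / (1 + t ^ 2)) + e2 * t)
    with hb
  have hpos : ∀ t : ℝ, 0 < 1 + t ^ 2 := fun t => by positivity
  set b' : ℝ → ℝ := fun t => 4 * ((e0 + a) * ((1 - t ^ 2) / (1 + t ^ 2) ^ 2)
    + e1 * (2 * t / (1 + t ^ 2) ^ 2) + e2) with hb'
  have hq : ∀ t : ℝ, HasDerivAt (fun t : ℝ => 1 + t ^ 2) (2 * t) t := fun t => by
    simpa using (hasDerivAt_pow 2 t).const_add 1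
  have hbd : ∀ t, HasDerivAt b (b' t) t := fun t => by
    have h1 : HasDerivAt (fun t : ℝ => t / (1 + t ^ 2)) ((1 - t ^ 2) / (1 + t ^ 2) ^ 2) t := by
      refine ((hasDerivAt_id' t).div (hq t) (hpos t).ne').congr_deriv ?_
      ring
    have h2 : HasDerivAt (fun t : ℝ => t ^ 2 / (1 + t ^ 2)) (2 * t / (1 + t ^ 2) ^ 2) t := by
      have := hasDerivAt_pow 2 t
      refine (this.div (hq t) (hpos t).ne').congr_deriv ?_
      push_cast; ring
    refine ((((h1.const_mul (e0 + a)).add (h2.const_mul e1)).add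
      ((hasDerivAt_id' t).const_mul e2)).const_mul 4).congr_deriv ?_
    simp [hb']
  have hE : ∀ t : ℝ, HasDerivAt (fun t : ℝ => Real.exp (t ^ 2 / 2)) (Real.exp (t ^ 2 / 2) * t) t :=
    fun t => by
      have := ((hasDerivAt_pow 2 t).div_const 2).exp
      refine this.congr_deriv ?_
      push_cast; ring
  have hh : ∀ t, HasDerivAt (fun t => (Real.exp (t ^ 2 / 2) : ℂ) * f t - 1)
      ((Real.exp (t ^ 2 / 2) : ℂ) * (f' t + t * f t)) t := fun t => by
    refine (((hE t).ofReal_comp.mul (hf t)).sub_const 1).congr_deriv ?_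
    push_cast; ring
  have hH : ∀ t, HasDerivAt (fun t => Real.exp (t ^ 2 / 2) * b t)
      (Real.exp (t ^ 2 / 2) * (b' t + t * b t)) t := fun t => by
    refine ((hE t).mul (hbd t)).congr_deriv ?_
    ring
  have key : ∀ t ∈ Icc 0 T, ‖(Real.exp (t ^ 2 / 2) : ℂ) * f t - 1‖ ≤ Real.exp (t ^ 2 / 2) * b t := by
    -- The derivatives need to be compared only at points where the norm equals the barrier. This
    -- equality is what bounds `‖f t‖` in the error term.
    refine image_norm_le_of_norm_deriv_right_lt_deriv_boundary
      (f := fun t => (Real.exp (t ^ 2 / 2) : ℂ) * f t - 1)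
      (B := fun t => Real.exp (t ^ 2 / 2) * b t)
      (fun t _ => (hh t).continuousAt.continuousWithinAt) (fun t _ => (hh t).hasDerivWithinAt)
      (by simp [hf0, hb]) hH ?_
    intro t ht heq
    have hex : 0 < Real.exp (t ^ 2 / 2) := Real.exp_pos _
    have hnex : ‖(Real.exp (t ^ 2 / 2) : ℂ)‖ = Real.exp (t ^ 2 / 2) := by
      rw [Complex.norm_real, Real.norm_eq_abs, abs_of_pos hex]
    rw [norm_mul, hnex]
    refine mul_lt_mul_of_pos_left ?_ hex
    have hfn : Real.exp (t ^ 2 / 2) * ‖f t‖ ≤ 1 + Real.exp (t ^ 2 / 2) * b t := by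
      have := norm_sub_norm_le ((Real.exp (t ^ 2 / 2) : ℂ) * f t) 1
      rw [norm_one, norm_mul, hnex] at this
      linarith [heq]
    have hexp : t ^ 2 ≤ Real.exp (t ^ 2 / 2) := by
      have := Real.quadratic_le_exp_of_nonneg (x := t ^ 2 / 2) (by positivity)
      nlinarith [sq_nonneg (t ^ 2 / 2 - 1)]
    -- At a contact point `‖f t‖` is at most `exp(-t²/2) + b t`, and `t² exp(-t²/2) ≤ 1`. Hence `a *
    -- t ^ 2 * ‖f t‖` costs only `a`, plus a quarter of `t * b t` by `4 * a * T ≤ 1`; three quarters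
    -- of `t * b t` remain for the barrier inequality.
    have h1 : t ^ 2 * ‖f t‖ ≤ 1 + t ^ 2 * b t := by
      have : Real.exp (t ^ 2 / 2) * (t ^ 2 * ‖f t‖) ≤ Real.exp (t ^ 2 / 2) * (1 + t ^ 2 * b t) := by
        nlinarith [sq_nonneg t]
      exact le_of_mul_le_mul_left this hex
    have ho := hode t ⟨ht.1, ht.2.le⟩
    have hb0 : 0 ≤ b t := by
      have := ht.1
      simp only [hb]; positivity
    have hat : a * t ^ 2 ≤ t / 4 := by
      have : 4 * a * t ≤ 1 := le_trans (by gcongr; exact ht.2.le) haT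
      nlinarith [ht.1]
    have h2 : a * t ^ 2 * ‖f t‖ ≤ a + t / 4 * b t := by nlinarith
    suffices a + e0 + e1 * t + e2 * t ^ 2 < b' t + 3 / 4 * t * b t by linarith
    have hx : 0 < (1 + t ^ 2) ^ 2 := by positivity
    have ht0 := ht.1
    have p0 : e0 + a < 4 * (e0 + a) * ((1 - t ^ 2) / (1 + t ^ 2) ^ 2 + 3 / 4 * t * (t / (1 + t ^ 2))) := by
      have : (1 - t ^ 2) / (1 + t ^ 2) ^ 2 + 3 / 4 * t * (t / (1 + t ^ 2))
          = (1 - t ^ 2 / 4 + 3 / 4 * t ^ 4) / (1 + t ^ 2) ^ 2 := by field_simp; ring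
      rw [this, ← mul_div_assoc, lt_div_iff₀ hx]
      have hea : 0 < e0 + a := by linarith
      have : (1 + t ^ 2) ^ 2 < 4 * (1 - t ^ 2 / 4 + 3 / 4 * t ^ 4) := by
        nlinarith [sq_nonneg (t ^ 2 - 3 / 4)]
      nlinarith
    have p1 : e1 * t ≤ 4 * e1 * (2 * t / (1 + t ^ 2) ^ 2 + 3 / 4 * t * (t ^ 2 / (1 + t ^ 2))) := by
      have : 2 * t / (1 + t ^ 2) ^ 2 + 3 / 4 * t * (t ^ 2 / (1 + t ^ 2))
          = t * (2 + 3 / 4 * t ^ 2 + 3 / 4 * t ^ 4) / (1 + t ^ 2) ^ 2 := by field_simp; ring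
      rw [this, ← mul_div_assoc, le_div_iff₀ hx]
      have : (1 + t ^ 2) ^ 2 ≤ 4 * (2 + 3 / 4 * t ^ 2 + 3 / 4 * t ^ 4) := by
        nlinarith [sq_nonneg t, sq_nonneg (t ^ 2)]
      nlinarith [mul_nonneg he1 ht0]
    have p2 : e2 * t ^ 2 ≤ 4 * e2 * (1 + 3 / 4 * t * t) := by nlinarith [mul_nonneg he2 (sq_nonneg t)]
    have : b' t + 3 / 4 * t * b t
        = 4 * (e0 + a) * ((1 - t ^ 2) / (1 + t ^ 2) ^ 2 + 3 / 4 * t * (t / (1 + t ^ 2)))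
          + 4 * e1 * (2 * t / (1 + t ^ 2) ^ 2 + 3 / 4 * t * (t ^ 2 / (1 + t ^ 2)))
          + 4 * e2 * (1 + 3 / 4 * t * t) := by
      simp only [hb, hb']; ring
    rw [this]; linarith
  intro t ht
  have hex : 0 < Real.exp (t ^ 2 / 2) := Real.exp_pos _
  have hk := key t ht
  have hfac : f t - (Real.exp (-(t ^ 2 / 2)) : ℝ)
      = (Real.exp (-(t ^ 2 / 2)) : ℝ) * ((Real.exp (t ^ 2 / 2) : ℂ) * f t - 1) := by
    rw [mul_sub, ← mul_assoc, ← Complex.ofReal_mul, ← Real.exp_add]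
    simp
  rw [hfac, norm_mul, Complex.norm_real, Real.norm_eq_abs, abs_of_pos (Real.exp_pos _)]
  calc _ ≤ Real.exp (-(t ^ 2 / 2)) * (Real.exp (t ^ 2 / 2) * b t) := by gcongr
    _ = b t := by rw [← mul_assoc, ← Real.exp_add]; simp
    _ = _ := by simp only [hb]; field_simp

lemma charFun_map_eq_osc {Ω : Type*} [MeasurableSpace Ω] {P : Measure Ω} {W : Ω → ℝ}
    (hW : Measurable W) (t : ℝ) : charFun (P.map W) t = ∫ ω, osc t (W ω) ∂P := by
  rw [charFun_apply_real, integral_map hW.aemeasurable (by fun_prop)]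
  simp [osc]

lemma hasDerivAt_integral_osc {Ω : Type*} [MeasurableSpace Ω] {P : Measure Ω}
    [IsProbabilityMeasure P] {W : Ω → ℝ} (hW : Measurable W) (hWi : Integrable W P) (t : ℝ) :
    HasDerivAt (fun t => ∫ ω, osc t (W ω) ∂P) (Complex.I * ∫ ω, (W ω : ℂ) * osc t (W ω) ∂P) t := by
  have hm : ∀ t, Measurable fun ω => osc t (W ω) := fun t => (measurable_osc t).comp hW
  have hd : ∀ (w t : ℝ), HasDerivAt (fun t => osc t w) (Complex.I * (w * osc t w)) t := by
    intro w t
    have h1 : HasDerivAt (fun t : ℝ => ((t * w : ℝ) : ℂ) * Complex.I) (w * Complex.I) t := by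
      have := ((hasDerivAt_id t).mul_const w).ofReal_comp
      simpa using this.mul_const Complex.I
    refine h1.cexp.congr_deriv ?_
    simp only [osc]; ring
  rw [← integral_const_mul]
  refine (hasDerivAt_integral_of_dominated_loc_of_deriv_le (𝕜 := ℝ) (s := univ)
    (F := fun t ω => osc t (W ω)) (F' := fun t ω => Complex.I * (W ω * osc t (W ω)))
    (bound := fun ω => |W ω|) univ_mem
    (Eventually.of_forall fun t => (hm t).aestronglyMeasurable) ?_ ?_ ?_ hWi.abs ?_).2
  · exact Integrable.of_bound (hm t).aestronglyMeasurable 1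
      (Eventually.of_forall fun ω => (norm_osc _ _).le)
  · exact ((Complex.measurable_ofReal.comp hW).mul (hm t)).const_mul _ |>.aestronglyMeasurable
  · exact Eventually.of_forall fun ω t _ => by simp [norm_osc]
  · exact Eventually.of_forall fun ω t _ => hd _ _

/-- The Berry–Esseen argument: an approximate differential equation for the characteristic
function gives a bound on the distance to the normal distribution. -/
theorem exists_normal_approximation_constant : ∃ C : ℝ, 0 < C ∧ ∀ {Ω : Type u} [MeasurableSpace Ω]
    (P : Measure Ω) [IsProbabilityMeasure P] (W : Ω → ℝ), Measurable W → Integrable W P →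
    ∀ a e0 e1 e2 T : ℝ, 0 < a → 0 ≤ e0 → 0 ≤ e1 → 0 ≤ e2 → 0 < T → 4 * a * T ≤ 1 →
    (∀ t ∈ Icc 0 T, ‖Complex.I * (∫ ω, (W ω : ℂ) * osc t (W ω) ∂P) + t * ∫ ω, osc t (W ω) ∂P‖
      ≤ a * t ^ 2 * ‖∫ ω, osc t (W ω) ∂P‖ + e0 + e1 * t + e2 * t ^ 2) →
    ∀ x, |P.real {ω | W ω < x} - cdf (gaussianReal 0 1) x|
      ≤ C * (e0 + a + e1 * Real.log (1 + T) + e2 * T + 1 / T) := by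
  obtain ⟨C, hC, hsm⟩ := exists_smoothing_constant
  refine ⟨8 * C, by positivity, ?_⟩
  intro Ω _ P _ W hW hWi a e0 e1 e2 T ha he0 he1 he2 hT haT hode x
  have : IsProbabilityMeasure (P.map W) := Measure.isProbabilityMeasure_map hW.aemeasurable
  have hid : Integrable id (P.map W) := by
    rw [integrable_map_measure (by fun_prop) hW.aemeasurable]; exact hWi
  have hgid : Integrable id (gaussianReal 0 1) :=
    memLp_one_iff_integrable.1 (memLp_id_gaussianReal' 1 (by simp))
  have hf := norm_sub_exp_le_of_deriv (f := fun t => ∫ ω, osc t (W ω) ∂P)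
    (f' := fun t => Complex.I * ∫ ω, (W ω : ℂ) * osc t (W ω) ∂P) ha he0 he1 he2 haT
    (hasDerivAt_integral_osc hW hWi) (by simp [osc]) hode
  set B : ℝ → ℝ := fun t => 4 * ((e0 + a) / (1 + t ^ 2) + e1 * (t / (1 + t ^ 2)) + e2) with hB
  have hBc : Continuous B := by
    have : ∀ t : ℝ, 1 + t ^ 2 ≠ 0 := fun t => by positivity
    simp only [hB]; fun_prop (disch := assumption)
  have := hsm (P.map W) (gaussianReal 0 1) hid hgid gaussianReal_Iio_le T hT B
    (hBc.intervalIntegrable _ _) (fun t ht => by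
      rw [charFun_map_eq_osc hW, charFun_gaussianReal]
      refine le_of_eq_of_le ?_ (hf t ⟨ht.1.le, ht.2⟩)
      congr 2
      push_cast
      congr 1
      simp) x
  have hI : ∫ t in (0 : ℝ)..T, B t ≤ 8 * (e0 + a + e1 * Real.log (1 + T) + e2 * T) := by
    -- The three parts of `B` have the primitives `arctan t`, `log (1 + t²) / 2` and `t`. They are
    -- the origin of the factors 1, `log (1 + T)` and `T` in the result.
    have hder : ∀ t ∈ uIcc 0 T, HasDerivAt (fun t => 4 * ((e0 + a) * Real.arctan t
        + e1 * (Real.log (1 + t ^ 2) / 2) + e2 * t)) (B t) t := fun t _ => by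
      have h1 := Real.hasDerivAt_arctan t
      have hq : HasDerivAt (fun t : ℝ => 1 + t ^ 2) (2 * t) t := by
        simpa using (hasDerivAt_pow 2 t).const_add 1
      have h2 := (hq.log (by positivity)).div_const 2
      refine ((((h1.const_mul (e0 + a)).add (h2.const_mul e1)).add
        ((hasDerivAt_id' t).const_mul e2)).const_mul 4).congr_deriv ?_
      simp only [hB]; field_simp
    rw [intervalIntegral.integral_eq_sub_of_hasDerivAt hder (hBc.intervalIntegrable _ _)]
    have hat : Real.arctan T ≤ 2 := (Real.arctan_lt_pi_div_two T).le.trans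
      (by linarith [Real.pi_le_four])
    have hlog : Real.log (1 + T ^ 2) / 2 ≤ Real.log (1 + T) := by
      have : Real.log (1 + T ^ 2) ≤ Real.log ((1 + T) ^ 2) :=
        Real.log_le_log (by positivity) (by nlinarith)
      rw [Real.log_pow] at this
      push_cast at this; linarith
    have hl0 : 0 ≤ Real.log (1 + T) := Real.log_nonneg (by linarith)
    simp only [Real.arctan_zero]
    simp
    have h3 : (e0 + a) * Real.arctan T ≤ (e0 + a) * 2 := by gcongr
    have h4 : e1 * (Real.log (1 + T ^ 2) / 2) ≤ e1 * Real.log (1 + T) := by gcongr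
    have h5 : 0 ≤ e1 * Real.log (1 + T) := mul_nonneg he1 hl0
    have h6 : 0 ≤ e2 * T := mul_nonneg he2 hT.le
    linarith
  have e1' : (P.map W).real (Iio x) = P.real {ω | W ω < x} := by
    rw [map_measureReal_apply hW measurableSet_Iio]; rfl
  have e2' : (gaussianReal 0 1).real (Iio x) = cdf (gaussianReal 0 1) x := by
    have := nullSingletonClass_gaussianReal (μ := 0) (v := 1) one_ne_zero
    rw [cdf_eq_real]
    exact measureReal_congr Iio_ae_eq_Iic
  rw [e1', e2'] at this
  refine this.trans ?_
  rw [mul_comm 8 C, mul_assoc]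
  gcongr
  have : 0 < 1 / T := by positivity
  linarith

end CharacteristicFunction

end WeakDependence

/-! ### Rings of indices around a site and the associated chain. -/

namespace WeakDependence

/-- The indices in `{1, …, N}` at distance at most `k * ℓ` from `j`. -/
def near (N ℓ j k : ℕ) : Finset ℕ :=
  (Finset.Icc 1 N).filter fun i => i ≤ j + k * ℓ ∧ j ≤ i + k * ℓ

/-- The indices in `{1, …, N}` at distance more than `(k - 1) * ℓ` from `j`; all of them if
`k = 0`. -/
def outer (N ℓ j : ℕ) : ℕ → Finset ℕ
  | 0 => Finset.Icc 1 N
  | k + 1 => Finset.Icc 1 N \ near N ℓ j k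

section Index

variable {N ℓ j k i : ℕ}

lemma mem_near : i ∈ near N ℓ j k ↔ (1 ≤ i ∧ i ≤ N) ∧ i ≤ j + k * ℓ ∧ j ≤ i + k * ℓ := by
  simp [near]

lemma near_mono {k' : ℕ} (h : k ≤ k') : near N ℓ j k ⊆ near N ℓ j k' := by
  intro i hi
  have := Nat.mul_le_mul_right ℓ h
  rw [mem_near] at hi ⊢
  omega

lemma outer_subset : outer N ℓ j k ⊆ Finset.Icc 1 N := by
  cases k
  · exact subset_rfl
  · exact Finset.sdiff_subset

lemma outer_succ_subset : outer N ℓ j (k + 1) ⊆ outer N ℓ j k := by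
  cases k
  · exact Finset.sdiff_subset
  · exact Finset.sdiff_subset_sdiff subset_rfl (near_mono (Nat.le_succ _))

lemma outer_anti {k' : ℕ} (h : k ≤ k') : outer N ℓ j k' ⊆ outer N ℓ j k := by
  induction h with
  | refl => exact subset_rfl
  | step _ ih => exact outer_succ_subset.trans ih

lemma outer_sdiff_subset_near : outer N ℓ j k \ outer N ℓ j (k + 1) ⊆ near N ℓ j k := by
  intro i hi
  rw [Finset.mem_sdiff] at hi
  have h1 := outer_subset hi.1
  by_contra h
  exact hi.2 (Finset.mem_sdiff.2 ⟨h1, h⟩)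

lemma outer_zero_sdiff (hj : 1 ≤ j) (hjN : j ≤ N) :
    outer N ℓ j 0 \ outer N ℓ j 1 = {j} := by
  ext i
  simp only [outer, Finset.mem_sdiff, mem_near, Finset.mem_Icc, Finset.mem_singleton]
  omega

lemma outer_one_sdiff : outer N ℓ j 1 \ outer N ℓ j 2 = near N ℓ j 1 \ near N ℓ j 0 := by
  ext i
  have := mem_near (N := N) (ℓ := ℓ) (j := j) (k := 1) (i := i)
  simp only [outer, Finset.mem_sdiff, Finset.mem_Icc]
  tauto

/-- Ring 0 is at most the site itself; every later ring has at most `ℓ` indices on each side. -/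
lemma card_outer_sdiff_le (hℓ : 1 ≤ ℓ) :
    (outer N ℓ j k \ outer N ℓ j (k + 1)).card ≤ 2 * ℓ := by
  cases k with
  | zero =>
    refine (Finset.card_le_one.2 ?_).trans (by omega : 1 ≤ 2 * ℓ)
    intro a ha b hb
    have h1 := outer_sdiff_subset_near ha
    have h2 := outer_sdiff_subset_near hb
    rw [mem_near] at h1 h2
    omega
  | succ k =>
    have : outer N ℓ j (k + 1) \ outer N ℓ j (k + 2)
        ⊆ Finset.Ioc (j + k * ℓ) (j + k * ℓ + ℓ) ∪
          Finset.Ico (j - k * ℓ - ℓ) (j - k * ℓ) := by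
      intro i hi
      have h1 := outer_sdiff_subset_near hi
      have h2 := (Finset.mem_sdiff.1 (Finset.mem_sdiff.1 hi).1).2
      rw [mem_near] at h1 h2
      rw [Finset.mem_union, Finset.mem_Ioc, Finset.mem_Ico]
      have : (k + 1) * ℓ = k * ℓ + ℓ := by ring
      omega
    refine (Finset.card_le_card this).trans ((Finset.card_union_le _ _).trans ?_)
    rw [Nat.card_Ioc, Nat.card_Ico]
    omega

end Index

/-- A sum of `n` variables with third absolute moment at most `κ³` has third absolute moment at
most `(n κ)³`. -/
lemma integral_abs_sum_cube_le {Ω : Type*} [MeasurableSpace Ω] {P : Measure Ω} {s : Finset ℕ}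
    {f : ℕ → Ω → ℝ} (hf : ∀ i ∈ s, Measurable (f i))
    (hf3 : ∀ i ∈ s, Integrable (fun ω => |f i ω| ^ 3) P) {κ : ℝ}
    (hκ : ∀ i ∈ s, ∫ ω, |f i ω| ^ 3 ∂P ≤ κ ^ 3) :
    Integrable (fun ω => |∑ i ∈ s, f i ω| ^ 3) P ∧
      ∫ ω, |∑ i ∈ s, f i ω| ^ 3 ∂P ≤ (s.card * κ) ^ 3 := by
  have hle : ∀ ω, |∑ i ∈ s, f i ω| ^ 3 ≤ (s.card : ℝ) ^ 2 * ∑ i ∈ s, |f i ω| ^ 3 := by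
    intro ω
    have h1 := Finset.abs_sum_le_sum_abs (fun i => f i ω) s
    exact (pow_le_pow_left₀ (abs_nonneg _) h1 3).trans
      (pow_sum_le_card_mul_sum_pow (fun i _ => abs_nonneg (f i ω)) 2)
  have hi : Integrable (fun ω => (s.card : ℝ) ^ 2 * ∑ i ∈ s, |f i ω| ^ 3) P :=
    (integrable_finsetSum _ hf3).const_mul _
  have hint : Integrable (fun ω => |∑ i ∈ s, f i ω| ^ 3) P := by
    refine hi.mono' ?_ (Eventually.of_forall fun ω => ?_)
    · exact ((Finset.measurable_sum s hf).norm.pow_const 3).aestronglyMeasurable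
    · rw [Real.norm_eq_abs, abs_of_nonneg (by positivity)]; exact hle ω
  refine ⟨hint, (integral_mono hint hi hle).trans ?_⟩
  rw [integral_const_mul, integral_finsetSum _ hf3]
  calc (s.card : ℝ) ^ 2 * ∑ i ∈ s, ∫ ω, |f i ω| ^ 3 ∂P
      ≤ (s.card : ℝ) ^ 2 * ∑ i ∈ s, κ ^ 3 := by gcongr with i hi; exact hκ i hi
    _ = _ := by rw [Finset.sum_const, nsmul_eq_mul]; ring

namespace Statistic

variable {Ω : Type u} [mΩ : MeasurableSpace Ω] {P : Measure Ω} {𝒳 : ℕ → Type v}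
  [∀ j, MeasurableSpace (𝒳 j)] {N : ℕ}

/-- The summand `g_j(X_j)` divided by the standard deviation of `S`. -/
noncomputable def std (D : Statistic P 𝒳 N) (j : ℕ) (ω : Ω) : ℝ := D.g j (D.X j ω) / D.sd

/-- The sum of the normalized variables over the `k`-th ring around `j`. -/
noncomputable def ringSum (D : Statistic P 𝒳 N) (ℓ j k : ℕ) (ω : Ω) : ℝ :=
  ∑ i ∈ outer N ℓ j k \ outer N ℓ j (k + 1), D.std i ω

/-- The normalized statistic without the rings of index less than `k` around `j`, its remainder
replaced by the one which leaves out the block of radius `r * ℓ`. -/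
noncomputable def tail (D : Statistic P 𝒳 N) (r ℓ j k : ℕ) (ω : Ω) : ℝ :=
  ∑ i ∈ outer N ℓ j k, D.std i ω + D.Rout (j - r * ℓ) (min N (j + r * ℓ)) ω / D.sd

variable (D : Statistic P 𝒳 N)

lemma measurable_std_sigmaGen {s : Set ℕ} {j : ℕ} (hjs : j ∈ s) (hj : 1 ≤ j) (hjN : j ≤ N) :
    Measurable[sigmaGen D.X s] (D.std j) :=
  ((D.measurable_g j hj hjN).comp (measurable_sigmaGen D.X hjs)).div_const _

lemma measurable_std {j : ℕ} (hj : 1 ≤ j) (hjN : j ≤ N) : Measurable (D.std j) :=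
  ((D.measurable_g j hj hjN).comp (D.measurable_X j hj)).div_const _

lemma sigmaGen_finset_le {s : Finset ℕ} (hs : s ⊆ Finset.Icc 1 N) :
    sigmaGen D.X (s : Set ℕ) ≤ mΩ :=
  sigmaGen_le D.X fun j hj => D.measurable_X j (Finset.mem_Icc.1 (hs hj)).1

lemma measurable_sum_std_sigmaGen {s t : Finset ℕ} (hs : s ⊆ Finset.Icc 1 N) (hst : s ⊆ t) :
    Measurable[sigmaGen D.X (t : Set ℕ)] (fun ω => ∑ i ∈ s, D.std i ω) :=
  Finset.measurable_sum _ fun i hi =>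
    D.measurable_std_sigmaGen (hst hi) (Finset.mem_Icc.1 (hs hi)).1 (Finset.mem_Icc.1 (hs hi)).2

lemma measurable_remainder : Measurable D.R :=
  D.measurable_R.mono (sigmaGen_le D.X fun j hj => D.measurable_X j hj.1) le_rfl

/-- `near N ℓ j k` lies in a window of radius `k * ℓ`, and the outer indices are at distance more
than `(k + 1) * ℓ` from `j`, so the gap is at least `ℓ`. -/
lemma strongMixing_near_outer [IsProbabilityMeasure P] {ℓ j k : ℕ} {η : ℝ} (hj : 1 ≤ j)
    (hη : 3 * phiMixing P D.X ℓ ≤ η ^ 3) :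
    StrongMixing P (sigmaGen D.X (near N ℓ j k : Set ℕ))
      (sigmaGen D.X (outer N ℓ j (k + 2) : Set ℕ)) (η ^ 3) := by
  intro M F hM hF
  rw [inter_comm, mul_comm (P.real M)]
  refine (abs_measure_inter_sub_le_of_window D.measurable_X (p := max 1 (j - k * ℓ))
    (q := j + k * ℓ) (le_max_left _ _) (by omega) ?_ ?_ hF hM).trans hη
  · intro i hi
    have := mem_near.1 (Finset.mem_coe.1 hi)
    rw [mem_Icc]; omega
  · intro i hi
    have h1 := Finset.mem_sdiff.1 (Finset.mem_coe.1 hi)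
    have h2 := h1.2
    have h3 := Finset.mem_Icc.1 h1.1
    rw [mem_near] at h2
    have : (k + 1) * ℓ = k * ℓ + ℓ := by ring
    omega

/-- A single remainder serves the whole chain: it leaves out the full block of radius `r * ℓ`, so it
is measurable with respect to the outermost algebra, and a fortiori to all the others. The condition
on `j` keeps the block inside the admissible indices. -/
lemma ringChain [IsProbabilityMeasure P] {r ℓ j : ℕ} {η : ℝ} (hj : r * ℓ + 1 < j) (hjN : j ≤ N)
    (hη : 3 * phiMixing P D.X ℓ ≤ η ^ 3) :
    RingChain P r η (fun k => sigmaGen D.X (near N ℓ j k : Set ℕ))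
      (fun k => sigmaGen D.X (outer N ℓ j k : Set ℕ)) (D.ringSum ℓ j) (D.tail r ℓ j) where
  I_le k _ := D.sigmaGen_finset_le (Finset.filter_subset _ _)
  O_le k _ := D.sigmaGen_finset_le outer_subset
  I_mono _ _ hik _ := sigmaGen_mono D.X (Finset.coe_subset.2 (near_mono hik))
  measurable_I k _ := D.measurable_sum_std_sigmaGen (Finset.sdiff_subset.trans outer_subset)
    outer_sdiff_subset_near
  measurable_O k _ := D.measurable_sum_std_sigmaGen (Finset.sdiff_subset.trans outer_subset)
    Finset.sdiff_subset
  measurable_V k hk := by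
    refine (D.measurable_sum_std_sigmaGen outer_subset subset_rfl).add (Measurable.div_const ?_ _)
    refine (D.measurable_Rout (j - r * ℓ) (min N (j + r * ℓ)) (by omega) (by omega) (by omega)
      (by omega)).mono (sigmaGen_mono D.X ?_) le_rfl
    intro i hi
    refine Finset.mem_coe.2 (outer_anti hk (Finset.mem_sdiff.2 ⟨Finset.mem_Icc.2 hi.1, ?_⟩))
    have h1 := hi.1
    have h2 := hi.2
    rw [mem_Icc] at h1 h2
    rw [mem_near]
    omega
  step k _ ω := by
    unfold tail ringSum
    rw [← add_assoc, Finset.sum_sdiff outer_succ_subset]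
  mixing k _ := D.strongMixing_near_outer (by omega) hη

end Statistic

end WeakDependence

namespace WeakDependence

/-! ### Moment estimates, and replacement of one statistic by another inside the oscillation. -/

section Holder

variable {Ω : Type*} [MeasurableSpace Ω] {P : Measure Ω} [IsProbabilityMeasure P]

lemma eLpNorm_three_le {f : Ω → ℝ} (hf : Measurable f) (hf3 : Integrable (fun ω => |f ω| ^ 3) P)
    {κ : ℝ} (hκ : 0 ≤ κ) (hfκ : ∫ ω, |f ω| ^ 3 ∂P ≤ κ ^ 3) :
    eLpNorm f 3 P ≤ ENNReal.ofReal κ := by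
  have h3 : ∀ ω, ‖f ω‖ ^ (3 : ℝ≥0∞).toReal = |f ω| ^ 3 := fun ω => by
    rw [Real.norm_eq_abs, ENNReal.toReal_ofNat]; exact Real.rpow_natCast _ 3
  have hm : MemLp f 3 P := by
    rw [← integrable_norm_rpow_iff hf.aestronglyMeasurable (by norm_num) (by norm_num)]
    simpa only [h3] using hf3
  rw [hm.eLpNorm_eq_integral_rpow_norm (by norm_num) (by norm_num)]
  simp only [h3]
  refine ENNReal.ofReal_le_ofReal ?_
  calc (∫ ω, |f ω| ^ 3 ∂P) ^ ((3 : ℝ≥0∞).toReal)⁻¹ ≤ (κ ^ 3) ^ ((3 : ℝ≥0∞).toReal)⁻¹ := by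
        refine Real.rpow_le_rpow (integral_nonneg fun ω => by positivity) hfκ (by positivity)
    _ = κ := by
        rw [ENNReal.toReal_ofNat]
        exact Real.pow_rpow_inv_natCast hκ (n := 3) (by norm_num)

lemma integrable_of_eLpNorm_one_le {g : Ω → ℝ} (hg : AEStronglyMeasurable g P) {d : ℝ}
    (hd : 0 ≤ d) (h : eLpNorm g 1 P ≤ ENNReal.ofReal d) :
    Integrable g P ∧ ∫ ω, |g ω| ∂P ≤ d := by
  refine ⟨memLp_one_iff_integrable.1 ⟨hg, h.trans_lt ENNReal.ofReal_lt_top⟩, ?_⟩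
  rw [eLpNorm_one_eq_lintegral_enorm] at h
  simp only [← Real.norm_eq_abs]
  rw [integral_norm_eq_lintegral_enorm hg]
  exact ENNReal.toReal_le_of_le_ofReal hd h

/-- The exponents 3 and 3/2 are conjugate; this is why `γ` is measured in `L^{3/2}` when the
summands have third moments. -/
lemma integral_abs_mul_le_of_eLpNorm {f g : Ω → ℝ} (hf : Measurable f) (hg : Measurable g)
    (hf3 : Integrable (fun ω => |f ω| ^ 3) P) {κ d : ℝ} (hκ : 0 ≤ κ) (hd : 0 ≤ d)
    (hfκ : ∫ ω, |f ω| ^ 3 ∂P ≤ κ ^ 3) (hgd : eLpNorm g (3 / 2) P ≤ ENNReal.ofReal d) :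
    Integrable (fun ω => f ω * g ω) P ∧ ∫ ω, |f ω * g ω| ∂P ≤ κ * d := by
  have : ENNReal.HolderTriple 3 (3 / 2) 1 := ⟨by
    rw [ENNReal.inv_div (by simp) (by simp), inv_one, ENNReal.div_eq_inv_mul, ← mul_one_add]
    norm_num
    exact ENNReal.inv_mul_cancel (by simp) (by simp)⟩
  refine integrable_of_eLpNorm_one_le (hf.mul hg).aestronglyMeasurable (by positivity) ?_
  refine (eLpNorm_le_eLpNorm_mul_eLpNorm'_of_norm (p := 3) (q := 3 / 2) hf.aestronglyMeasurable
    hg.aestronglyMeasurable (fun x y => x * y) 1 (Eventually.of_forall fun ω => ?_)).trans ?_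
  · simp
  · rw [ENNReal.coe_one, one_mul, ENNReal.ofReal_mul hκ]
    exact mul_le_mul' (eLpNorm_three_le hf hf3 hκ hfκ) hgd

lemma integral_abs_le_of_eLpNorm {g : Ω → ℝ} (hg : Measurable g) {d : ℝ} (hd : 0 ≤ d)
    (hgd : eLpNorm g (3 / 2) P ≤ ENNReal.ofReal d) :
    Integrable g P ∧ ∫ ω, |g ω| ∂P ≤ d := by
  refine integrable_of_eLpNorm_one_le hg.aestronglyMeasurable hd
    ((eLpNorm_le_eLpNorm_of_exponent_le ?_ hg.aestronglyMeasurable).trans hgd)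
  rw [ENNReal.le_div_iff_mul_le (by simp) (by simp)]
  norm_num

lemma integral_abs_mul_le_of_cube {f g : Ω → ℝ} (hf : Measurable f) (hg : Measurable g)
    (hf3 : Integrable (fun ω => |f ω| ^ 3) P) (hg3 : Integrable (fun ω => |g ω| ^ 3) P)
    {a b : ℝ} (ha : 0 < a) (hb : 0 < b) (hfa : ∫ ω, |f ω| ^ 3 ∂P ≤ a ^ 3)
    (hgb : ∫ ω, |g ω| ^ 3 ∂P ≤ b ^ 3) :
    Integrable (fun ω => f ω * g ω) P ∧ |∫ ω, f ω * g ω ∂P| ≤ a * b := by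
  have h := integral_mul_mul_le_of_cube hf hg (measurable_const (a := (1 : ℝ))) hf3 hg3 (by simp)
    ha hb one_pos hfa hgb (by simp)
  simp only [abs_one, mul_one, ← abs_mul] at h
  exact ⟨(integrable_norm_iff (hf.mul hg).aestronglyMeasurable).1 h.1,
    (abs_integral_le_integral_abs).trans h.2⟩

lemma norm_osc_sub_osc_le (t x y : ℝ) : ‖osc t x - osc t y‖ ≤ |t| * |x - y| := by
  have h : osc t x - osc t y = osc t y * (osc t (x - y) - 1) := by
    rw [mul_sub, ← osc_add]; simp
  rw [h, norm_mul, norm_osc, one_mul]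
  exact norm_osc_sub_one_le _ _

lemma integrable_mul_osc {f V : Ω → ℝ} (hf : Integrable f P) (hV : Measurable V) (t : ℝ) :
    Integrable (fun ω => (f ω : ℂ) * osc t (V ω)) P := by
  have hf' : Integrable (fun ω => (f ω : ℂ)) P := hf.ofReal
  exact hf'.mul_bdd (c := 1) ((measurable_osc t).comp hV).aestronglyMeasurable
    (Eventually.of_forall fun ω => (norm_osc _ _).le)

lemma norm_integral_mul_osc_le {f V : Ω → ℝ} (t : ℝ) :
    ‖∫ ω, (f ω : ℂ) * osc t (V ω) ∂P‖ ≤ ∫ ω, |f ω| ∂P :=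
  (norm_integral_le_integral_norm _).trans_eq (by simp [norm_osc])

lemma norm_integral_mul_osc_sub_le {f V W : Ω → ℝ} (hf : Integrable f P) (hV : Measurable V)
    (hW : Measurable W) (hi : Integrable (fun ω => f ω * (W ω - V ω)) P) (t : ℝ) :
    ‖∫ ω, (f ω : ℂ) * osc t (W ω) ∂P - ∫ ω, (f ω : ℂ) * osc t (V ω) ∂P‖
      ≤ |t| * ∫ ω, |f ω * (W ω - V ω)| ∂P := by
  rw [← integral_sub (integrable_mul_osc hf hW t) (integrable_mul_osc hf hV t),
    ← integral_const_mul]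
  refine norm_integral_le_of_norm_le (hi.abs.const_mul _) (Eventually.of_forall fun ω => ?_)
  rw [← mul_sub, norm_mul, Complex.norm_real, Real.norm_eq_abs, abs_mul]
  nlinarith [norm_osc_sub_osc_le t (W ω) (V ω), abs_nonneg (f ω)]

lemma norm_integral_osc_sub_le {V W : Ω → ℝ} (hV : Measurable V)
    (hW : Measurable W) (hi : Integrable (fun ω => W ω - V ω) P) (t : ℝ) :
    ‖∫ ω, osc t (W ω) ∂P - ∫ ω, osc t (V ω) ∂P‖ ≤ |t| * ∫ ω, |W ω - V ω| ∂P := by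
  have := norm_integral_mul_osc_sub_le (f := fun _ => (1 : ℝ)) (P := P) (integrable_const 1) hV hW
    (by simpa using hi) t
  simpa using this

end Holder

end WeakDependence

/-! ### Local variances and their sum. -/

namespace WeakDependence

namespace Statistic

variable {Ω : Type u} [mΩ : MeasurableSpace Ω] {P : Measure Ω} [IsProbabilityMeasure P]
  {𝒳 : ℕ → Type v} [∀ j, MeasurableSpace (𝒳 j)] {N : ℕ} (D : Statistic P 𝒳 N)

/-- The local contribution of the site `j` to the normalized variance. -/
noncomputable def localVar (ℓ j : ℕ) : ℝ := ∑ i ∈ near N ℓ j 1, ∫ ω, D.std j ω * D.std i ω ∂P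

/-- The normalized summands have third absolute moments at most `κ³`. -/
def CubeBound (κ : ℝ) : Prop := ∀ j, 1 ≤ j → j ≤ N →
  Integrable (fun ω => |D.std j ω| ^ 3) P ∧ ∫ ω, |D.std j ω| ^ 3 ∂P ≤ κ ^ 3

lemma integral_std {j : ℕ} (hj : 1 ≤ j) (hjN : j ≤ N) : ∫ ω, D.std j ω ∂P = 0 := by
  unfold std
  rw [integral_div, D.centered_g j hj hjN, zero_div]

lemma integrable_std {j : ℕ} (hj : 1 ≤ j) (hjN : j ≤ N) : Integrable (D.std j) P :=
  (D.integrable_g j hj hjN).div_const _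

variable {D} {κ : ℝ} {ℓ r j : ℕ} {η t d : ℝ}

lemma CubeBound.integrable_mul (h : D.CubeBound κ) (hκ : 0 < κ) {i : ℕ} (hj : 1 ≤ j) (hjN : j ≤ N)
    (hi : 1 ≤ i) (hiN : i ≤ N) : Integrable (fun ω => D.std j ω * D.std i ω) P :=
  (integral_abs_mul_le_of_cube (D.measurable_std hj hjN) (D.measurable_std hi hiN) (h j hj hjN).1
    (h i hi hiN).1 hκ hκ (h j hj hjN).2 (h i hi hiN).2).1

lemma CubeBound.sum (h : D.CubeBound κ) {s : Finset ℕ} (hs : s ⊆ Finset.Icc 1 N) :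
    Integrable (fun ω => |∑ i ∈ s, D.std i ω| ^ 3) P ∧
      ∫ ω, |∑ i ∈ s, D.std i ω| ^ 3 ∂P ≤ (s.card * κ) ^ 3 :=
  integral_abs_sum_cube_le
    (fun _ hi => D.measurable_std (Finset.mem_Icc.1 (hs hi)).1 (Finset.mem_Icc.1 (hs hi)).2)
    (fun i hi => (h i (Finset.mem_Icc.1 (hs hi)).1 (Finset.mem_Icc.1 (hs hi)).2).1)
    (fun i hi => (h i (Finset.mem_Icc.1 (hs hi)).1 (Finset.mem_Icc.1 (hs hi)).2).2)

lemma measurable_sum_std {s : Finset ℕ} (hs : s ⊆ Finset.Icc 1 N) :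
    Measurable (fun ω => ∑ i ∈ s, D.std i ω) :=
  (D.measurable_sum_std_sigmaGen hs subset_rfl).mono (D.sigmaGen_finset_le hs) le_rfl

lemma ringSum_subset {k : ℕ} : outer N ℓ j k \ outer N ℓ j (k + 1) ⊆ Finset.Icc 1 N :=
  Finset.sdiff_subset.trans outer_subset

lemma CubeBound.ringSum (h : D.CubeBound κ) (hκ : 0 ≤ κ) (hℓ : 1 ≤ ℓ) (k : ℕ) :
    Integrable (fun ω => |D.ringSum ℓ j k ω| ^ 3) P ∧
      ∫ ω, |D.ringSum ℓ j k ω| ^ 3 ∂P ≤ (2 * ℓ * κ) ^ 3 := by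
  refine ⟨(h.sum ringSum_subset).1, (h.sum ringSum_subset).2.trans ?_⟩
  have : ((outer N ℓ j k \ outer N ℓ j (k + 1)).card : ℝ) ≤ 2 * ℓ := by
    exact_mod_cast card_outer_sdiff_le hℓ
  gcongr

lemma ringSum_zero (hj : 1 ≤ j) (hjN : j ≤ N) : D.ringSum ℓ j 0 = D.std j := by
  funext ω
  rw [Statistic.ringSum, outer_zero_sdiff hj hjN, Finset.sum_singleton]

/-- The neighbourhood of radius `ℓ` consists of ring 0 and ring 1, so `localVar` is the coefficient
produced by the first-order expansion. -/
lemma localVar_eq (h : D.CubeBound κ) (hκ : 0 < κ) (hj : 1 ≤ j) (hjN : j ≤ N) :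
    D.localVar ℓ j = ∫ ω, D.ringSum ℓ j 0 ω * D.ringSum ℓ j 0 ω ∂P
      + ∫ ω, D.ringSum ℓ j 0 ω * D.ringSum ℓ j 1 ω ∂P := by
  have h0 : near N ℓ j 0 = {j} := by
    ext i; rw [mem_near, Finset.mem_singleton]; omega
  have h1 : ∀ i ∈ near N ℓ j 1 \ near N ℓ j 0, 1 ≤ i ∧ i ≤ N := fun i hi =>
    (mem_near.1 (Finset.mem_sdiff.1 hi).1).1
  rw [ringSum_zero hj hjN]
  unfold localVar Statistic.ringSum
  rw [outer_one_sdiff, ← Finset.sum_sdiff (near_mono (Nat.zero_le 1)), add_comm]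
  congr 1
  · rw [h0, Finset.sum_singleton]
  · simp_rw [Finset.mul_sum]
    rw [integral_finsetSum _ fun i hi => h.integrable_mul hκ hj hjN (h1 i hi).1 (h1 i hi).2]

lemma abs_localVar_le (h : D.CubeBound κ) (hκ : 0 < κ) (hℓ : 1 ≤ ℓ) (hj : 1 ≤ j) (hjN : j ≤ N) :
    |D.localVar ℓ j| ≤ 4 * ℓ * κ ^ 2 := by
  rw [localVar_eq h hκ hj hjN, ringSum_zero hj hjN]
  have hℓ' : (1 : ℝ) ≤ ℓ := by exact_mod_cast hℓ
  have hm := D.measurable_std hj hjN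
  have a0 := (integral_abs_mul_le_of_cube hm hm (h j hj hjN).1 (h j hj hjN).1 hκ hκ
    (h j hj hjN).2 (h j hj hjN).2).2
  have a1 := (integral_abs_mul_le_of_cube hm (measurable_sum_std ringSum_subset) (h j hj hjN).1
    (h.ringSum hκ.le hℓ 1).1 hκ (by positivity) (h j hj hjN).2 (h.ringSum hκ.le hℓ 1 (j := j)).2).2
  change |∫ ω, D.std j ω * D.ringSum ℓ j 1 ω ∂P| ≤ _ at a1
  refine (abs_add_le _ _).trans ((add_le_add a0 a1).trans ?_)
  nlinarith [sq_nonneg κ]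

lemma abs_integral_mul_le_of_notMem_near (h : D.CubeBound κ) (hκ1 : κ ≤ 1) (hκ : 0 < κ)
    (hη0 : 0 < η) (hη1 : η ≤ 1) (hη : 3 * phiMixing P D.X ℓ ≤ η ^ 3) {i : ℕ} (hj : 1 ≤ j)
    (hjN : j ≤ N) (hi : i ∈ Finset.Icc 1 N \ near N ℓ j 1) :
    |∫ ω, D.std j ω * D.std i ω ∂P| ≤ 22 * 8 ^ 2 * η := by
  have hiN := Finset.mem_Icc.1 (Finset.mem_sdiff.1 hi).1
  have hjn : j ∈ near N ℓ j 0 := by rw [mem_near]; omega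
  have hκ3 : κ ^ 3 ≤ 8 := (pow_le_one₀ hκ.le hκ1).trans (by norm_num)
  have := (D.strongMixing_near_outer (N := N) (k := 0) hj hη).norm_cov_le hη0 hη1
    (D.sigmaGen_finset_le (Finset.filter_subset _ _)) (D.sigmaGen_finset_le outer_subset)
    (Y := fun ω => (D.std j ω : ℂ)) (F := fun ω => (D.std i ω : ℂ))
    (Complex.measurable_ofReal.comp (D.measurable_std_sigmaGen (Finset.mem_coe.2 hjn) hj hjN))
    (Complex.measurable_ofReal.comp (D.measurable_std_sigmaGen (Finset.mem_coe.2 hi) hiN.1 hiN.2))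
    (A := 8) (by norm_num) (by simpa using (h j hj hjN).1) (by simpa using (h i hiN.1 hiN.2).1)
    (by simpa using (h j hj hjN).2.trans hκ3) (by simpa using (h i hiN.1 hiN.2).2.trans hκ3)
  rw [integral_complex_ofReal, D.integral_std hj hjN, Complex.ofReal_zero, zero_mul, sub_zero] at this
  simp_rw [← Complex.ofReal_mul] at this
  rwa [integral_complex_ofReal, Complex.norm_real] at this

lemma sum_std (ω : Ω) : ∑ j ∈ Finset.Icc 1 N, D.std j ω = D.S ω / D.sd := by
  unfold std S; rw [Finset.sum_div]

lemma integral_S : ∫ ω, D.S ω ∂P = 0 := by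
  unfold S
  rw [integral_finsetSum _ fun i hi => D.integrable_g i (Finset.mem_Icc.1 hi).1
    (Finset.mem_Icc.1 hi).2]
  exact Finset.sum_eq_zero fun i hi => D.centered_g i (Finset.mem_Icc.1 hi).1
    (Finset.mem_Icc.1 hi).2

lemma measurable_S : Measurable D.S :=
  Finset.measurable_sum _ fun i hi => (D.measurable_g i (Finset.mem_Icc.1 hi).1
    (Finset.mem_Icc.1 hi).2).comp (D.measurable_X i (Finset.mem_Icc.1 hi).1)

lemma integral_sum_std_sq (hsd : 0 < D.sd) :
    ∫ ω, (∑ j ∈ Finset.Icc 1 N, D.std j ω) ^ 2 ∂P = 1 := by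
  simp_rw [sum_std, div_pow]
  rw [integral_div, ← variance_of_integral_eq_zero measurable_S.aemeasurable integral_S]
  have : Var[D.S; P] = D.sd ^ 2 := (Real.sq_sqrt (variance_nonneg _ _)).symm
  rw [this, div_self (by positivity)]

lemma sum_sum_cov (h : D.CubeBound κ) (hκ : 0 < κ) (hsd : 0 < D.sd) :
    ∑ j ∈ Finset.Icc 1 N, ∑ i ∈ Finset.Icc 1 N, ∫ ω, D.std j ω * D.std i ω ∂P = 1 := by
  rw [← integral_sum_std_sq hsd]
  simp_rw [sq, Finset.sum_mul_sum]
  have hi : ∀ j ∈ Finset.Icc 1 N, ∀ i ∈ Finset.Icc 1 N,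
      Integrable (fun ω => D.std j ω * D.std i ω) P := fun j hj i hi =>
    h.integrable_mul hκ (Finset.mem_Icc.1 hj).1 (Finset.mem_Icc.1 hj).2 (Finset.mem_Icc.1 hi).1
      (Finset.mem_Icc.1 hi).2
  rw [integral_finsetSum _ fun j hj => integrable_finsetSum _ (hi j hj)]
  exact Finset.sum_congr rfl fun j hj => (integral_finsetSum _ (hi j hj)).symm

/-- All covariances together add up to the variance of `S / σ_N`, which is 1. The sum of the local
variances omits only pairs more than `ℓ` apart, at most `N ^ 2` of them, each negligible by mixing.
-/
lemma abs_one_sub_sum_localVar_le (h : D.CubeBound κ) (hκ1 : κ ≤ 1) (hκ : 0 < κ)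
    (hη0 : 0 < η) (hη1 : η ≤ 1) (hη : 3 * phiMixing P D.X ℓ ≤ η ^ 3) (hsd : 0 < D.sd) :
    |1 - ∑ j ∈ Finset.Icc 1 N, D.localVar ℓ j| ≤ N ^ 2 * (22 * 8 ^ 2 * η) := by
  have hn : ∀ j, near N ℓ j 1 ⊆ Finset.Icc 1 N := fun j => Finset.filter_subset _ _
  rw [← sum_sum_cov h hκ hsd, ← Finset.sum_sub_distrib]
  have hs : ∀ j ∈ Finset.Icc 1 N, |∑ i ∈ Finset.Icc 1 N, ∫ ω, D.std j ω * D.std i ω ∂P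
      - D.localVar ℓ j| ≤ N * (22 * 8 ^ 2 * η) := by
    intro j hj
    unfold localVar
    rw [← Finset.sum_sdiff (hn j), add_sub_cancel_right]
    refine (Finset.abs_sum_le_sum_abs _ _).trans ?_
    refine (Finset.sum_le_sum fun i hi => abs_integral_mul_le_of_notMem_near h hκ1 hκ hη0 hη1 hη
      (Finset.mem_Icc.1 hj).1 (Finset.mem_Icc.1 hj).2 hi).trans ?_
    rw [Finset.sum_const, nsmul_eq_mul]
    have : ((Finset.Icc 1 N \ near N ℓ j 1).card : ℝ) ≤ N := by
      exact_mod_cast (Finset.card_le_card Finset.sdiff_subset).trans (by simp)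
    gcongr
  refine (Finset.abs_sum_le_sum_abs _ _).trans ((Finset.sum_le_sum hs).trans ?_)
  rw [Finset.sum_const, nsmul_eq_mul, Nat.card_Icc, Nat.add_sub_cancel]
  exact le_of_eq (by ring)

end Statistic

end WeakDependence

/-! ### The approximate differential equation for the normalized statistic. -/

namespace WeakDependence

namespace Statistic

variable {Ω : Type u} [mΩ : MeasurableSpace Ω] {P : Measure Ω} [IsProbabilityMeasure P]
  {𝒳 : ℕ → Type v} [∀ j, MeasurableSpace (𝒳 j)] {N : ℕ} {D : Statistic P 𝒳 N} {κ : ℝ} {ℓ r j : ℕ}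
  {η t d : ℝ}

/-- The statistic normalized by the standard deviation of its linear part. -/
noncomputable def normalized (D : Statistic P 𝒳 N) (ω : Ω) : ℝ := D.T ω / D.sd

/-- The normalized change of the remainder when the block of radius `r * ℓ` around `j` is left
out. -/
noncomputable def blockChange (D : Statistic P 𝒳 N) (r ℓ j : ℕ) (ω : Ω) : ℝ :=
  (D.R ω - D.Rout (j - r * ℓ) (min N (j + r * ℓ)) ω) / D.sd

lemma normalized_eq (ω : Ω) :
    D.normalized ω = ∑ j ∈ Finset.Icc 1 N, D.std j ω + D.R ω / D.sd := by
  unfold normalized T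
  rw [sum_std, add_div]

lemma measurable_normalized : Measurable D.normalized :=
  (measurable_S.add D.measurable_remainder).div_const _

lemma integrable_normalized (hR : Integrable D.R P) : Integrable D.normalized P := by
  have hS : Integrable D.S P := integrable_finsetSum _ fun i hi =>
    D.integrable_g i (Finset.mem_Icc.1 hi).1 (Finset.mem_Icc.1 hi).2
  exact (hS.add hR).div_const _

lemma normalized_sub_tail (ω : Ω) :
    D.normalized ω - D.tail r ℓ j 0 ω = D.blockChange r ℓ j ω := by
  rw [normalized_eq, tail, blockChange, outer]
  ring

lemma measurable_tail_zero (hj : r * ℓ + 1 < j) (hjN : j ≤ N) : Measurable (D.tail r ℓ j 0) := by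
  refine (measurable_sum_std subset_rfl).add (Measurable.div_const ?_ _)
  exact (D.measurable_Rout (j - r * ℓ) (min N (j + r * ℓ)) (by omega) (by omega) (by omega)
      (by omega)).mono (sigmaGen_le D.X fun i hi => D.measurable_X i hi.1.1) le_rfl

lemma measurable_blockChange (hj : r * ℓ + 1 < j) (hjN : j ≤ N) :
    Measurable (D.blockChange r ℓ j) := by
  simp_rw [← funext (normalized_sub_tail (D := D) (r := r) (ℓ := ℓ) (j := j))]
  exact measurable_normalized.sub (measurable_tail_zero hj hjN)

lemma integral_abs_std_le (h : D.CubeBound κ) (hκ : 0 < κ) (hj : 1 ≤ j) (hjN : j ≤ N) :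
    ∫ ω, |D.std j ω| ∂P ≤ κ :=
  (RingChain.integral_norm_osc_sub_one_le (t := 0) (D.measurable_std hj hjN) (h j hj hjN).1 hκ
    (h j hj hjN).2).2.1

/-- The local expansion at a site away from the left end of the sample. -/
lemma norm_integral_std_mul_osc_sub_le (h : D.CubeBound κ) (hκ : 0 < κ) (hκ1 : κ ≤ 1)
    (hη0 : 0 < η) (hη1 : η ≤ 1) (hη : 3 * phiMixing P D.X ℓ ≤ η ^ 3) (hℓ : 1 ≤ ℓ) (hr : 3 ≤ r)
    (hj : r * ℓ + 1 < j) (hjN : j ≤ N) (ht : 0 ≤ t) (htβ : 512 * (t * (2 * ℓ * κ)) ≤ 1)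
    (hd0 : 0 ≤ d) (hd : eLpNorm (D.blockChange r ℓ j) (3 / 2) P ≤ ENNReal.ofReal d) {e : ℝ}
    (he : 22 * (8 ^ r * 8) ^ 2 * η ≤ e) :
    ‖∫ ω, (D.std j ω : ℂ) * osc t (D.normalized ω) ∂P
        - Complex.I * (t * D.localVar ℓ j : ℝ) * ∫ ω, osc t (D.normalized ω) ∂P‖
      ≤ 16000 * ℓ ^ 2 * κ ^ 3 * t ^ 2
          * (‖∫ ω, osc t (D.normalized ω) ∂P‖ + (3 * (1 / 2) ^ r + 27 * (r + 1) * e))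
        + 3 * κ * d * t + 18 * (r + 1) * e := by
  have hj1 : 1 ≤ j := by omega
  have hℓ' : (1 : ℝ) ≤ ℓ := by exact_mod_cast hℓ
  have habs : |t| = t := abs_of_nonneg ht
  have he0 : 0 ≤ e := le_trans (by positivity) he
  have hmt := measurable_tail_zero (D := D) hj hjN
  have hmb := measurable_blockChange (D := D) hj hjN
  have hms := D.measurable_std hj1 hjN
  -- A ring has at most `2 * ℓ` sites, whence `β = 2 * ℓ * κ`, while ring 0 is one site and keeps
  -- `κ`. So `4000 * κ * β ^ 2` becomes `16000 * ℓ ^ 2 * κ ^ 3`.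
  have hmain := (D.ringChain hj hjN hη).norm_integral_mul_osc_sub_variance_le (t := t) (A := 8)
    (β := 2 * ℓ * κ) (κ := κ) (e := e) hη0 hη1 le_rfl he hr hκ (by nlinarith)
    ((pow_le_one₀ hκ.le hκ1).trans (by norm_num)) (by rwa [habs])
    (fun k _ => (h.ringSum hκ.le hℓ k).1) (fun k _ => (h.ringSum hκ.le hℓ k).2)
    (by rw [ringSum_zero hj1 hjN]; exact (h j hj1 hjN).2)
    (by rw [ringSum_zero hj1 hjN]; exact D.integral_std hj1 hjN)
  rw [← localVar_eq h hκ hj1 hjN, ringSum_zero hj1 hjN, RingChain.mean] at hmain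
  set φ := ∫ ω, osc t (D.normalized ω) ∂P
  set φ' := ∫ ω, osc t (D.tail r ℓ j 0 ω) ∂P
  have hsd := integral_abs_mul_le_of_eLpNorm hms hmb (h j hj1 hjN).1 hκ.le hd0 (h j hj1 hjN).2 hd
  have hbd := integral_abs_le_of_eLpNorm hmb hd0 hd
  have h1 := norm_integral_mul_osc_sub_le (D.integrable_std hj1 hjN) hmt
    (measurable_normalized (D := D)) (by simpa only [normalized_sub_tail] using hsd.1) t
  have h2 := norm_integral_osc_sub_le hmt (measurable_normalized (D := D))
    (by simpa only [normalized_sub_tail] using hbd.1) t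
  simp only [normalized_sub_tail, habs] at h1 h2
  replace h1 := h1.trans (mul_le_mul_of_nonneg_left hsd.2 ht)
  replace h2 := h2.trans (mul_le_mul_of_nonneg_left hbd.2 ht)
  have hc := abs_localVar_le h hκ hℓ hj1 hjN
  have h3 : ‖Complex.I * (t * D.localVar ℓ j : ℝ) * (φ' - φ)‖ ≤ t * (4 * ℓ * κ ^ 2) * (t * d) := by
    rw [norm_mul, norm_mul, Complex.norm_I, one_mul, Complex.norm_real, Real.norm_eq_abs, abs_mul,
      habs, norm_sub_rev]
    gcongr
  have h4 : ‖φ'‖ ≤ ‖φ‖ + t * d := by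
    have := norm_sub_norm_le φ' φ
    rw [norm_sub_rev] at this
    linarith
  set τ := 3 * (1 / 2 : ℝ) ^ r + 27 * (r + 1) * e with hτ
  have hτ0 : 0 ≤ τ := by positivity
  -- Returning from the tail to the full statistic costs `κ * d * t` three times: in the main
  -- integral, here, and in `h6`. In the last two the surplus factors of `t * (2 * ℓ * κ)` are
  -- absorbed by `htβ`.
  have h5 : t * (4 * ℓ * κ ^ 2) * (t * d) ≤ κ * d * t := by
    have : 0 ≤ κ * d * t := by positivity
    calc _ = 2 * (t * (2 * ℓ * κ)) * (κ * d * t) := by ring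
      _ ≤ 1 * (κ * d * t) := by gcongr; linarith
      _ = _ := one_mul _
  have h6 : 4000 * (t ^ 2 * (κ * (2 * ℓ * κ) ^ 2)) * (t * d) ≤ κ * d * t := by
    have h0 : 0 ≤ t * (2 * ℓ * κ) := by positivity
    calc _ = 4000 * (t * (2 * ℓ * κ)) ^ 2 * (κ * d * t) := by ring
      _ ≤ 1 * (κ * d * t) := by
        gcongr
        nlinarith
      _ = _ := one_mul _
  have h7 : 4000 * (t ^ 2 * (κ * (2 * ℓ * κ) ^ 2)) * (‖φ'‖ + τ)
      ≤ 16000 * ℓ ^ 2 * κ ^ 3 * t ^ 2 * (‖φ‖ + τ) + κ * d * t := by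
    calc _ ≤ 4000 * (t ^ 2 * (κ * (2 * ℓ * κ) ^ 2)) * (‖φ‖ + t * d + τ) := by gcongr
      _ = 16000 * ℓ ^ 2 * κ ^ 3 * t ^ 2 * (‖φ‖ + τ)
          + 4000 * (t ^ 2 * (κ * (2 * ℓ * κ) ^ 2)) * (t * d) := by ring
      _ ≤ _ := by gcongr
  have h8 : 9 * (1 + κ) * (r + 1) * e ≤ 18 * (r + 1) * e := by
    gcongr; linarith
  set E' := ∫ ω, (D.std j ω : ℂ) * osc t (D.tail r ℓ j 0 ω) ∂P
  set c := Complex.I * (t * D.localVar ℓ j : ℝ)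
  calc ‖∫ ω, (D.std j ω : ℂ) * osc t (D.normalized ω) ∂P - c * φ‖
      = ‖(∫ ω, (D.std j ω : ℂ) * osc t (D.normalized ω) ∂P - E') + (E' - c * φ')
          + c * (φ' - φ)‖ := by congr 1; ring
    _ ≤ _ := norm_add₃_le
    _ ≤ t * (κ * d) + (4000 * (t ^ 2 * (κ * (2 * ℓ * κ) ^ 2)) * (‖φ'‖ + τ)
          + 9 * (1 + κ) * (r + 1) * e) + t * (4 * ℓ * κ ^ 2) * (t * d) := by gcongr
    _ ≤ _ := by linarith

/-- A crude bound for the sites near the left end, where the block of radius `r * ℓ` would start at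
an index at most 1 and its remainder is not linked to `R`. There are only `r * ℓ + 1` of them. -/
lemma norm_integral_std_mul_osc_sub_le_two_mul (h : D.CubeBound κ) (hκ : 0 < κ) (hℓ : 1 ≤ ℓ)
    (hj : 1 ≤ j) (hjN : j ≤ N) (ht : 0 ≤ t) (htβ : 512 * (t * (2 * ℓ * κ)) ≤ 1) :
    ‖∫ ω, (D.std j ω : ℂ) * osc t (D.normalized ω) ∂P
        - Complex.I * (t * D.localVar ℓ j : ℝ) * ∫ ω, osc t (D.normalized ω) ∂P‖ ≤ 2 * κ := by
  have h1 : ‖∫ ω, (D.std j ω : ℂ) * osc t (D.normalized ω) ∂P‖ ≤ κ :=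
    (norm_integral_mul_osc_le t).trans (integral_abs_std_le h hκ hj hjN)
  have h2 : ‖Complex.I * (t * D.localVar ℓ j : ℝ) * ∫ ω, osc t (D.normalized ω) ∂P‖ ≤ κ := by
    rw [norm_mul, norm_mul, Complex.norm_I, one_mul, Complex.norm_real, Real.norm_eq_abs, abs_mul,
      abs_of_nonneg ht]
    calc _ ≤ t * (4 * ℓ * κ ^ 2) * 1 := by
          gcongr
          · exact abs_localVar_le h hκ hℓ hj hjN
          · exact RingChain.norm_integral_osc_le_one _ _
      _ = 2 * (t * (2 * ℓ * κ)) * κ := by ring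
      _ ≤ 1 * κ := by gcongr; linarith
      _ = κ := one_mul κ
  linarith [norm_sub_le (∫ ω, (D.std j ω : ℂ) * osc t (D.normalized ω) ∂P)
    (Complex.I * (t * D.localVar ℓ j : ℝ) * ∫ ω, osc t (D.normalized ω) ∂P)]

/-- The characteristic function of the normalized statistic nearly solves `φ' = - t φ`. -/
lemma norm_integral_normalized_mul_osc_le (h : D.CubeBound κ) (hκ : 0 < κ) (hκ1 : κ ≤ 1)
    (hη0 : 0 < η) (hη1 : η ≤ 1) (hη : 3 * phiMixing P D.X ℓ ≤ η ^ 3) (hℓ : 1 ≤ ℓ) (hr : 3 ≤ r)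
    (hsd : 0 < D.sd) (hR : Integrable D.R P) (ht : 0 ≤ t) (htβ : 512 * (t * (2 * ℓ * κ)) ≤ 1)
    (hd0 : 0 ≤ d) (hd : ∀ j, r * ℓ + 1 < j → j ≤ N →
      eLpNorm (D.blockChange r ℓ j) (3 / 2) P ≤ ENNReal.ofReal d) {e : ℝ}
    (he : 22 * (8 ^ r * 8) ^ 2 * η ≤ e) :
    ‖Complex.I * (∫ ω, (D.normalized ω : ℂ) * osc t (D.normalized ω) ∂P)
        + t * ∫ ω, osc t (D.normalized ω) ∂P‖
      ≤ 16000 * N * ℓ ^ 2 * κ ^ 3 * t ^ 2 * ‖∫ ω, osc t (D.normalized ω) ∂P‖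
        + ((∫ ω, |D.R ω| ∂P) / D.sd + 2 * (r * ℓ + 1) * κ + 18 * N * (r + 1) * e)
        + (3 * N * κ * d + N ^ 2 * e) * t
        + 16000 * N * ℓ ^ 2 * κ ^ 3 * (3 * (1 / 2) ^ r + 27 * (r + 1) * e) * t ^ 2 := by
  have he0 : 0 ≤ e := le_trans (by positivity) he
  set φ := ∫ ω, osc t (D.normalized ω) ∂P with hφ
  set τ := 3 * (1 / 2 : ℝ) ^ r + 27 * (r + 1) * e with hτ
  have hτ0 : 0 ≤ τ := by positivity
  set F : ℕ → ℂ := fun j => ∫ ω, (D.std j ω : ℂ) * osc t (D.normalized ω) ∂P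
    - Complex.I * (t * D.localVar ℓ j : ℝ) * φ with hF
  set B := 16000 * (ℓ : ℝ) ^ 2 * κ ^ 3 * t ^ 2 * (‖φ‖ + τ) + 3 * κ * d * t + 18 * (r + 1) * e with hB
  have hB0 : 0 ≤ B := by positivity
  have hFB : ∀ j ∈ Finset.Icc 1 N, ‖F j‖ ≤ B + if j ∈ Finset.Icc 1 (r * ℓ + 1) then 2 * κ else 0 := by
    intro j hj
    rw [Finset.mem_Icc] at hj
    split_ifs with hjr
    · have := norm_integral_std_mul_osc_sub_le_two_mul h hκ hℓ hj.1 hj.2 ht htβ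
      linarith
    · rw [add_zero]
      rw [Finset.mem_Icc] at hjr
      have hj' : r * ℓ + 1 < j := by omega
      exact norm_integral_std_mul_osc_sub_le h hκ hκ1 hη0 hη1 hη hℓ hr hj' hj.2 ht htβ hd0
        (hd j hj' hj.2) he
  have hsum : ‖∑ j ∈ Finset.Icc 1 N, F j‖ ≤ N * B + 2 * (r * ℓ + 1) * κ := by
    refine (norm_sum_le _ _).trans ((Finset.sum_le_sum hFB).trans ?_)
    rw [Finset.sum_add_distrib, Finset.sum_const, nsmul_eq_mul, Nat.card_Icc, Nat.add_sub_cancel,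
      ← Finset.sum_filter, Finset.sum_const, nsmul_eq_mul]
    have : (((Finset.Icc 1 N).filter (· ∈ Finset.Icc 1 (r * ℓ + 1))).card : ℝ) ≤ r * ℓ + 1 := by
      have h1 : (Finset.Icc 1 N).filter (· ∈ Finset.Icc 1 (r * ℓ + 1)) ⊆ Finset.Icc 1 (r * ℓ + 1) :=
        fun i hi => (Finset.mem_filter.1 hi).2
      have h2 := Finset.card_le_card h1
      rw [Nat.card_Icc, Nat.add_sub_cancel] at h2
      exact_mod_cast h2
    have : (((Finset.Icc 1 N).filter (· ∈ Finset.Icc 1 (r * ℓ + 1))).card : ℝ) * (2 * κ)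
      ≤ (r * ℓ + 1) * (2 * κ) := by gcongr
    linarith
  have hdecomp : ∫ ω, (D.normalized ω : ℂ) * osc t (D.normalized ω) ∂P
      = ∑ j ∈ Finset.Icc 1 N, ∫ ω, (D.std j ω : ℂ) * osc t (D.normalized ω) ∂P
        + ∫ ω, ((D.R ω / D.sd : ℝ) : ℂ) * osc t (D.normalized ω) ∂P := by
    have hi : ∀ j ∈ Finset.Icc 1 N,
        Integrable (fun ω => (D.std j ω : ℂ) * osc t (D.normalized ω)) P := fun j hj =>
      integrable_mul_osc (D.integrable_std (Finset.mem_Icc.1 hj).1 (Finset.mem_Icc.1 hj).2)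
        measurable_normalized t
    rw [← integral_finsetSum _ hi, ← integral_add (integrable_finsetSum _ hi)
      (integrable_mul_osc (hR.div_const _) measurable_normalized t)]
    refine integral_congr_ae (Eventually.of_forall fun ω => ?_)
    simp only
    rw [← Finset.sum_mul, ← add_mul, ← Complex.ofReal_sum, ← Complex.ofReal_add, ← normalized_eq]
  have hRb : ‖∫ ω, ((D.R ω / D.sd : ℝ) : ℂ) * osc t (D.normalized ω) ∂P‖
      ≤ (∫ ω, |D.R ω| ∂P) / D.sd := by
    refine (norm_integral_mul_osc_le t).trans_eq ?_
    simp_rw [abs_div, abs_of_pos hsd]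
    rw [integral_div]
  have hlv : |1 - ∑ j ∈ Finset.Icc 1 N, D.localVar ℓ j| ≤ N ^ 2 * e := by
    refine (abs_one_sub_sum_localVar_le h hκ1 hκ hη0 hη1 hη hsd).trans ?_
    gcongr
    refine le_trans ?_ he
    have : (1 : ℝ) ≤ 8 ^ r := one_le_pow₀ (by norm_num)
    gcongr
    linarith
  have hφ1 : ‖φ‖ ≤ 1 := RingChain.norm_integral_osc_le_one _ _
  -- The main terms carry `Complex.I * Complex.I = -1`, so they cancel `t * φ` up to the defect of
  -- the sum of local variances from 1.
  have hid : Complex.I * (∫ ω, (D.normalized ω : ℂ) * osc t (D.normalized ω) ∂P) + t * φ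
      = Complex.I * ∑ j ∈ Finset.Icc 1 N, F j
        + Complex.I * ∫ ω, ((D.R ω / D.sd : ℝ) : ℂ) * osc t (D.normalized ω) ∂P
        + (t * (1 - ∑ j ∈ Finset.Icc 1 N, D.localVar ℓ j) : ℝ) * φ := by
    rw [hdecomp]
    simp only [hF]
    rw [Finset.sum_sub_distrib, ← Finset.sum_mul, ← Finset.mul_sum, ← Complex.ofReal_sum,
      ← Finset.mul_sum]
    push_cast
    linear_combination (t * (∑ j ∈ Finset.Icc 1 N, (D.localVar ℓ j : ℂ)) * φ) * Complex.I_sq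
  rw [hid]
  refine (norm_add₃_le).trans ?_
  rw [norm_mul, norm_mul, norm_mul, Complex.norm_I, one_mul, one_mul, Complex.norm_real,
    Real.norm_eq_abs, abs_mul, abs_of_nonneg ht]
  have hlast : t * |1 - ∑ j ∈ Finset.Icc 1 N, D.localVar ℓ j| * ‖φ‖ ≤ t * (N ^ 2 * e) * 1 := by
    gcongr
  refine (add_le_add (add_le_add hsum hRb) hlast).trans_eq ?_
  rw [hB]
  ring

end Statistic

end WeakDependence

/-! ### Telescoping the remainder; normal approximation with free parameters. -/

namespace WeakDependence

namespace Statistic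

section Telescope

variable {Ω : Type u} [mΩ : MeasurableSpace Ω] {P : Measure Ω}
  {𝒳 : ℕ → Type v} [∀ j, MeasurableSpace (𝒳 j)] {N : ℕ} {D : Statistic P 𝒳 N} {ℓ r j : ℕ}

lemma measurable_Rout' {k : ℕ} (hj : 1 ≤ j) (hjN : j ≤ N) (hjk : j ≤ k + 1) (hk : k ≤ N) :
    Measurable (D.Rout j k) :=
  (D.measurable_Rout j k hj hjN hjk hk).mono
    (sigmaGen_le D.X fun i hi => D.measurable_X i hi.1.1) le_rfl

/-- Leaving out a whole block changes the remainder by at most its length times `γ`. -/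
lemma eLpNorm_sub_Rout_le {m : ℕ} {L : ℝ} (hj : 2 ≤ j) (hjN : j ≤ N) (hjm : j + m ≤ N + 1) (hm : (m : ℝ) ≤ L + 1) :
    eLpNorm (fun ω => D.R ω - D.Rout j (j + m - 1) ω) (3 / 2) P ≤ m * D.gamma L := by
  induction m with
  | zero =>
    -- The empty block gives `R` itself; this is where `2 ≤ j` is needed.
    have : (fun ω => D.R ω - D.Rout j (j + 0 - 1) ω) = 0 := by
      funext ω; simp [D.Rout_empty j hj hjN]
    rw [this]; simp
  | succ m ih =>
    have hγ : eLpNorm (fun ω => D.Rout j (j + m) ω - D.Rout j (j + m - 1) ω) (3 / 2) P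
        ≤ D.gamma L := by
      unfold gamma
      refine le_iSup_of_le j (le_iSup_of_le (j + m) (le_iSup_of_le ⟨by omega, by omega, by omega, ?_⟩
        le_rfl))
      push_cast at hm ⊢
      rw [sub_add_cancel_left, abs_neg, abs_of_nonneg (by positivity)]
      linarith
    have hm' : (m : ℝ) ≤ L + 1 := le_trans (by push_cast; linarith) hm
    have hR := D.measurable_remainder
    have h1 := measurable_Rout' (D := D) (j := j) (k := j + m - 1) (by omega) (by omega) (by omega)
      (by omega)
    have h2 := measurable_Rout' (D := D) (j := j) (k := j + m) (by omega) (by omega) (by omega)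
      (by omega)
    have heq : (fun ω => D.R ω - D.Rout j (j + (m + 1) - 1) ω)
        = (fun ω => D.R ω - D.Rout j (j + m - 1) ω)
          - fun ω => D.Rout j (j + m) ω - D.Rout j (j + m - 1) ω := by
      funext ω
      have : j + (m + 1) - 1 = j + m := by omega
      rw [this, Pi.sub_apply]; ring
    rw [heq]
    refine (eLpNorm_sub_le (hR.sub h1).aestronglyMeasurable (h2.sub h1).aestronglyMeasurable
      ?_).trans ?_
    · rw [ENNReal.le_div_iff_mul_le (by simp) (by simp)]
      norm_num
    · push_cast
      rw [add_mul, one_mul]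
      exact add_le_add (ih (by omega) hm') hγ

/-- The block has at most `2 * (r * ℓ) + 1` sites, cut at `N` on the right if necessary, and starts
at an index at least 2, so the telescoping sum applies. -/
lemma eLpNorm_blockChange_le {L : ℝ} (hL : 2 * (r * ℓ : ℝ) ≤ L) (hj : r * ℓ + 1 < j) (hjN : j ≤ N)
    (hsd : 0 < D.sd) (hγ : D.gamma L ≠ ⊤) :
    eLpNorm (D.blockChange r ℓ j) (3 / 2) P
      ≤ ENNReal.ofReal ((2 * (r * ℓ) + 1) * (D.gamma L).toReal / D.sd) := by
  have h0 : D.blockChange r ℓ j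
      = D.sd⁻¹ • fun ω => D.R ω - D.Rout (j - r * ℓ) (min N (j + r * ℓ)) ω := by
    funext ω; simp [blockChange, div_eq_inv_mul]
  obtain ⟨m, hm⟩ : ∃ m, min N (j + r * ℓ) + 1 = j - r * ℓ + m := ⟨_, (Nat.add_sub_of_le (by omega)).symm⟩
  have hm2 : min N (j + r * ℓ) = j - r * ℓ + m - 1 := by omega
  have hmle : m ≤ 2 * (r * ℓ) + 1 := by omega
  have hmle' : (m : ℝ) ≤ 2 * (r * ℓ) + 1 := by exact_mod_cast hmle
  have h1 := eLpNorm_sub_Rout_le (D := D) (j := j - r * ℓ) (m := m) (L := L) (by omega) (by omega)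
    (by omega) (by linarith)
  rw [h0, eLpNorm_const_smul, hm2, Real.enorm_of_nonneg (by positivity)]
  rw [← ENNReal.ofReal_toReal hγ, ← ENNReal.ofReal_natCast, ← ENNReal.ofReal_mul (by positivity)] at h1
  refine (mul_le_mul_right h1 _).trans ?_
  rw [← ENNReal.ofReal_mul (by positivity)]
  refine ENNReal.ofReal_le_ofReal ?_
  rw [div_eq_inv_mul]
  gcongr

lemma normalDist_le_one [IsProbabilityMeasure P] : D.normalDist ≤ 1 := by
  refine iSup_le fun x => ?_
  rw [← ENNReal.ofReal_one]
  refine ENNReal.ofReal_le_ofReal (abs_le.2 ⟨?_, ?_⟩)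
  · linarith [cdf_le_one (gaussianReal 0 1) x, measureReal_nonneg (μ := P) (s := {ω | D.T ω < D.sd * x})]
  · linarith [cdf_nonneg (gaussianReal 0 1) x, measureReal_le_one (μ := P) (s := {ω | D.T ω < D.sd * x})]

end Telescope

/-- The approximate differential equation is inserted into the Berry–Esseen argument. The constant
1408 is `22 * 8 ^ 2`, and `64 ^ r = (8 ^ r) ^ 2` is the price of decoupling products of up to `r`
ring factors. -/
theorem exists_normalDist_le_of_cubeBound : ∃ C : ℝ, 0 < C ∧
    ∀ {Ω : Type u} [MeasurableSpace Ω] (P : Measure Ω) [IsProbabilityMeasure P]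
      (𝒳 : ℕ → Type v) [∀ j, MeasurableSpace (𝒳 j)] (N : ℕ) (D : Statistic P 𝒳 N)
      (κ η T L : ℝ) (ℓ r : ℕ), D.CubeBound κ → 0 < κ → κ ≤ 1 → 0 < η → η ≤ 1 →
      3 * phiMixing P D.X ℓ ≤ η ^ 3 → 1 ≤ N → 1 ≤ ℓ → 3 ≤ r → 0 < D.sd → 0 < T →
      512 * (T * (2 * ℓ * κ)) ≤ 1 → 4 * (16000 * N * ℓ ^ 2 * κ ^ 3) * T ≤ 1 →
      2 * (r * ℓ : ℝ) ≤ L → D.meanAbsR ≠ ⊤ → D.gamma L ≠ ⊤ →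
      D.normalDist ≤ ENNReal.ofReal (C * (D.meanAbsR.toReal / D.sd + 2 * (r * ℓ + 1) * κ
        + 18 * N * (r + 1) * (1408 * 64 ^ r * η) + 16000 * N * ℓ ^ 2 * κ ^ 3
        + (3 * N * κ * ((2 * (r * ℓ) + 1) * (D.gamma L).toReal / D.sd)
            + N ^ 2 * (1408 * 64 ^ r * η)) * Real.log (1 + T)
        + (3 * (1 / 2) ^ r + 27 * (r + 1) * (1408 * 64 ^ r * η)) + 1 / T)) := by
  obtain ⟨C, hC, hCn⟩ := exists_normal_approximation_constant.{u}
  refine ⟨C, hC, ?_⟩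
  intro Ω _ P _ 𝒳 _ N D κ η T L ℓ r h hκ hκ1 hη0 hη1 hη hN hℓ hr hsd hT hTβ hTa hL hRt hγ
  have hR : Integrable D.R P := ⟨D.measurable_remainder.aestronglyMeasurable,
    lt_top_iff_ne_top.2 hRt⟩
  have hRe : ∫ ω, |D.R ω| ∂P = D.meanAbsR.toReal := by
    simp only [← Real.norm_eq_abs]
    exact integral_norm_eq_lintegral_enorm D.measurable_remainder.aestronglyMeasurable
  set e := 1408 * 64 ^ r * η with he
  have he' : 22 * (8 ^ r * 8) ^ 2 * η ≤ e := by
    have : (64 : ℝ) ^ r = (8 ^ r) ^ 2 := by rw [← pow_mul, mul_comm, pow_mul]; norm_num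
    rw [he, this]
    exact le_of_eq (by ring)
  have he0 : 0 ≤ e := by positivity
  set d := (2 * (r * ℓ) + 1) * (D.gamma L).toReal / D.sd with hd
  have hd0 : 0 ≤ d := by positivity
  have hℓ0 : (0 : ℝ) < ℓ := by exact_mod_cast hℓ
  have hN0 : (0 : ℝ) < N := by exact_mod_cast hN
  set τ := 3 * (1 / 2 : ℝ) ^ r + 27 * (r + 1) * e with hτ
  have hτ0 : 0 ≤ τ := by positivity
  refine iSup_le fun x => ENNReal.ofReal_le_ofReal ?_
  have hset : {ω | D.T ω < D.sd * x} = {ω | D.normalized ω < x} := by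
    ext ω
    simp only [Set.mem_ofPred_eq, normalized]
    rw [div_lt_iff₀ hsd, mul_comm]
  rw [hset]
  refine (hCn P D.normalized measurable_normalized (integrable_normalized hR)
    (16000 * N * ℓ ^ 2 * κ ^ 3) (D.meanAbsR.toReal / D.sd + 2 * (r * ℓ + 1) * κ
        + 18 * N * (r + 1) * e) (3 * N * κ * d + N ^ 2 * e) (16000 * N * ℓ ^ 2 * κ ^ 3 * τ) T
    (by positivity) (by positivity) (by positivity) (by positivity) hT hTa ?_ x).trans ?_
  · intro t ht
    have := norm_integral_normalized_mul_osc_le h hκ hκ1 hη0 hη1 hη hℓ hr hsd hR ht.1 (t := t)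
      (le_trans (by gcongr; exact ht.2) hTβ) hd0
      (fun j hj hjN => eLpNorm_blockChange_le hL hj hjN hsd hγ) he'
    rwa [hRe] at this
  · refine mul_le_mul_of_nonneg_left ?_ hC.le
    -- The quadratic error has coefficient `a * τ`, and `4 * a * T ≤ 1` makes its contribution `a *
    -- τ * T` at most `τ`.
    have : 16000 * N * ℓ ^ 2 * κ ^ 3 * τ * T ≤ τ := by
      have := mul_le_mul_of_nonneg_right hTa hτ0
      have h0 : 0 ≤ 16000 * N * ℓ ^ 2 * κ ^ 3 * T * τ := by positivity
      nlinarith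
    linarith

end Statistic

end WeakDependence

/-! ### Choice of the parameters for a given block length. -/

namespace WeakDependence

namespace Statistic

lemma cubeBound_of_third_moment {Ω : Type u} [MeasurableSpace Ω] {P : Measure Ω}
    {𝒳 : ℕ → Type v} [∀ j, MeasurableSpace (𝒳 j)] {N : ℕ} {D : Statistic P 𝒳 N} {ρ σ : ℝ}
    (hρ : 0 < ρ) (hσ : 0 < σ) (hsd : σ ≤ D.sd)
    (h3 : ∀ j, 1 ≤ j → j ≤ N → ∫⁻ ω, ‖D.g j (D.X j ω)‖ₑ ^ 3 ∂P ≤ ENNReal.ofReal ρ) :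
    D.CubeBound (ρ ^ (3⁻¹ : ℝ) / σ) := by
  intro j hj hjN
  have hm : Measurable fun ω => D.g j (D.X j ω) :=
    (D.measurable_g j hj hjN).comp (D.measurable_X j hj)
  have hm3 : Measurable fun ω => |D.g j (D.X j ω)| ^ 3 := hm.norm.pow_const 3
  have he : ∀ ω, ‖|D.g j (D.X j ω)| ^ 3‖ₑ = ‖D.g j (D.X j ω)‖ₑ ^ 3 := fun ω => by
    rw [enorm_pow, Real.enorm_abs]
  have hlt : ∫⁻ ω, ‖|D.g j (D.X j ω)| ^ 3‖ₑ ∂P ≤ ENNReal.ofReal ρ := by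
    simp only [he]; exact h3 j hj hjN
  have hi : Integrable (fun ω => |D.g j (D.X j ω)| ^ 3) P :=
    ⟨hm3.aestronglyMeasurable, hlt.trans_lt ENNReal.ofReal_lt_top⟩
  have hb : ∫ ω, |D.g j (D.X j ω)| ^ 3 ∂P ≤ ρ := by
    have h1 := integral_norm_eq_lintegral_enorm hm3.aestronglyMeasurable (μ := P)
    have h2 : ∀ ω, ‖|D.g j (D.X j ω)| ^ 3‖ = |D.g j (D.X j ω)| ^ 3 := fun ω =>
      Real.norm_of_nonneg (by positivity)
    simp only [h2] at h1
    rw [h1]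
    exact ENNReal.toReal_le_of_le_ofReal hρ.le hlt
  have hs : 0 < D.sd := hσ.trans_le hsd
  have hd : (fun ω => |D.std j ω| ^ 3) = fun ω => |D.g j (D.X j ω)| ^ 3 / D.sd ^ 3 := by
    funext ω
    rw [std, abs_div, div_pow, abs_of_pos hs]
  rw [hd]
  refine ⟨hi.div_const _, ?_⟩
  rw [integral_div, div_pow]
  have : (ρ ^ (3⁻¹ : ℝ)) ^ 3 = ρ := Real.rpow_inv_natCast_pow hρ.le (n := 3) (by norm_num)
  rw [this]
  gcongr

lemma half_pow_le {x : ℝ} {r : ℕ} (hr : x ≤ r) (hx : 0 ≤ x) : (1 / 2 : ℝ) ^ r ≤ Real.exp (-(x / 2)) := by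
  have h2 := Real.log_two_gt_d9
  have : (1 / 2 : ℝ) ^ r = Real.exp (-(r * Real.log 2)) := by
    rw [Real.exp_neg, ← Real.log_pow, Real.exp_log (by positivity)]
    simp
  rw [this]
  refine Real.exp_le_exp.2 (neg_le_neg ?_)
  nlinarith

/-- By `r + 1 ≤ 2 ^ r` the left side is at most `128 ^ r`. As `7 * log 2 < 4.86`, the exponent 5
leaves room for the rounding of `r` once `x ≥ 35`. -/
lemma mul_pow_le_exp {x : ℝ} {r : ℕ} (hr : r ≤ x + 1) (hx : 35 ≤ x) :
    (r + 1) * (64 : ℝ) ^ r ≤ Real.exp (5 * x) := by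
  have h2 := Real.log_two_lt_d9
  have hr2 : ((r : ℝ) + 1) ≤ 2 ^ r := by
    exact_mod_cast Nat.succ_le_of_lt (Nat.lt_two_pow_self (n := r))
  calc (r + 1) * (64 : ℝ) ^ r ≤ 2 ^ r * 64 ^ r := by gcongr
    _ = Real.exp (r * (7 * Real.log 2)) := by
      have : 7 * Real.log 2 = Real.log 128 := by
        rw [show (128 : ℝ) = 2 ^ 7 by norm_num, Real.log_pow]; norm_num
      rw [this, ← Real.log_pow, Real.exp_log (by positivity), ← mul_pow]; norm_num
    _ ≤ _ := by
      refine Real.exp_le_exp.2 ?_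
      nlinarith

/-- Sum of the contributions in the normal approximation for a block length `ℓ`, with the rest of
the parameters chosen. -/
lemma sum_le_of_parameters {κ₀ s b x ℓ r η M G σ c : ℝ} (hκ₀ : 0 < κ₀) (hb : 0 < b) (hs : 1 ≤ s)
    (hx : 1 ≤ x) (hxN : x ≤ s ^ 2) (hℓ : 1 ≤ ℓ) (hr0 : 0 ≤ r) (hr : r ≤ 2 * x) {p q : ℝ}
    (hσ : b * s ≤ σ) (hM : 0 ≤ M) (hG : 0 ≤ G) (hp : 0 ≤ p) (hq : 3 * q ≤ 3 / s) (hη : 0 ≤ η)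
    (hpη : (r + 1) * p * η * s ^ 6 ≤ 1 / s) (hc : 0 ≤ c) {lg : ℝ} (hlg0 : 0 ≤ lg) (hlg : lg ≤ x) :
    M / σ + 2 * (r * ℓ + 1) * (κ₀ / s)
        + 18 * s ^ 2 * (r + 1) * (1408 * p * η) + 16000 * s ^ 2 * ℓ ^ 2 * (κ₀ / s) ^ 3
        + (3 * s ^ 2 * (κ₀ / s) * ((2 * (r * ℓ) + 1) * G / σ)
            + (s ^ 2) ^ 2 * (1408 * p * η)) * lg
        + (3 * q + 27 * (r + 1) * (1408 * p * η)) + 1 / (s / (ℓ ^ 2 * c))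
      ≤ (1 / b + 6 * κ₀ + 16000 * κ₀ ^ 3 + c + 70000 + 15 * κ₀ / b)
        * ((ℓ ^ 2 + ℓ * x) / s + M / s + ℓ * x ^ 2 * G) := by
  have hs0 : 0 < s := by linarith
  have hσ0 : 0 < σ := lt_of_lt_of_le (by positivity) hσ
  have hs2 : 1 ≤ s ^ 2 := one_le_pow₀ hs
  have hlx : 1 ≤ ℓ * x := by nlinarith
  have hrl : r * ℓ ≤ 2 * (ℓ * x) := by nlinarith
  have hrl0 : 0 ≤ r * ℓ := by positivity
  have t1 : M / σ ≤ 1 / b * (M / s) := by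
    calc M / σ ≤ M / (b * s) := by gcongr
      _ = _ := by field_simp
  have t2 : 2 * (r * ℓ + 1) * (κ₀ / s) ≤ 6 * κ₀ * ((ℓ * x) / s) := by
    calc 2 * (r * ℓ + 1) * (κ₀ / s) ≤ 2 * (2 * (ℓ * x) + ℓ * x) * (κ₀ / s) := by gcongr
      _ = _ := by ring
  -- Every mixing error is a constant times `w` with at most six powers of `s`, which `hpη` makes at
  -- most a constant times `1 / s`.
  set w := (r + 1) * p * η with hw
  have hw0 : 0 ≤ w := by positivity
  have hpw : p * η ≤ w := by
    rw [hw, mul_assoc]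
    exact le_mul_of_one_le_left (by positivity) (by linarith)
  have hws2 : w * s ^ 2 ≤ 1 / s := by
    refine le_trans ?_ hpη
    gcongr
    · norm_num
  have hws : w ≤ 1 / s := le_trans (le_mul_of_one_le_right hw0 hs2) hws2
  have t3 : 18 * s ^ 2 * (r + 1) * (1408 * p * η) ≤ 18 * 1408 * (1 / s) := by
    calc _ = 18 * 1408 * (w * s ^ 2) := by rw [hw]; ring
      _ ≤ _ := by gcongr
  have t4 : 16000 * s ^ 2 * ℓ ^ 2 * (κ₀ / s) ^ 3 = 16000 * κ₀ ^ 3 * (ℓ ^ 2 / s) := by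
    field_simp
  have t5 : 3 * s ^ 2 * (κ₀ / s) * ((2 * (r * ℓ) + 1) * G / σ) * lg
      ≤ 15 * κ₀ / b * (ℓ * x ^ 2 * G) := by
    calc _ ≤ 3 * s ^ 2 * (κ₀ / s) * ((2 * (2 * (ℓ * x)) + ℓ * x) * G / (b * s)) * x := by gcongr
      _ = _ := by field_simp; ring
  have t6 : (s ^ 2) ^ 2 * (1408 * p * η) * lg ≤ 1408 * (1 / s) := by
    calc _ = 1408 * ((s ^ 2) ^ 2 * (p * η) * lg) := by ring
      _ ≤ 1408 * ((s ^ 2) ^ 2 * w * s ^ 2) := by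
        gcongr
        exact hlg.trans hxN
      _ = 1408 * (w * s ^ 6) := by ring
      _ ≤ _ := by gcongr
  have t7 : 27 * (r + 1) * (1408 * p * η) ≤ 27 * 1408 * (1 / s) := by
    calc _ = 27 * 1408 * w := by rw [hw]; ring
      _ ≤ _ := by gcongr
  have t8 : 1 / (s / (ℓ ^ 2 * c)) = c * (ℓ ^ 2 / s) := by
    rw [one_div_div]; ring
  have hA : 1 / s ≤ (ℓ ^ 2 + ℓ * x) / s := by
    gcongr; nlinarith [sq_nonneg ℓ]
  have hA1 : (ℓ * x) / s ≤ (ℓ ^ 2 + ℓ * x) / s := by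
    gcongr; nlinarith [sq_nonneg ℓ]
  have hA2 : ℓ ^ 2 / s ≤ (ℓ ^ 2 + ℓ * x) / s := by
    gcongr; linarith
  set A := (ℓ ^ 2 + ℓ * x) / s
  have hA0 : 0 ≤ A := le_trans (by positivity) hA
  have u2 := t2.trans (mul_le_mul_of_nonneg_left hA1 (by positivity))
  have u4 : 16000 * κ₀ ^ 3 * (ℓ ^ 2 / s) ≤ 16000 * κ₀ ^ 3 * A := by gcongr
  have u8 : c * (ℓ ^ 2 / s) ≤ c * A := by gcongr
  have hB0 : 0 ≤ M / s := by positivity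
  have hG0 : 0 ≤ ℓ * x ^ 2 * G := by positivity
  set B := M / s
  set G' := ℓ * x ^ 2 * G
  rw [t4, t8, add_mul]
  have c1 : 0 ≤ 1 / b := by positivity
  have c2 : 0 ≤ 15 * κ₀ / b := by positivity
  have c3 : 0 ≤ κ₀ ^ 3 := by positivity
  have hexp : (1 / b + 6 * κ₀ + 16000 * κ₀ ^ 3 + c + 70000 + 15 * κ₀ / b) * (A + B + G')
      = (6 * κ₀ * A + 16000 * κ₀ ^ 3 * A + c * A + 70000 * A + 1 / b * B + 15 * κ₀ / b * G')
        + (1 / b * (A + G') + 6 * κ₀ * (B + G') + 16000 * κ₀ ^ 3 * (B + G') + c * (B + G')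
          + 70000 * (B + G') + 15 * κ₀ / b * (A + B)) := by ring
  rw [hexp]
  have hrest : 0 ≤ 1 / b * (A + G') + 6 * κ₀ * (B + G') + 16000 * κ₀ ^ 3 * (B + G') + c * (B + G')
          + 70000 * (B + G') + 15 * κ₀ / b * (A + B) := by positivity
  have hq' : 3 * q ≤ 3 * (1 / s) := by rw [mul_one_div]; exact hq
  linarith

set_option maxHeartbeats 1000000 in
-- With `κ` of order `N^{-1/2}`, the choices are `r = ⌈log N⌉` rings, so that `(1 / 2) ^ r ≤
-- N^{-1/2}`; `η = N^{-9}`, which dominates `(r + 1) * 64 ^ r ≤ N ^ 5` together with the counting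
-- factors; and a cutoff `T` of order `√N / ℓ ^ 2`. Only `ℓ` remains, to be fitted to the mixing
-- rate. The factor of `γ` is the block length, of order `ℓ log N`, times the `log (1 + T)` of the
-- linear error.
theorem exists_normalDist_le_of_phiMixing {ρ b' : ℝ} (hρ : 0 < ρ) (hb' : 0 < b') :
    ∃ C : ℝ, 0 < C ∧ ∃ N₁ : ℕ, ∀ {Ω : Type u} [MeasurableSpace Ω] (P : Measure Ω)
      [IsProbabilityMeasure P] (𝒳 : ℕ → Type v) [∀ j, MeasurableSpace (𝒳 j)] (N : ℕ)
      (D : Statistic P 𝒳 N) (ℓ : ℕ) (L : ℝ), N₁ ≤ N → b' * N ≤ Var[D.S; P] →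
      (∀ j, 1 ≤ j → j ≤ N → ∫⁻ ω, ‖D.g j (D.X j ω)‖ₑ ^ 3 ∂P ≤ ENNReal.ofReal ρ) →
      1 ≤ ℓ → 3 * phiMixing P D.X ℓ ≤ ((N : ℝ) ^ 27)⁻¹ → 4 * (Real.log N * ℓ) ≤ L →
      D.normalDist ≤ ENNReal.ofReal (C * ((ℓ ^ 2 + ℓ * Real.log N) * (N : ℝ) ^ (-(1 / 2) : ℝ)))
        + ENNReal.ofReal (C * (N : ℝ) ^ (-(1 / 2) : ℝ)) * D.meanAbsR
        + ENNReal.ofReal (C * (ℓ * Real.log N ^ 2)) * D.gamma L := by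
  obtain ⟨C, hC, hmain⟩ := exists_normalDist_le_of_cubeBound.{u, v}
  set b := Real.sqrt b' with hb
  have hb0 : 0 < b := Real.sqrt_pos.2 hb'
  set κ₀ := ρ ^ (3⁻¹ : ℝ) / b with hκ₀
  have hκ₀0 : 0 < κ₀ := by positivity
  -- The first two summands ensure the two smallness conditions on `T`; the summand 1 gives `T ≤
  -- √N`, hence `log (1 + T) ≤ log N`.
  set c := 64000 * κ₀ ^ 3 + 1024 * κ₀ + 1 with hc
  have hc1 : 1 ≤ c := by
    have : 0 ≤ 64000 * κ₀ ^ 3 + 1024 * κ₀ := by positivity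
    linarith
  -- The thresholds give `log N ≥ 35`, for `mul_pow_le_exp`, and `κ₀ / √N ≤ 1`.
  refine ⟨C * (1 / b + 6 * κ₀ + 16000 * κ₀ ^ 3 + c + 70000 + 15 * κ₀ / b), by positivity,
    max ⌈Real.exp 35⌉₊ ⌈κ₀ ^ 2⌉₊, ?_⟩
  set C₁ := 1 / b + 6 * κ₀ + 16000 * κ₀ ^ 3 + c + 70000 + 15 * κ₀ / b with hC₁
  have hC₁0 : 0 < C₁ := by positivity
  intro Ω _ P _ 𝒳 _ N D ℓ L hN hvar h3 hℓ hφ hL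
  have hNe : Real.exp 35 ≤ N := (Nat.le_ceil _).trans (by exact_mod_cast (le_max_left _ _).trans hN)
  have hNκ : κ₀ ^ 2 ≤ N := (Nat.le_ceil _).trans (by exact_mod_cast (le_max_right _ _).trans hN)
  have hN0 : (0 : ℝ) < N := (Real.exp_pos _).trans_le hNe
  set x := Real.log N with hx
  have hx35 : 35 ≤ x := (Real.le_log_iff_exp_le hN0).2 hNe
  have hexp : Real.exp x = N := Real.exp_log hN0
  have hNx : x + 1 ≤ N := by rw [← hexp]; exact Real.add_one_le_exp x
  set s := Real.sqrt N with hs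
  have hss : s ^ 2 = N := Real.sq_sqrt hN0.le
  have hs3 : 3 ≤ s := Real.le_sqrt_of_sq_le (by linarith)
  have hs0 : 0 < s := by linarith
  have hsx : Real.exp (-(x / 2)) = 1 / s := by
    rw [Real.exp_neg, one_div, hs, Real.sqrt_eq_rpow, Real.rpow_def_of_pos hN0]
    congr 2; ring
  have hrs : (N : ℝ) ^ (-(1 / 2) : ℝ) = 1 / s := by
    rw [Real.rpow_neg hN0.le, ← Real.sqrt_eq_rpow, one_div]
  have hsd : b * s ≤ D.sd := by
    rw [hb, hs, ← Real.sqrt_mul hb'.le]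
    exact Real.sqrt_le_sqrt hvar
  have hsd0 : 0 < D.sd := lt_of_lt_of_le (by positivity) hsd
  have hℓ' : (1 : ℝ) ≤ ℓ := by exact_mod_cast hℓ
  have hcx : 0 < C * C₁ := by positivity
  -- Infinite `E|R|` or `γ` makes the right side infinite, since its coefficient is positive.
  by_cases hM : D.meanAbsR = ⊤
  · have : ENNReal.ofReal (C * C₁ * (N : ℝ) ^ (-(1 / 2) : ℝ)) * D.meanAbsR = ⊤ := by
      rw [hM]
      exact ENNReal.mul_top (ENNReal.ofReal_pos.2 (by positivity)).ne'
    rw [this]; simp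
  by_cases hG : D.gamma L = ⊤
  · have : ENNReal.ofReal (C * C₁ * (ℓ * x ^ 2)) * D.gamma L = ⊤ := by
      rw [hG]
      exact ENNReal.mul_top (ENNReal.ofReal_pos.2 (by positivity)).ne'
    rw [this]; simp
  set r := ⌈x⌉₊ with hr
  have hrx : x ≤ r := Nat.le_ceil _
  have hrx1 : (r : ℝ) ≤ x + 1 := (Nat.ceil_lt_add_one (by linarith)).le
  have hr3 : 3 ≤ r := by
    have : (3 : ℝ) ≤ r := by linarith
    exact_mod_cast this
  have hκs : ρ ^ (3⁻¹ : ℝ) / (b * s) = κ₀ / s := by rw [hκ₀, div_div]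
  have hcube : D.CubeBound (κ₀ / s) := hκs ▸ cubeBound_of_third_moment hρ (by positivity) hsd h3
  set η := ((N : ℝ) ^ 9)⁻¹ with hη
  have hN1 : (1 : ℝ) ≤ N := by linarith
  have hη0 : 0 < η := by positivity
  have hη1 : η ≤ 1 := inv_le_one_of_one_le₀ (one_le_pow₀ hN1)
  have hη3 : η ^ 3 = ((N : ℝ) ^ 27)⁻¹ := by rw [hη, inv_pow, ← pow_mul]
  set T := s / (ℓ ^ 2 * c) with hT
  have hT0 : 0 < T := by positivity
  have hℓ2 : (ℓ : ℝ) ≤ ℓ ^ 2 := by nlinarith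
  have hTs : T ≤ s := div_le_self hs0.le (by nlinarith)
  have hfinal := hmain P 𝒳 N D (κ₀ / s) η T L ℓ r hcube (by positivity)
    (by rw [div_le_one hs0, hs]; exact Real.le_sqrt_of_sq_le hNκ) hη0 hη1 (by rw [hη3]; exact hφ)
    (by exact_mod_cast hN1) hℓ hr3 hsd0 hT0
    (by
      calc 512 * (T * (2 * ℓ * (κ₀ / s))) = (1024 * κ₀) * ℓ / (ℓ ^ 2 * c) := by
            rw [hT]; field_simp; norm_num
        _ ≤ c * ℓ ^ 2 / (ℓ ^ 2 * c) := by
            gcongr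
            rw [hc]
            have : 0 ≤ 64000 * κ₀ ^ 3 := by positivity
            linarith
        _ = 1 := by field_simp)
    (by
      calc 4 * (16000 * N * ℓ ^ 2 * (κ₀ / s) ^ 3) * T = (64000 * κ₀ ^ 3) / c := by
            rw [hT, ← hss]; field_simp; norm_num
        _ ≤ c / c := by
            gcongr
            rw [hc]
            have : 0 ≤ 1024 * κ₀ := by positivity
            linarith
        _ = 1 := div_self (by positivity))
    (by nlinarith) hM hG
  refine hfinal.trans ?_
  have hlog0 : 0 ≤ Real.log (1 + T) := Real.log_nonneg (by linarith)
  have hlog : Real.log (1 + T) ≤ x := by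
    refine Real.log_le_log (by linarith) ?_
    rw [← hss]; nlinarith
  have hsum := sum_le_of_parameters (κ₀ := κ₀) (s := s) (b := b) (x := x) (ℓ := ℓ) (r := r) (η := η)
    (M := D.meanAbsR.toReal) (G := (D.gamma L).toReal) (σ := D.sd) (c := c) (p := 64 ^ r)
    (q := (1 / 2) ^ r) (lg := Real.log (1 + T)) hκ₀0 hb0 (by linarith) (by linarith)
    (by rw [hss]; linarith) hℓ' (by positivity) (by linarith) hsd ENNReal.toReal_nonneg
    ENNReal.toReal_nonneg (by positivity)
    (by
      have := half_pow_le hrx (by linarith)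
      rw [hsx] at this
      calc _ ≤ 3 * (1 / s) := by gcongr
        _ = _ := by ring) hη0.le
    (by
      have h1 := mul_pow_le_exp hrx1 hx35
      have h2 : Real.exp (5 * x) = (N : ℝ) ^ 5 := by
        rw [← hexp, ← Real.exp_nat_mul]; norm_num
      rw [h2] at h1
      calc _ ≤ (N : ℝ) ^ 5 * η * s ^ 6 := by gcongr
        _ = 1 / s ^ 2 := by
          rw [hη, ← hss]; field_simp
        _ ≤ 1 / s := by
          gcongr
          nlinarith) (by positivity) hlog0 hlog
  rw [hss] at hsum
  refine (ENNReal.ofReal_le_ofReal (mul_le_mul_of_nonneg_left hsum hC.le)).trans_eq ?_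
  have hx0 : 0 ≤ x := by linarith
  rw [show C * (C₁ * ((ℓ ^ 2 + ℓ * x) / s + D.meanAbsR.toReal / s + ℓ * x ^ 2 * (D.gamma L).toReal))
      = C * C₁ * ((ℓ ^ 2 + ℓ * x) * (N : ℝ) ^ (-(1 / 2) : ℝ))
        + C * C₁ * (N : ℝ) ^ (-(1 / 2) : ℝ) * D.meanAbsR.toReal
        + C * C₁ * (ℓ * x ^ 2) * (D.gamma L).toReal by rw [hrs]; ring,
    ENNReal.ofReal_add (by positivity) (by positivity),
    ENNReal.ofReal_add (by positivity) (by positivity),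
    ENNReal.ofReal_mul (p := C * C₁ * (N : ℝ) ^ (-(1 / 2) : ℝ)) (by positivity),
    ENNReal.ofReal_mul (p := C * C₁ * (ℓ * x ^ 2)) (by positivity),
    ENNReal.ofReal_toReal hM, ENNReal.ofReal_toReal hG]

end Statistic

end WeakDependence

/-! ### Block lengths for exponential and polynomial mixing. -/

namespace WeakDependence

/-- With `ℓ = ⌈(28 / lam) log N⌉` the mixing coefficient is at most `K * N^{-28}`, and the spare
factor `N` absorbs `3 * K`. Then `ℓ ^ 2 + ℓ log N` is of order `log² N` and `ℓ log² N` of order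
`log³ N`. -/
theorem exists_normalDist_le_of_exponential {lam K ρ b' : ℝ} (hlam : 0 < lam)
    (hρ : 0 < ρ) (hb' : 0 < b') (N₀ : ℕ) : ∃ A : ℝ, 0 < A ∧
      ∀ (Ω : Type u) [MeasurableSpace Ω] (P : Measure Ω) [IsProbabilityMeasure P]
        (𝒳 : ℕ → Type v) [∀ j, MeasurableSpace (𝒳 j)]
        (D : ∀ N, Statistic P 𝒳 N) (b Sig : ℝ),
      (∀ N m : ℕ, 1 ≤ N → 1 ≤ m →
        phiMixing P (D N).X m ≤ K * Real.exp (-(lam * m))) →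
      MomentAssumptions D b' b N₀ ρ Sig →
      ∀ N : ℕ, 2 ≤ N →
        (D N).normalDist ≤
          ENNReal.ofReal (A * (N : ℝ) ^ (-(1 / 2) : ℝ) * Real.log N ^ 2)
            + ENNReal.ofReal (A * (N : ℝ) ^ (-(1 / 2) : ℝ)) * (D N).meanAbsR
            + ENNReal.ofReal (A * Real.log N ^ 3) * (D N).gamma (Real.log N ^ 3) := by
  obtain ⟨C, hC, N₁, hmain⟩ := Statistic.exists_normalDist_le_of_phiMixing.{u, v} hρ hb'
  set c := 28 / lam with hc
  have hc0 : 0 < c := by positivity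
  have hclam : c * lam = 28 := by rw [hc]; field_simp
  -- The last threshold gives `4 * (c + 1) ≤ log N`, which fits the required block length `4 * log N
  -- * ℓ` into `(log N) ^ 3`.
  set N₂ := max (max N₁ N₀) (max ⌈3 * K⌉₊ ⌈Real.exp (4 * (c + 1))⌉₊) with hN₂
  have hlog2 : 0 < Real.log 2 := Real.log_pos (by norm_num)
  -- The second summand makes the right side at least 1 for `2 ≤ N < N₂`, where the trivial bound
  -- for the distance is used.
  set A := C * (c + 2) ^ 2 + (N₂ : ℝ) ^ (1 / 2 : ℝ) / Real.log 2 ^ 2 with hA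
  have hA0 : 0 < A := by positivity
  have hA1 : C * (c + 2) ^ 2 ≤ A := le_add_of_nonneg_right (by positivity)
  refine ⟨A, hA0, ?_⟩
  intro Ω _ P _ 𝒳 _ D b Sig hφ hmom N hN
  have hN0 : (0 : ℝ) < N := by positivity
  by_cases hNN : N₂ ≤ N
  · have h1 : N₁ ≤ N := le_trans (by simp [hN₂]) hNN
    have h0 : N₀ ≤ N := le_trans (by simp [hN₂]) hNN
    have hK : 3 * K ≤ N := (Nat.le_ceil _).trans
      (by exact_mod_cast (le_trans (by simp [hN₂]) hNN : ⌈3 * K⌉₊ ≤ N))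
    have hNe : Real.exp (4 * (c + 1)) ≤ N := (Nat.le_ceil _).trans
      (by exact_mod_cast (le_trans (by simp [hN₂]) hNN : ⌈Real.exp (4 * (c + 1))⌉₊ ≤ N))
    set x := Real.log N with hx
    have hxc : 4 * (c + 1) ≤ x := (Real.le_log_iff_exp_le hN0).2 hNe
    have hx1 : 1 ≤ x := by linarith
    have hexp : Real.exp x = N := Real.exp_log hN0
    set ℓ := ⌈c * x⌉₊ with hℓ
    have hℓ1 : 1 ≤ ℓ := Nat.ceil_pos.2 (by positivity)
    have hℓx : c * x ≤ ℓ := Nat.le_ceil _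
    have hℓx' : (ℓ : ℝ) ≤ (c + 1) * x := by
      have := (Nat.ceil_lt_add_one (by positivity : 0 ≤ c * x)).le
      linarith
    have hmix : 3 * phiMixing P (D N).X ℓ ≤ ((N : ℝ) ^ 27)⁻¹ := by
      have h2 : Real.exp (-(lam * ℓ)) ≤ ((N : ℝ) ^ 28)⁻¹ := by
        rw [← hexp, ← Real.exp_nat_mul, ← Real.exp_neg]
        refine Real.exp_le_exp.2 (neg_le_neg ?_)
        push_cast
        nlinarith
      have hφ0 := phiMixing_nonneg (P := P) (D N).X ℓ
      have h3 := hφ N ℓ (by omega) hℓ1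
      have hK0 : 0 ≤ K := by
        by_contra hneg
        have := mul_neg_of_neg_of_pos (not_le.1 hneg) (Real.exp_pos (-(lam * ℓ)))
        linarith
      calc 3 * phiMixing P (D N).X ℓ ≤ 3 * (K * ((N : ℝ) ^ 28)⁻¹) := by
            refine mul_le_mul_of_nonneg_left (h3.trans ?_) (by norm_num)
            exact mul_le_mul_of_nonneg_left h2 hK0
        _ = 3 * K * ((N : ℝ) ^ 28)⁻¹ := by ring
        _ ≤ N * ((N : ℝ) ^ 28)⁻¹ := by gcongr
        _ = _ := by field_simp
    have hc2 : 1 ≤ (c + 2) ^ 2 := by nlinarith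
    refine (hmain P 𝒳 N (D N) ℓ (x ^ 3) h1 (hmom.variance_linear N (by omega) h0).1
      (hmom.third_moment N) hℓ1 hmix ?_).trans ?_
    · calc 4 * (x * ℓ) ≤ 4 * (x * ((c + 1) * x)) := by gcongr
        _ = 4 * (c + 1) * x ^ 2 := by ring
        _ ≤ x * x ^ 2 := by gcongr
        _ = _ := by ring
    · gcongr ENNReal.ofReal ?_ + ENNReal.ofReal ?_ * _ + ENNReal.ofReal ?_ * _
      · calc C * ((ℓ ^ 2 + ℓ * x) * (N : ℝ) ^ (-(1 / 2) : ℝ))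
            ≤ C * ((((c + 1) * x) ^ 2 + (c + 1) * x * x) * (N : ℝ) ^ (-(1 / 2) : ℝ)) := by gcongr
          _ = C * ((c + 1) * (c + 2)) * (N : ℝ) ^ (-(1 / 2) : ℝ) * x ^ 2 := by ring
          _ ≤ C * (c + 2) ^ 2 * (N : ℝ) ^ (-(1 / 2) : ℝ) * x ^ 2 := by
              gcongr; nlinarith
          _ ≤ _ := by gcongr
      · gcongr
        exact (le_mul_of_one_le_right hC.le hc2).trans hA1
      · calc C * (ℓ * x ^ 2) ≤ C * ((c + 1) * x * x ^ 2) := by gcongr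
          _ = C * (c + 1) * x ^ 3 := by ring
          _ ≤ C * (c + 2) ^ 2 * x ^ 3 := by gcongr; nlinarith
          _ ≤ _ := by gcongr
  · refine Statistic.normalDist_le_one.trans ?_
    rw [add_assoc]
    refine le_trans ?_ le_self_add
    rw [← ENNReal.ofReal_one]
    refine ENNReal.ofReal_le_ofReal ?_
    have hlog : Real.log 2 ≤ Real.log N := Real.log_le_log (by norm_num) (by exact_mod_cast hN)
    have hNr : 0 < (N : ℝ) ^ (1 / 2 : ℝ) := by positivity
    calc (1 : ℝ) = (N : ℝ) ^ (1 / 2 : ℝ) / Real.log 2 ^ 2 * (N : ℝ) ^ (-(1 / 2) : ℝ)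
          * Real.log 2 ^ 2 := by
            rw [Real.rpow_neg hN0.le]; field_simp
      _ ≤ (N₂ : ℝ) ^ (1 / 2 : ℝ) / Real.log 2 ^ 2 * (N : ℝ) ^ (-(1 / 2) : ℝ)
          * Real.log N ^ 2 := by
            have : (N : ℝ) ≤ N₂ := by exact_mod_cast (not_le.1 hNN).le
            gcongr
      _ ≤ _ := by
            gcongr
            exact le_add_of_nonneg_left (by positivity)

/-- With `y = N^{28/p}` and `ℓ = ⌈y⌉` one has `φ(ℓ) ≤ K * N^{-28}`, and `log N` is at most a
multiple of `y`. The worst factors, `ℓ log² N` and the block length, are then covered by `y ^ 3 =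
N^{84/p}`. -/
theorem exists_normalDist_le_of_polynomial {p K ρ b' : ℝ} (hp : 0 < p)
    (hρ : 0 < ρ) (hb' : 0 < b') (N₀ : ℕ) : ∃ A : ℝ, 0 < A ∧ ∀ ε : ℝ, 84 / p ≤ ε →
      ∀ (Ω : Type u) [MeasurableSpace Ω] (P : Measure Ω) [IsProbabilityMeasure P]
        (𝒳 : ℕ → Type v) [∀ j, MeasurableSpace (𝒳 j)]
        (D : ∀ N, Statistic P 𝒳 N) (b Sig : ℝ),
      (∀ N m : ℕ, 1 ≤ N → 1 ≤ m → phiMixing P (D N).X m ≤ K * (m : ℝ) ^ (-p)) →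
      MomentAssumptions D b' b N₀ ρ Sig →
      ∀ N : ℕ, 1 ≤ N →
        (D N).normalDist ≤
          ENNReal.ofReal (A * (N : ℝ) ^ (-(1 / 2) + 84 / p : ℝ))
            + ENNReal.ofReal (A * (N : ℝ) ^ (-(1 / 2) : ℝ)) * (D N).meanAbsR
            + ENNReal.ofReal (A * (N : ℝ) ^ (84 / p)) * (D N).gamma ((N : ℝ) ^ ε) := by
  obtain ⟨C, hC, N₁, hmain⟩ := Statistic.exists_normalDist_le_of_phiMixing.{u, v} hρ hb'
  set w := 28 / p with hw
  have hw0 : 0 < w := by positivity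
  have hwp : w * p = 28 := by rw [hw]; field_simp
  -- The last threshold gives `8 / w ≤ y`, so that the constant in `4 * log N * ℓ ≤ (8 / w) * y ^ 2`
  -- is absorbed by the third power of `y`.
  set N₂ := max (max N₁ N₀) (max ⌈3 * K⌉₊ ⌈(8 / w) ^ (1 / w)⌉₊) with hN₂
  set c := 4 + 2 / w + 2 / w ^ 2 with hc
  have hc1 : 1 ≤ c := by
    have : 0 ≤ 2 / w + 2 / w ^ 2 := by positivity
    linarith
  set A := C * c + (N₂ : ℝ) ^ (1 / 2 : ℝ) with hA
  have hA0 : 0 < A := by positivity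
  have hA1 : C * c ≤ A := le_add_of_nonneg_right (by positivity)
  refine ⟨A, hA0, ?_⟩
  intro ε hε Ω _ P _ 𝒳 _ D b Sig hφ hmom N hN
  have hN0 : (0 : ℝ) < N := by positivity
  have hN1 : (1 : ℝ) ≤ N := by exact_mod_cast hN
  by_cases hNN : N₂ ≤ N
  · have h1 : N₁ ≤ N := le_trans (by simp [hN₂]) hNN
    have h0 : N₀ ≤ N := le_trans (by simp [hN₂]) hNN
    have hK : 3 * K ≤ N := (Nat.le_ceil _).trans
      (by exact_mod_cast (le_trans (by simp [hN₂]) hNN : ⌈3 * K⌉₊ ≤ N))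
    have hNw : (8 / w) ^ (1 / w) ≤ N := (Nat.le_ceil _).trans
      (by exact_mod_cast (le_trans (by simp [hN₂]) hNN : ⌈(8 / w) ^ (1 / w)⌉₊ ≤ N))
    set x := Real.log N with hx
    have hx0 : 0 ≤ x := Real.log_nonneg hN1
    set y := (N : ℝ) ^ w with hy
    have hy1 : 1 ≤ y := Real.one_le_rpow hN1 hw0.le
    have hxy : x ≤ 1 / w * y := by
      rw [one_div_mul_eq_div]; exact Real.log_le_rpow_div hN0.le hw0
    have hy3 : (N : ℝ) ^ (84 / p) = y ^ 3 := by
      rw [hy, ← Real.rpow_natCast, ← Real.rpow_mul hN0.le, hw]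
      congr 1; push_cast; ring
    have hwy : 8 / w ≤ y := by
      have := Real.rpow_le_rpow (by positivity) hNw hw0.le
      rwa [← Real.rpow_mul (by positivity), one_div_mul_cancel hw0.ne', Real.rpow_one] at this
    set ℓ := ⌈y⌉₊ with hℓ
    have hℓ1 : 1 ≤ ℓ := Nat.ceil_pos.2 (by positivity)
    have hℓy : y ≤ ℓ := Nat.le_ceil _
    have hℓy' : (ℓ : ℝ) ≤ 2 * y := by
      have := (Nat.ceil_lt_add_one (by positivity : 0 ≤ y)).le
      linarith
    have hmix : 3 * phiMixing P (D N).X ℓ ≤ ((N : ℝ) ^ 27)⁻¹ := by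
      have h2 : (ℓ : ℝ) ^ (-p) ≤ ((N : ℝ) ^ 28)⁻¹ := by
        refine (Real.rpow_le_rpow_of_nonpos (by positivity) hℓy (by linarith)).trans_eq ?_
        rw [hy, ← Real.rpow_mul hN0.le, ← Real.rpow_natCast, ← Real.rpow_neg hN0.le]
        congr 1; push_cast; linarith
      have hφ0 := phiMixing_nonneg (P := P) (D N).X ℓ
      have h3 := hφ N ℓ hN hℓ1
      have hℓ0 : (0 : ℝ) < ℓ := by positivity
      have hK0 : 0 ≤ K := by
        by_contra hneg
        have := mul_neg_of_neg_of_pos (not_le.1 hneg) (Real.rpow_pos_of_pos hℓ0 (-p))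
        linarith
      calc 3 * phiMixing P (D N).X ℓ ≤ 3 * (K * ((N : ℝ) ^ 28)⁻¹) := by
            refine mul_le_mul_of_nonneg_left (h3.trans ?_) (by norm_num)
            exact mul_le_mul_of_nonneg_left h2 hK0
        _ = 3 * K * ((N : ℝ) ^ 28)⁻¹ := by ring
        _ ≤ N * ((N : ℝ) ^ 28)⁻¹ := by gcongr
        _ = _ := by field_simp
    refine (hmain P 𝒳 N (D N) ℓ ((N : ℝ) ^ ε) h1 (hmom.variance_linear N hN h0).1
      (hmom.third_moment N) hℓ1 hmix ?_).trans ?_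
    · calc 4 * (x * ℓ) ≤ 4 * (1 / w * y * (2 * y)) := by gcongr
        _ = 8 / w * y ^ 2 := by ring
        _ ≤ y * y ^ 2 := by gcongr
        _ = (N : ℝ) ^ (84 / p) := by rw [hy3]; ring
        _ ≤ _ := Real.rpow_le_rpow_of_exponent_le hN1 hε
    · have hw1 : 0 < 1 / w := by positivity
      gcongr ENNReal.ofReal ?_ + ENNReal.ofReal ?_ * _ + ENNReal.ofReal ?_ * _
      · rw [Real.rpow_add hN0, hy3]
        calc C * ((ℓ ^ 2 + ℓ * x) * (N : ℝ) ^ (-(1 / 2) : ℝ))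
            ≤ C * (((2 * y) ^ 2 + 2 * y * (1 / w * y)) * (N : ℝ) ^ (-(1 / 2) : ℝ)) := by gcongr
          _ = C * (4 + 2 / w) * ((N : ℝ) ^ (-(1 / 2) : ℝ) * y ^ 2) := by ring
          _ ≤ C * c * ((N : ℝ) ^ (-(1 / 2) : ℝ) * y ^ 3) := by
              gcongr
              · rw [hc]; exact le_add_of_nonneg_right (by positivity)
              · norm_num
          _ ≤ _ := by gcongr
      · gcongr
        exact (le_mul_of_one_le_right hC.le hc1).trans hA1
      · rw [hy3]
        calc C * (ℓ * x ^ 2) ≤ C * (2 * y * (1 / w * y) ^ 2) := by gcongr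
          _ = C * (2 / w ^ 2) * y ^ 3 := by field_simp
          _ ≤ C * c * y ^ 3 := by
              gcongr
              rw [hc]; exact le_add_of_nonneg_left (by positivity)
          _ ≤ _ := by gcongr
  · refine Statistic.normalDist_le_one.trans ?_
    rw [add_assoc]
    refine le_trans ?_ le_self_add
    rw [← ENNReal.ofReal_one]
    refine ENNReal.ofReal_le_ofReal ?_
    have hNr : 0 < (N : ℝ) ^ (1 / 2 : ℝ) := by positivity
    calc (1 : ℝ) = (N : ℝ) ^ (1 / 2 : ℝ) * (N : ℝ) ^ (-(1 / 2) : ℝ) := by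
            rw [Real.rpow_neg hN0.le]; field_simp
      _ ≤ A * (N : ℝ) ^ (-(1 / 2) + 84 / p : ℝ) := by
            have : (N : ℝ) ≤ N₂ := by exact_mod_cast (not_le.1 hNN).le
            have h2 : (N : ℝ) ^ (1 / 2 : ℝ) ≤ (N₂ : ℝ) ^ (1 / 2 : ℝ) := by gcongr
            have h3 : (N₂ : ℝ) ^ (1 / 2 : ℝ) ≤ A := le_add_of_nonneg_left (by positivity)
            have h4 : 0 ≤ 84 / p := by positivity
            refine mul_le_mul (h2.trans h3) ?_ (by positivity) hA0.le
            exact Real.rpow_le_rpow_of_exponent_le hN1 (by linarith)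

end WeakDependence

theorem theorem1 :
    -- polynomial mixing rates
    (∃ e p₀ : ℝ → ℝ, Tendsto e atTop (𝓝 0) ∧
      ∀ p K Sig ρ b' : ℝ, 0 < p → 0 < K → 0 < Sig → 0 < ρ → 0 < b' → ∀ N₀ : ℕ,
      ∃ A : ℝ, 0 < A ∧ ∀ ε : ℝ, 0 < ε → p₀ ε ≤ p →
      ∀ (Ω : Type u) [MeasurableSpace Ω] (P : Measure Ω) [IsProbabilityMeasure P]
        (𝒳 : ℕ → Type v) [∀ j, MeasurableSpace (𝒳 j)]
        (D : ∀ N, WeakDependence.Statistic P 𝒳 N) (b : ℝ),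
      (∀ N m : ℕ, 1 ≤ N → 1 ≤ m →
        WeakDependence.phiMixing P (D N).X m ≤ K * (m : ℝ) ^ (-p)) →
      WeakDependence.MomentAssumptions D b' b N₀ ρ Sig →
      ∀ N : ℕ, 1 ≤ N →
        (D N).normalDist ≤
          ENNReal.ofReal (A * (N : ℝ) ^ (-(1 / 2) + e p : ℝ))
            + ENNReal.ofReal (A * (N : ℝ) ^ (-(1 / 2) : ℝ)) * (D N).meanAbsR
            + ENNReal.ofReal (A * (N : ℝ) ^ (e p)) * (D N).gamma ((N : ℝ) ^ ε)) ∧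
    -- exponential mixing rates
    (∀ lam K Sig ρ b' : ℝ, 0 < lam → 0 < K → 0 < Sig → 0 < ρ → 0 < b' → ∀ N₀ : ℕ,
      ∃ A : ℝ, 0 < A ∧
      ∀ (Ω : Type u) [MeasurableSpace Ω] (P : Measure Ω) [IsProbabilityMeasure P]
        (𝒳 : ℕ → Type v) [∀ j, MeasurableSpace (𝒳 j)]
        (D : ∀ N, WeakDependence.Statistic P 𝒳 N) (b : ℝ),
      (∀ N m : ℕ, 1 ≤ N → 1 ≤ m →
        WeakDependence.phiMixing P (D N).X m ≤ K * Real.exp (-(lam * m))) →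
      WeakDependence.MomentAssumptions D b' b N₀ ρ Sig →
      ∀ N : ℕ, 2 ≤ N →
        (D N).normalDist ≤
          ENNReal.ofReal (A * (N : ℝ) ^ (-(1 / 2) : ℝ) * Real.log N ^ 2)
            + ENNReal.ofReal (A * (N : ℝ) ^ (-(1 / 2) : ℝ)) * (D N).meanAbsR
            + ENNReal.ofReal (A * Real.log N ^ 3) * (D N).gamma (Real.log N ^ 3)) := by
  -- The block length `N^{84/p}` must not exceed `N^ε`, that is, `p ≥ 84 / ε`.
  refine ⟨⟨fun p => 84 / p, fun ε => 84 / ε, tendsto_const_nhds.div_atTop tendsto_id, ?_⟩, ?_⟩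
  · intro p K Sig ρ b' hp _ _ hρ hb' N₀
    obtain ⟨A, hA, h⟩ := WeakDependence.exists_normalDist_le_of_polynomial.{u, v} (K := K) hp hρ hb' N₀
    refine ⟨A, hA, fun ε hε hpε Ω _ P _ 𝒳 _ D b hφ hmom N hN => ?_⟩
    refine h ε ?_ Ω P 𝒳 D b Sig hφ hmom N hN
    rw [div_le_iff₀ hε] at hpε
    rwa [div_le_iff₀ hp, mul_comm]
  · intro lam K Sig ρ b' hlam _ _ hρ hb' N₀
    obtain ⟨A, hA, h⟩ :=
      WeakDependence.exists_normalDist_le_of_exponential.{u, v} (K := K) hlam hρ hb' N₀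
    exact ⟨A, hA, fun Ω _ P _ 𝒳 _ D b hφ hmom N hN => h Ω P 𝒳 D b Sig hφ hmom N hN⟩
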